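/- **Conventions.** $\mathbb R^8_1$ is $\mathbb R^8$ with $\langle x,y\rangle=-x_0y_0+\sum_{j=1}^7x_jy_j$, extended complex bilinearly to $\mathbb C^8$. For a smooth conformal immersion $y$ of a Riemann surface into $S^6\subset\mathbb R^7$ and a local complex coordinate $z=u+iv$, put $e^{2\omega}=2\langle y_z,y_{\bar z}\rangle$ and $Y=e^{-\omega}(1,y)$ (canonical lift), $V=\mathrm{Span}_{\mathbb R}\{Y,\mathrm{Re}\,Y_z,\mathrm{Im}\,Y_z,Y_{z\bar z}\}$, and let $N\in V$ be given by $\langle N,Y_z\rangle=\langle N,Y_{\bar z}\rangle=\langle N,N\rangle=0$, $\langle N,Y\rangle=-1$. Let $D$ be the normal connection on $V^\perp_{\mathbb C}$, and define $\kappa\in V^\perp_{\mathbb C}$ and $s$ by $Y_{zz}=-\frac s2Y+\kappa$. The surface is *Willmore* if $D_{\bar z}D_{\bar z}\kappa+\frac{\bar s}2\kappa=0$; a Willmore surface is *S-Willmore* if $D_{\bar z}\kappa$ and $\kappa$ are linearly dependent at every point; $y$ is *totally isotropic* if $\langle\partial_z^mY,\partial_z^nY\rangle=0$ for all $m,n\ge1$;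 it is *full* if its image lies in no affine hyperplane of $\mathbb R^7$. Its conformal Gauss map is $Gr=Y\wedge Y_u\wedge Y_v\wedge N$, a map into $SO^+(1,7)/SO^+(1,3)\times SO(4)$. Let $\eta=\lambda^{-1}\begin{pmatrix}0&\hat B_1\\-\hat B_1^tI_{1,3}&0\end{pmatrix}dz$ with $\hat B_1$ polynomial in $z\in\mathbb C$, $\lambda\in S^1$, $I_{1,3}=\mathrm{diag}(-1,1,1,1)$, and let $H$ solve $H^{-1}dH=\eta$, $H(0,\lambda)=I$. Loops are twisted by $\sigma(A)=DAD^{-1}$, $D=\mathrm{diag}(-I_4,I_4)$, i.e. $A(-\lambda)=DA(\lambda)D^{-1}$. An extended frame of $\eta$ on $\mathbb C$ is a map $F(z,\lambda)$, smooth in $z$, with $F(0,\lambda)=I$, such that $F(z,\cdot)$ is a continuous twisted loop in $SO^+(1,7)$ and $H=FF_+$ (Iwasawa decomposition), where $F_+(z,\cdot)$ is a twisted loop in $SO(1,7,\mathbb C)$ which extends continuously to the closed unit disk and holomorphically to its interior, with values in $SO(1,7,\mathbb C)$ and with $F_+(z,0)\in SO(1,3,\mathbb C)\times SO(4,\mathbb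 C)$. A family $(y_\lambda)_{\lambda\in S^1}$ of conformal immersions $\mathbb C\to S^6$ is an *associated family corresponding to $\eta$* if there is an extended frame $F$ of $\eta$ such that for every $\lambda$ the conformal Gauss map of $y_\lambda$ is the harmonic map defined by $F(\cdot,\lambda)$, i.e. the wedge product of the first four columns of $F(\cdot,\lambda)$. **Theorem.** Let $$\hat B_1=\frac12\begin{pmatrix}2iz&-2z&-i&1\\-2iz&2z&-i&1\\-2&-2i&-z&-iz\\2i&-2&-iz&z\end{pmatrix}.$$ There are maps $x_\lambda:S^2=\mathbb C\cup\{\infty\}\to S^6$, $\lambda\in S^1$, given for $z\in\mathbb C$, $r=|z|$, by $$x_\lambda(z)=\frac1{1+r^2+\frac{5r^4}4+\frac{4r^6}9+\frac{r^8}{36}}\begin{pmatrix}1-r^2-\frac{3r^4}4+\frac{4r^6}9-\frac{r^8}{36}\\-i(z-\bar z)(1+\frac{r^6}9)\\(z+\bar z)(1+\frac{r^6}9)\\-i(\lambda^{-1}z^2-\lambda\bar z^2)(1-\frac{r^4}{12})\\(\lambda^{-1}z^2+\lambda\bar z^2)(1-\frac{r^4}{12})\\-i\frac{r^2}2(\lambda^{-1}z-\lambda\bar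 z)(1+\frac{4r^2}3)\\\frac{r^2}2(\lambda^{-1}z+\lambda\bar z)(1+\frac{4r^2}3)\end{pmatrix},$$ such that: 1. the restrictions of the $x_\lambda$ to $\mathbb C$ form an associated family corresponding to $\eta$, and it is the only one; 2. for every $\lambda\in S^1$, $x_\lambda$ is a smooth, unbranched, conformal Willmore immersion of $S^2$ into $S^6$ which is full, totally isotropic and not S-Willmore (so not every Willmore two-sphere is S-Willmore, which answers Ejiri's question); 3. for all $\lambda,\mu\in S^1$ there is a linear isometry $A$ of $\mathbb R^7$ with $x_\mu=A\circ x_\lambda$. -/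

import Mathlib

open scoped ContDiff Manifold

noncomputable section

namespace WillmoreTwoSphere

open Complex

/-! ### The two-sphere as a Riemann surface -/

/-- The unit two-sphere. -/
abbrev S2 : Type := Metric.sphere (0 : EuclideanSpace ℝ (Fin 3)) 1

/-- The unit six-sphere. -/
abbrev S6 : Type := Metric.sphere (0 : EuclideanSpace ℝ (Fin 7)) 1

/-- Inverse stereographic projection from the north pole: the coordinate `z ∈ ℂ` on the sphere
without its north pole, which is the point `z = ∞`. -/
def chartZero (z : ℂ) : S2 :=
  ⟨!₂[2 * z.re / (1 + normSq z), 2 * z.im / (1 + normSq z), (normSq z - 1) / (1 + normSq z)], by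
    have h : 0 < 1 + normSq z := by have := normSq_nonneg z; linarith
    rw [mem_sphere_zero_iff_norm, EuclideanSpace.norm_eq, Real.sqrt_eq_one]
    simp only [Fin.sum_univ_three, Real.norm_eq_abs, sq_abs]
    simp
    field_simp
    rw [normSq_apply]
    ring⟩

/-- The coordinate `w = 1 / z` around the north pole, which is the point `w = 0`. -/
def chartInfty (w : ℂ) : S2 :=
  ⟨!₂[2 * w.re / (1 + normSq w), -2 * w.im / (1 + normSq w), (1 - normSq w) / (1 + normSq w)], by
    have h : 0 < 1 + normSq w := by have := normSq_nonneg w; linarith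
    rw [mem_sphere_zero_iff_norm, EuclideanSpace.norm_eq, Real.sqrt_eq_one]
    simp only [Fin.sum_univ_three, Real.norm_eq_abs, sq_abs]
    simp
    field_simp
    rw [normSq_apply]
    ring⟩

/-- The transition map between the two coordinates is `w ↦ 1 / w`. -/
theorem chartInfty_eq (w : ℂ) (hw : w ≠ 0) : chartInfty w = chartZero w⁻¹ := by
  have h : 0 < normSq w := normSq_pos.mpr hw
  have h1 : 0 < 1 + normSq w := by linarith
  apply Subtype.ext
  ext j
  fin_cases j <;> simp [chartInfty, chartZero] <;> field_simp <;> ring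

/-- A map of the two-sphere into `S⁶` read in the coordinate given by `φ`. -/
def inCoord (φ : ℂ → S2) (X : S2 → S6) : ℂ → EuclideanSpace ℝ (Fin 7) :=
  fun z => (X (φ z) : EuclideanSpace ℝ (Fin 7))

/-- A local property holds on the two-sphere if it holds in the two complex coordinates `z` and
`1 / z`, which form its holomorphic atlas. -/
def InAtlas (P : (ℂ → EuclideanSpace ℝ (Fin 7)) → Prop) (X : S2 → S6) : Prop :=
  P (inCoord chartZero X) ∧ P (inCoord chartInfty X)

/-! ### Conformal surface theory in the light cone model -/

/-- The Lorentzian bilinear form on `ℝ⁸₁`, extended complex bilinearly to `ℂ⁸`. -/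
def lorentz (x y : Fin 8 → ℂ) : ℂ := -(x 0 * y 0) + ∑ j : Fin 7, x j.succ * y j.succ

/-- The Wirtinger derivative `∂/∂z`. -/
def dz (f : ℂ → Fin 8 → ℂ) (z : ℂ) : Fin 8 → ℂ :=
  (1 / 2 : ℂ) • (fderiv ℝ f z 1 - I • fderiv ℝ f z I)

/-- The Wirtinger derivative `∂/∂z̄`. -/
def dzbar (f : ℂ → Fin 8 → ℂ) (z : ℂ) : Fin 8 → ℂ :=
  (1 / 2 : ℂ) • (fderiv ℝ f z 1 + I • fderiv ℝ f z I)

/-- The lift `(1, y)` of a map into `S⁶` to the light cone. Since its first entry is constant,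
`⟨(1, y)_z, (1, y)_z⟩` and `⟨(1, y)_z, (1, y)_z̄⟩` are `⟨y_z, y_z⟩` and `⟨y_z, y_z̄⟩`. -/
def coneLift (y : ℂ → EuclideanSpace ℝ (Fin 7)) (z : ℂ) : Fin 8 → ℂ :=
  Fin.cons 1 fun j => ((y z j : ℝ) : ℂ)

/-- `y` is a smooth conformal immersion of `ℂ` into `S⁶`. -/
structure IsConformalImmersion (y : ℂ → EuclideanSpace ℝ (Fin 7)) : Prop where
  smooth : ContDiff ℝ ∞ y
  mem_sphere : ∀ z, ‖y z‖ = 1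
  immersion : ∀ z, Function.Injective (fderiv ℝ y z)
  conformal : ∀ z, lorentz (dz (coneLift y) z) (dz (coneLift y) z) = 0

/-- `e^{2ω} = 2 ⟨y_z, y_z̄⟩`. -/
def conformalFactor (y : ℂ → EuclideanSpace ℝ (Fin 7)) (z : ℂ) : ℝ :=
  (2 * lorentz (dz (coneLift y) z) (dzbar (coneLift y) z)).re

/-- The canonical lift `Y = e^{-ω} (1, y)`. -/
def canonicalLift (y : ℂ → EuclideanSpace ℝ (Fin 7)) (z : ℂ) : Fin 8 → ℂ :=
  (((Real.sqrt (conformalFactor y z))⁻¹ : ℝ) : ℂ) • coneLift y z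

/-- The section `N` of `V = Span {Y, Re Y_z, Im Y_z, Y_zz̄}` with
`⟨N, Y_z⟩ = ⟨N, Y_z̄⟩ = ⟨N, N⟩ = 0` and `⟨N, Y⟩ = -1`, namely
`N = 2 Y_zz̄ + 2 ⟨Y_zz̄, Y_zz̄⟩ Y`. -/
def lightlikeN (y : ℂ → EuclideanSpace ℝ (Fin 7)) (z : ℂ) : Fin 8 → ℂ :=
  let Y := canonicalLift y
  let Yzzbar := dzbar (dz Y)
  (2 : ℂ) • Yzzbar z + (2 * lorentz (Yzzbar z) (Yzzbar z)) • Y z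

/-- The orthogonal projection of `ℂ⁸` onto the complexified conformal normal space `V^⊥` at `z`,
written in the frame `Y, Y_z, Y_z̄, N` of the complexification of `V`, whose only nonzero products
are `⟨Y, N⟩ = -1` and `⟨Y_z, Y_z̄⟩ = 1 / 2`. -/
def normalPart (y : ℂ → EuclideanSpace ℝ (Fin 7)) (z : ℂ) (w : Fin 8 → ℂ) : Fin 8 → ℂ :=
  let Y := canonicalLift y
  w + lorentz w (lightlikeN y z) • Y z + lorentz w (Y z) • lightlikeN y z
    - (2 * lorentz w (dzbar Y z)) • dz Y z - (2 * lorentz w (dz Y z)) • dzbar Y z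

/-- The conformal Hopf differential `κ`: the normal part of `Y_zz`. -/
def hopf (y : ℂ → EuclideanSpace ℝ (Fin 7)) (z : ℂ) : Fin 8 → ℂ :=
  normalPart y z (dz (dz (canonicalLift y)) z)

/-- The Schwarzian `s`, defined by `Y_zz = -(s / 2) Y + κ`. -/
def schwarzian (y : ℂ → EuclideanSpace ℝ (Fin 7)) (z : ℂ) : ℂ :=
  2 * lorentz (dz (dz (canonicalLift y)) z) (lightlikeN y z)

/-- The derivative `D_z̄` of the normal connection. -/
def normalDzbar (y : ℂ → EuclideanSpace ℝ (Fin 7)) (ψ : ℂ → Fin 8 → ℂ) (z : ℂ) : Fin 8 → ℂ :=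
  normalPart y z (dzbar ψ z)

/-- The Willmore equation `D_z̄ D_z̄ κ + (s̄ / 2) κ = 0`. -/
def WillmoreEquation (y : ℂ → EuclideanSpace ℝ (Fin 7)) : Prop :=
  ∀ z, normalDzbar y (normalDzbar y (hopf y)) z
    + (starRingEnd ℂ (schwarzian y z) / 2) • hopf y z = 0

/-- A smooth conformal unbranched immersion of the two-sphere into `S⁶` which satisfies the
Willmore equation. -/
structure IsWillmoreImmersion (X : S2 → S6) : Prop where
  smooth : ContMDiff (𝓡 2) (𝓡 6) ∞ X
  immersion : ∀ p, Function.Injective (mfderiv (𝓡 2) (𝓡 6) X p)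
  conformal : InAtlas IsConformalImmersion X
  willmore : InAtlas WillmoreEquation X

/-- A Willmore immersion is S-Willmore if `D_z̄ κ` and `κ` are everywhere parallel. -/
def IsSWillmore (X : S2 → S6) : Prop :=
  IsWillmoreImmersion X ∧
    InAtlas (fun y => ∀ z, ¬ LinearIndependent ℂ ![hopf y z, normalDzbar y (hopf y) z]) X

/-- Total isotropy: `⟨Y_z^{(m)}, Y_z^{(n)}⟩ = 0` for all `m, n ≥ 1`. -/
def IsTotallyIsotropic (X : S2 → S6) : Prop :=
  InAtlas (fun y => ∀ m n : ℕ, 1 ≤ m → 1 ≤ n → ∀ z,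
    lorentz (dz^[m] (canonicalLift y) z) (dz^[n] (canonicalLift y) z) = 0) X

/-- A surface in `S⁶` is full if it lies in no proper (great or small) subsphere, i.e. in no
affine hyperplane of `ℝ⁷`. -/
def IsFull (X : S2 → S6) : Prop :=
  affineSpan ℝ (Set.range fun p => (X p : EuclideanSpace ℝ (Fin 7))) = ⊤

/-- The conformal Gauss map `Gr = Y ∧ Y_u ∧ Y_v ∧ N`, `z = u + i v`, as a decomposable 4-vector;
it describes the oriented Lorentzian 4-space `V`. -/
def conformalGaussMap (y : ℂ → EuclideanSpace ℝ (Fin 7)) (z : ℂ) : ExteriorAlgebra ℂ (Fin 8 → ℂ) :=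
  ExteriorAlgebra.ιMulti ℂ 4
    ![canonicalLift y z, fderiv ℝ (canonicalLift y) z 1, fderiv ℝ (canonicalLift y) z I,
      lightlikeN y z]

/-! ### Surfaces from normalized potentials -/

/-- `I_{1,3} = diag(-1, 1, 1, 1)`. -/
def I13 : Matrix (Fin 4) (Fin 4) ℂ := Matrix.diagonal ![-1, 1, 1, 1]

/-- `I_{1,7} = diag(-1, 1, …, 1)`. -/
def I17 (R : Type*) [CommRing R] : Matrix (Fin 8) (Fin 8) R :=
  Matrix.diagonal (Fin.cons (-1) fun _ : Fin 7 => 1)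

/-- `D = diag(-I₄, I₄)`, which induces the involution `σ(A) = D A D⁻¹` (and `D⁻¹ = D`). -/
def involD (R : Type*) [CommRing R] : Matrix (Fin 8) (Fin 8) R :=
  Matrix.diagonal ![-1, -1, -1, -1, 1, 1, 1, 1]

/-- The element `(0, B; -Bᵗ I_{1,3}, 0)` of the complexification of `𝔭`. -/
def offDiagonal (B : Matrix (Fin 4) (Fin 4) ℂ) : Matrix (Fin 8) (Fin 8) ℂ :=
  Matrix.reindex finSumFinEquiv finSumFinEquiv
    (Matrix.fromBlocks 0 B (-(B.transpose * I13)) 0)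

/-- `F(·, λ)`, `λ ∈ S¹`, is the extended frame with `F(0, λ) = I` obtained on all of `ℂ` from the
normalized potential `η = λ⁻¹ (0, B; -Bᵗ I_{1,3}, 0) dz`: the solution `H` of `H⁻¹ dH = η`,
`H(0, λ) = I`, has the Iwasawa decomposition `H = F F₊`, in which `F` is a `σ`-twisted loop in
`SO⁺(1, 7)` and `F₊` is a `σ`-twisted loop in `SO(1, 7, ℂ)` that extends holomorphically to the
unit disk and whose value at `λ = 0` lies in `SO(1, 3, ℂ) × SO(4, ℂ)`. -/
structure IsExtendedFrame (B : ℂ → Matrix (Fin 4) (Fin 4) ℂ)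
    (H : ℂ → Circle → Matrix (Fin 8) (Fin 8) ℂ) (F : ℂ → Circle → Matrix (Fin 8) (Fin 8) ℝ)
    (Fplus : ℂ → ℂ → Matrix (Fin 8) (Fin 8) ℂ) : Prop where
  hol_init : ∀ l, H 0 l = 1
  hol_deriv : ∀ l z i j, HasDerivAt (fun w => H w l i j)
    ((H z l * ((l : ℂ)⁻¹ • offDiagonal (B z))) i j) z
  iwasawa : ∀ z (l : Circle), H z l = (F z l).map ofReal * Fplus z (l : ℂ)
  frame_init : ∀ l, F 0 l = 1
  frame_smooth : ∀ l i j, ContDiff ℝ ∞ (fun z => F z l i j)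
  frame_continuous : ∀ z, Continuous (F z)
  frame_orthogonal : ∀ z l, (F z l).transpose * I17 ℝ * F z l = I17 ℝ
  frame_det : ∀ z l, (F z l).det = 1
  frame_orthochronous : ∀ z l, 0 < F z l 0 0
  frame_twisted : ∀ z l, F z (-l) = involD ℝ * F z l * involD ℝ
  plus_hol : ∀ z i j, DiffContOnCl ℂ (fun l => Fplus z l i j) (Metric.ball 0 1)
  plus_orthogonal : ∀ z, ∀ l ∈ Metric.closedBall (0 : ℂ) 1,
    (Fplus z l).transpose * I17 ℂ * Fplus z l = I17 ℂ
  plus_det : ∀ z, ∀ l ∈ Metric.closedBall (0 : ℂ) 1, (Fplus z l).det = 1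
  plus_twisted : ∀ z, ∀ l ∈ Metric.closedBall (0 : ℂ) 1,
    Fplus z (-l) = involD ℂ * Fplus z l * involD ℂ
  plus_zero : ∀ z, ((Fplus z 0).submatrix (Fin.castAdd 4 : Fin 4 → Fin 8)
    (Fin.castAdd 4 : Fin 4 → Fin 8)).det = 1

/-- `y_λ`, `λ ∈ S¹`, is an associated family of surfaces corresponding to the normalized potential
`η = λ⁻¹ (0, B; -Bᵗ I_{1,3}, 0) dz` on `ℂ`: every `y_λ` is a conformal immersion, and its conformal
Gauss map is the harmonic map into `SO⁺(1, 7) / SO⁺(1, 3) × SO(4)` which `η` generates, that is,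
the oriented span of the first four columns of the extended frame `F(·, λ)`. -/
def IsAssociatedFamily (B : ℂ → Matrix (Fin 4) (Fin 4) ℂ)
    (y : Circle → ℂ → EuclideanSpace ℝ (Fin 7)) : Prop :=
  (∀ l, IsConformalImmersion (y l)) ∧
    ∃ H F Fplus, IsExtendedFrame B H F Fplus ∧
      ∀ l z, conformalGaussMap (y l) z =
        ExteriorAlgebra.ιMulti ℂ 4 (fun k : Fin 4 => fun i : Fin 8 =>
          ((F z l i (Fin.castAdd 4 k) : ℝ) : ℂ))

/-! ### The example -/

/-- The polynomial block `B̂₁` of the potential. -/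
def exampleB (z : ℂ) : Matrix (Fin 4) (Fin 4) ℂ :=
  (1 / 2 : ℂ) •
    !![2 * I * z, -2 * z, -I, 1;
       -2 * I * z, 2 * z, -I, 1;
       -2, -2 * I, -z, -I * z;
       2 * I, -2, -I * z, z]

/-- The explicit formula for `x_λ(z)`; here `c = z̄` and `r = |z|`. -/
def exampleFormula (l z : ℂ) : Fin 7 → ℂ :=
  let c : ℂ := starRingEnd ℂ z
  let r : ℂ := ((‖z‖ : ℝ) : ℂ)
  (1 + r ^ 2 + 5 * r ^ 4 / 4 + 4 * r ^ 6 / 9 + r ^ 8 / 36)⁻¹ •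
    ![1 - r ^ 2 - 3 * r ^ 4 / 4 + 4 * r ^ 6 / 9 - r ^ 8 / 36,
      -I * ((z - c) * (1 + r ^ 6 / 9)),
      (z + c) * (1 + r ^ 6 / 9),
      -I * ((l⁻¹ * z ^ 2 - l * c ^ 2) * (1 - r ^ 4 / 12)),
      (l⁻¹ * z ^ 2 + l * c ^ 2) * (1 - r ^ 4 / 12),
      -I * (r ^ 2 / 2) * (l⁻¹ * z - l * c) * (1 + 4 * r ^ 2 / 3),
      (r ^ 2 / 2) * (l⁻¹ * z + l * c) * (1 + 4 * r ^ 2 / 3)]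

end WillmoreTwoSphere

end

/-! Everything is read off from two polynomial curves `h₀`, `h₁` in `ℂ⁸` (`frameZero`; `frameInfty`
at infinity). At every point `h₀, h₁, h₀', h₁'` span a maximal isotropic 4-space `U`, so `U` equals
its own orthogonal complement. The lightlike lift of the surface is real and orthogonal to `U`,
hence lies in `U` and in its conjugate `Ū`.

Geometry (`IsIsotropicFrame`). The conjugate frame is antiholomorphic, so orthogonality to `Ū`
survives `∂_z`; all `∂_z^m Y` lie in the isotropic space `Ū`, which gives conformality and total
isotropy at once. Each `hᵢ` is a normal field, and `h₀, h₁, h̄₀, h̄₁` frame the complexified normal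
bundle because their Gram determinant does not vanish. The Hopf differential `κ` lies in the span of
`h̄₀, h̄₁`, a bundle preserved by `D_z̄`. The Willmore equation therefore only has to be tested
against `hᵢ`. Since `⟨κ, hᵢ⟩ = ⟨Y, hᵢ''⟩` and `hᵢ''` is holomorphic, the test reads `⟨Y_z̄z̄ +
(s̄/2) Y, hᵢ''⟩ = 0`, that is `⟨κ̄, hᵢ''⟩ = 0`. This holds because `κ̄` lies in the span of `h₀, h₁`
and `⟨hᵢ, hⱼ''⟩ = 0` (`willmoreEquation`). A 2×2 determinant at `z = 0` shows that `κ` and `D_z̄ κ`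
are independent there, so the surface is not S-Willmore. Absence of branch points is the positivity
of the coefficients of a polynomial in `|z|²`, in both charts.

Associated family. Let `R_l` be the simultaneous rotation of the planes `e₄, e₅` and `e₆, e₇`. It
grades `ℂ⁸` by weights `1, 0, -1`, and the potential at `λ = 1` lowers weights by one, so
conjugation by `R_l` multiplies it by `l⁻¹`. Hence `H` at `λ = l` is the conjugate by `R_l` of the
explicit `initialSolution`. The frame `F` at `λ = 1` consists of `Y ± N/2, Y_v, Y_u` and the real
and imaginary parts of a unitary version of `h₀, h₁`. Both `H` and `F` map the weight-one space onto
the span of `h₀, h₁`, so `F⁻¹H` preserves that space. Its conjugate by `R_l` then has no negative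
powers of `l` (`conjLoop_eq`) and serves as `F₊`. All members of the family are rotations of one
surface.

Uniqueness. Two extended frames of one potential share `H`, so `F⁻¹F'` is holomorphic in the disk
and real on the circle, hence constant in `λ`; twisting and the normalization at `λ = 0` make it
block diagonal with upper block of determinant one (`frame_eq`, `ιMulti_eq`). So the Gauss map is
determined by the potential. A surface with the same Gauss map has its lift orthogonal to the same
`U`; two lightlike lifts in one isotropic space have product zero, which for points of the sphere
means equality (`eq_of_perp`). -/

namespace WillmoreTwoSphere

open Complex

/-! ### Wirtinger derivatives -/

section Wirtinger

variable {E E' : Type*} [NormedAddCommGroup E] [NormedSpace ℂ E] [NormedAddCommGroup E']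
  [NormedSpace ℂ E']

/-- The first order operator `(∂_u + a ∂_v) / 2`; it is `∂/∂z` for `a = -i`, and `∂/∂z̄` for
`a = i`. -/
noncomputable def wirtinger (a : ℂ) (f : ℂ → E) (z : ℂ) : E :=
  (1 / 2 : ℂ) • (fderiv ℝ f z 1 + a • fderiv ℝ f z I)

theorem dz_eq_wirtinger (f : ℂ → Fin 8 → ℂ) : dz f = wirtinger (-I) f := by
  ext z i
  simp [dz, wirtinger, sub_eq_add_neg]

theorem dzbar_eq_wirtinger (f : ℂ → Fin 8 → ℂ) : dzbar f = wirtinger I f := rfl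

theorem contDiff_wirtinger {f : ℂ → E} (hf : ContDiff ℝ ∞ f) (a : ℂ) :
    ContDiff ℝ ∞ (wirtinger a f) := by
  have h : ∀ v : ℂ, ContDiff ℝ ∞ fun z => fderiv ℝ f z v := fun v =>
    (hf.fderiv_right (by norm_num)).clm_apply contDiff_const
  exact ((h 1).add ((h I).const_smul a)).const_smul _

theorem fderiv_wirtinger {f : ℂ → E} (hf : ContDiff ℝ ∞ f) (a z v : ℂ) :
    fderiv ℝ (wirtinger a f) z v = (1 / 2 : ℂ) •
      (fderiv ℝ (fderiv ℝ f) z v 1 + a • fderiv ℝ (fderiv ℝ f) z v I) := by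
  have hd : DifferentiableAt ℝ (fderiv ℝ f) z :=
    ((hf.fderiv_right (m := ∞) (by norm_num)).differentiable (by norm_num)) z
  have h : ∀ w : ℂ, HasFDerivAt (fun z => fderiv ℝ f z w)
      ((fderiv ℝ (fderiv ℝ f) z).flip w) z := fun w => by
    have := hd.hasFDerivAt.clm_apply (hasFDerivAt_const w z)
    simpa using this
  have := ((h 1).add ((h I).const_smul a)).const_smul (1 / 2 : ℂ)
  have h2 : HasFDerivAt (wirtinger a f) _ z := this
  rw [h2.fderiv]
  simp

theorem wirtinger_comm {f : ℂ → E} (hf : ContDiff ℝ ∞ f) (a b z : ℂ) :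
    wirtinger a (wirtinger b f) z = wirtinger b (wirtinger a f) z := by
  have hs : fderiv ℝ (fderiv ℝ f) z 1 I = fderiv ℝ (fderiv ℝ f) z I 1 :=
    (hf.contDiffAt.isSymmSndFDerivAt (by simpa using WithTop.coe_le_coe.2 (le_top : (2 : ℕ∞) ≤ ⊤))).eq 1 I
  rw [wirtinger, wirtinger, fderiv_wirtinger hf, fderiv_wirtinger hf, fderiv_wirtinger hf,
    fderiv_wirtinger hf, hs]
  module

theorem wirtinger_add {f g : ℂ → E} {z : ℂ} (hf : DifferentiableAt ℝ f z)
    (hg : DifferentiableAt ℝ g z) (a : ℂ) :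
    wirtinger a (fun z => f z + g z) z = wirtinger a f z + wirtinger a g z := by
  have : (fun z => f z + g z) = f + g := rfl
  simp only [wirtinger, this, fderiv_add hf hg, add_apply]
  module

theorem wirtinger_sub {f g : ℂ → E} {z : ℂ} (hf : DifferentiableAt ℝ f z)
    (hg : DifferentiableAt ℝ g z) (a : ℂ) :
    wirtinger a (fun z => f z - g z) z = wirtinger a f z - wirtinger a g z := by
  have : (fun z => f z - g z) = f - g := rfl
  simp only [wirtinger, this, fderiv_sub hf hg, sub_apply]
  module

theorem wirtinger_smul {s : ℂ → ℂ} {f : ℂ → E} {z : ℂ} (hs : DifferentiableAt ℝ s z)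
    (hf : DifferentiableAt ℝ f z) (a : ℂ) :
    wirtinger a (fun z => s z • f z) z = wirtinger a s z • f z + s z • wirtinger a f z := by
  have h := (hs.hasFDerivAt.smul hf.hasFDerivAt).fderiv
  have : (fun z => s z • f z) = s • f := rfl
  simp only [wirtinger, this, h]
  simp only [add_apply, smul_apply,
    ContinuousLinearMap.smulRight_apply, smul_eq_mul]
  module

theorem wirtinger_mul {f g : ℂ → ℂ} {z : ℂ} (hf : DifferentiableAt ℝ f z)
    (hg : DifferentiableAt ℝ g z) (a : ℂ) :
    wirtinger a (fun z => f z * g z) z = wirtinger a f z * g z + f z * wirtinger a g z :=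
  wirtinger_smul hf hg a

theorem wirtinger_const (c : E) (a z : ℂ) : wirtinger a (fun _ => c) z = 0 := by
  simp [wirtinger]

theorem wirtinger_neg (f : ℂ → E) (a z : ℂ) :
    wirtinger a (fun z => -f z) z = -wirtinger a f z := by
  simp only [wirtinger, fderiv_fun_neg, neg_apply]
  module

theorem wirtinger_clm (A : E →L[ℂ] E') {f : ℂ → E} {z : ℂ} (hf : DifferentiableAt ℝ f z)
    (a : ℂ) : wirtinger a (fun z => A (f z)) z = A (wirtinger a f z) := by
  have h := ((A.restrictScalars ℝ).hasFDerivAt.comp z hf.hasFDerivAt).fderiv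
  have : (fun z => A (f z)) = (A.restrictScalars ℝ) ∘ f := rfl
  rw [wirtinger, this, h, wirtinger]
  simp

theorem wirtinger_pi {n : ℕ} {f : ℂ → Fin n → ℂ} {z : ℂ} (hf : DifferentiableAt ℝ f z) (a : ℂ)
    (i : Fin n) : wirtinger a f z i = wirtinger a (fun z => f z i) z :=
  (wirtinger_clm (ContinuousLinearMap.proj (R := ℂ) i) hf a).symm

theorem wirtinger_id (a z : ℂ) : wirtinger a (fun z => z) z = (1 + a * I) / 2 := by
  simp [wirtinger]
  ring

theorem wirtinger_conj_id (a z : ℂ) :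
    wirtinger a (fun z => starRingEnd ℂ z) z = (1 - a * I) / 2 := by
  have h : fderiv ℝ (fun z => starRingEnd ℂ z) z = conjCLE := conjCLE.hasFDerivAt.fderiv
  simp only [wirtinger, h]
  simp
  ring

theorem wirtinger_star {f : ℂ → Fin 8 → ℂ} {z : ℂ} (hf : DifferentiableAt ℝ f z) (a : ℂ) :
    wirtinger a (fun z => star (f z)) z = star (wirtinger (starRingEnd ℂ a) f z) := by
  have h := ((starL' ℝ (A := Fin 8 → ℂ)).hasFDerivAt.comp z hf.hasFDerivAt).fderiv
  have : (fun z => star (f z)) = (starL' ℝ (A := Fin 8 → ℂ)) ∘ f := rfl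
  rw [wirtinger, this, h, wirtinger]
  ext i
  simp [mul_add]

end Wirtinger

/-! ### The Lorentzian form -/

theorem lorentz_comm (x y : Fin 8 → ℂ) : lorentz x y = lorentz y x := by
  simp only [lorentz, mul_comm]

theorem lorentz_add_left (x y w : Fin 8 → ℂ) :
    lorentz (x + y) w = lorentz x w + lorentz y w := by
  simp only [lorentz, Fin.sum_univ_seven, Pi.add_apply]
  ring

theorem lorentz_smul_left (c : ℂ) (x w : Fin 8 → ℂ) : lorentz (c • x) w = c * lorentz x w := by
  simp only [lorentz, Fin.sum_univ_seven, Pi.smul_apply, smul_eq_mul]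
  ring

theorem lorentz_sub_left (x y w : Fin 8 → ℂ) :
    lorentz (x - y) w = lorentz x w - lorentz y w := by
  simp only [lorentz, Fin.sum_univ_seven, Pi.sub_apply]
  ring

theorem lorentz_add_right (x y w : Fin 8 → ℂ) :
    lorentz w (x + y) = lorentz w x + lorentz w y := by
  simp only [lorentz_comm w, lorentz_add_left]

theorem lorentz_smul_right (c : ℂ) (x w : Fin 8 → ℂ) : lorentz w (c • x) = c * lorentz w x := by
  simp only [lorentz_comm w, lorentz_smul_left]

theorem lorentz_sub_right (x y w : Fin 8 → ℂ) :
    lorentz w (x - y) = lorentz w x - lorentz w y := by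
  simp only [lorentz_comm w, lorentz_sub_left]

theorem lorentz_zero_left (x : Fin 8 → ℂ) : lorentz 0 x = 0 := by
  simp [lorentz]

theorem lorentz_zero_right (x : Fin 8 → ℂ) : lorentz x 0 = 0 := by
  simp [lorentz]

theorem lorentz_star (x y : Fin 8 → ℂ) :
    lorentz (star x) (star y) = starRingEnd ℂ (lorentz x y) := by
  simp [lorentz]

theorem lorentz_star_eq_zero {x y : Fin 8 → ℂ} (h : lorentz x y = 0) :
    lorentz (star x) (star y) = 0 := by
  simp [lorentz_star, h]

/-- The Lorentzian form as a bilinear form. -/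
noncomputable def lorentzForm : LinearMap.BilinForm ℂ (Fin 8 → ℂ) :=
  LinearMap.mk₂ ℂ lorentz (fun x y w => lorentz_add_left x y w)
    (fun c x w => lorentz_smul_left c x w) (fun w x y => lorentz_add_right x y w)
    (fun c w x => lorentz_smul_right c x w)

@[simp]
theorem lorentzForm_apply (x y : Fin 8 → ℂ) : lorentzForm x y = lorentz x y := rfl

theorem eq_zero_of_lorentz_eq_zero {x : Fin 8 → ℂ} (h : ∀ y, lorentz x y = 0) : x = 0 := by
  ext i
  have := h (Pi.single i 1)
  refine Fin.cases (fun h => ?_) (fun j h => ?_) i this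
  · simpa [lorentz] using h
  · simpa [lorentz, Pi.single_apply] using h

theorem lorentzForm_nondegenerate : lorentzForm.Nondegenerate :=
  ⟨fun _ h => eq_zero_of_lorentz_eq_zero h,
    fun y h => eq_zero_of_lorentz_eq_zero fun x => (lorentz_comm y x).trans (h x)⟩

/-- Vectors orthogonal to a maximal isotropic subspace are orthogonal to each other. -/
theorem lorentz_eq_zero_of_isotropic {v : Fin 4 → Fin 8 → ℂ} (hv : LinearIndependent ℂ v)
    (hiso : ∀ i j, lorentz (v i) (v j) = 0) {x y : Fin 8 → ℂ} (hx : ∀ i, lorentz x (v i) = 0)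
    (hy : ∀ i, lorentz y (v i) = 0) : lorentz x y = 0 := by
  set U := Submodule.span ℂ (Set.range v) with hU
  have mem_orth : ∀ x, (∀ i, lorentz x (v i) = 0) → x ∈ lorentzForm.orthogonal U := by
    intro x hx
    rw [LinearMap.BilinForm.mem_orthogonal_iff]
    intro u hu
    rw [lorentzForm_apply, lorentz_comm]
    induction hu using Submodule.span_induction with
    | mem u hu => obtain ⟨i, rfl⟩ := hu; exact hx i
    | zero => exact lorentz_zero_right x
    | add u w _ _ h1 h2 => rw [lorentz_add_right, h1, h2, add_zero]
    | smul c u _ h1 => rw [lorentz_smul_right, h1, mul_zero]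
  have hle : U ≤ lorentzForm.orthogonal U := by
    rw [hU, Submodule.span_le]
    rintro _ ⟨i, rfl⟩
    exact mem_orth _ (hiso i)
  have hdim : Module.finrank ℂ U = 4 := by
    rw [hU, finrank_span_eq_card hv, Fintype.card_fin]
  have hfin := LinearMap.BilinForm.finrank_orthogonal lorentzForm_nondegenerate U
  rw [Module.finrank_fin_fun, hdim] at hfin
  -- The complement has dimension `8 - 4 = 4`, so the inclusion of `U` in it is an equality.
  have heq : U = lorentzForm.orthogonal U :=
    Submodule.eq_of_le_of_finrank_le hle (by omega)
  have hxU : x ∈ U := heq ▸ mem_orth x hx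
  exact (LinearMap.BilinForm.mem_orthogonal_iff.1 (mem_orth y hy)) x hxU

theorem wirtinger_lorentz {f g : ℂ → Fin 8 → ℂ} {z : ℂ} (hf : DifferentiableAt ℝ f z)
    (hg : DifferentiableAt ℝ g z) (a : ℂ) :
    wirtinger a (fun z => lorentz (f z) (g z)) z
      = lorentz (wirtinger a f z) (g z) + lorentz (f z) (wirtinger a g z) := by
  have hf' : ∀ i, DifferentiableAt ℝ (fun z => f z i) z := differentiableAt_pi.1 hf
  have hg' : ∀ i, DifferentiableAt ℝ (fun z => g z i) z := differentiableAt_pi.1 hg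
  simp only [lorentz, Fin.sum_univ_seven]
  simp (disch := fun_prop) only [wirtinger_add, wirtinger_neg, wirtinger_mul, ← wirtinger_pi hf,
    ← wirtinger_pi hg]
  ring


/-! ### Derivatives of vector fields along a surface -/

theorem contDiff_dz {f : ℂ → Fin 8 → ℂ} (hf : ContDiff ℝ ∞ f) : ContDiff ℝ ∞ (dz f) := by
  rw [dz_eq_wirtinger]
  exact contDiff_wirtinger hf _

theorem contDiff_dzbar {f : ℂ → Fin 8 → ℂ} (hf : ContDiff ℝ ∞ f) : ContDiff ℝ ∞ (dzbar f) :=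
  contDiff_wirtinger hf _

theorem differentiableAt_of_contDiff {E F : Type*} [NormedAddCommGroup E] [NormedSpace ℝ E]
    [NormedAddCommGroup F] [NormedSpace ℝ F] {f : E → F} (hf : ContDiff ℝ ∞ f) (z : E) :
    DifferentiableAt ℝ f z :=
  hf.differentiable (by norm_num) z

theorem dzbar_dz_comm {f : ℂ → Fin 8 → ℂ} (hf : ContDiff ℝ ∞ f) :
    dzbar (dz f) = dz (dzbar f) := by
  funext z
  simp only [dz_eq_wirtinger, dzbar_eq_wirtinger]
  exact wirtinger_comm hf _ _ _

theorem dz_star {f : ℂ → Fin 8 → ℂ} (hf : ContDiff ℝ ∞ f) (z : ℂ) :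
    dz (fun z => star (f z)) z = star (dzbar f z) := by
  rw [dz_eq_wirtinger, dzbar_eq_wirtinger, wirtinger_star (differentiableAt_of_contDiff hf z)]
  simp

theorem dzbar_star {f : ℂ → Fin 8 → ℂ} (hf : ContDiff ℝ ∞ f) (z : ℂ) :
    dzbar (fun z => star (f z)) z = star (dz f z) := by
  rw [dz_eq_wirtinger, dzbar_eq_wirtinger, wirtinger_star (differentiableAt_of_contDiff hf z)]
  simp

theorem dz_lorentz_eq_zero {f g : ℂ → Fin 8 → ℂ} {c : ℂ} (hf : ContDiff ℝ ∞ f)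
    (hg : ContDiff ℝ ∞ g) (h : ∀ z, lorentz (f z) (g z) = c) (z : ℂ) :
    lorentz (dz f z) (g z) + lorentz (f z) (dz g z) = 0 := by
  rw [dz_eq_wirtinger, dz_eq_wirtinger,
    ← wirtinger_lorentz (differentiableAt_of_contDiff hf z) (differentiableAt_of_contDiff hg z)]
  simp only [h, wirtinger_const]

theorem dzbar_lorentz_eq_zero {f g : ℂ → Fin 8 → ℂ} {c : ℂ} (hf : ContDiff ℝ ∞ f)
    (hg : ContDiff ℝ ∞ g) (h : ∀ z, lorentz (f z) (g z) = c) (z : ℂ) :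
    lorentz (dzbar f z) (g z) + lorentz (f z) (dzbar g z) = 0 := by
  rw [dzbar_eq_wirtinger, dzbar_eq_wirtinger,
    ← wirtinger_lorentz (differentiableAt_of_contDiff hf z) (differentiableAt_of_contDiff hg z)]
  simp only [h, wirtinger_const]

/-- Against an antiholomorphic field the Leibniz rule has a single term. With `g` a conjugated
holomorphic field this propagates orthogonality to all `∂_z` derivatives. -/
theorem lorentz_dz_eq_zero {f g : ℂ → Fin 8 → ℂ} {c : ℂ} (hf : ContDiff ℝ ∞ f)
    (hg : ContDiff ℝ ∞ g) (h : ∀ z, lorentz (f z) (g z) = c) (hg' : ∀ z, dz g z = 0) (z : ℂ) :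
    lorentz (dz f z) (g z) = 0 := by
  have := dz_lorentz_eq_zero hf hg h z
  rwa [hg', lorentz_zero_right, add_zero] at this

theorem lorentz_dzbar_eq_zero {f g : ℂ → Fin 8 → ℂ} {c : ℂ} (hf : ContDiff ℝ ∞ f)
    (hg : ContDiff ℝ ∞ g) (h : ∀ z, lorentz (f z) (g z) = c) (hg' : ∀ z, dzbar g z = 0) (z : ℂ) :
    lorentz (dzbar f z) (g z) = 0 := by
  have := dzbar_lorentz_eq_zero hf hg h z
  rwa [hg', lorentz_zero_right, add_zero] at this

theorem contDiff_lorentz {f g : ℂ → Fin 8 → ℂ} (hf : ContDiff ℝ ∞ f) (hg : ContDiff ℝ ∞ g) :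
    ContDiff ℝ ∞ fun z => lorentz (f z) (g z) := by
  have hf' : ∀ i, ContDiff ℝ ∞ fun z => f z i := contDiff_pi.1 hf
  have hg' : ∀ i, ContDiff ℝ ∞ fun z => g z i := contDiff_pi.1 hg
  simp only [lorentz, Fin.sum_univ_seven]
  fun_prop

theorem contDiff_star {f : ℂ → Fin 8 → ℂ} (hf : ContDiff ℝ ∞ f) :
    ContDiff ℝ ∞ fun z => star (f z) :=
  (starL' ℝ (A := Fin 8 → ℂ)).contDiff.comp hf

/-! ### The lift of a surface to the light cone -/

section Lift

variable {y : ℂ → EuclideanSpace ℝ (Fin 7)}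

theorem contDiff_coneLift (hy : ContDiff ℝ ∞ y) : ContDiff ℝ ∞ (coneLift y) := by
  rw [contDiff_pi]
  intro i
  refine Fin.cases ?_ (fun j => ?_) i
  · exact contDiff_const
  · exact ofRealCLM.contDiff.comp ((contDiff_piLp 2).1 hy j)

theorem star_coneLift (z : ℂ) : star (coneLift y z) = coneLift y z := by
  ext i
  refine Fin.cases ?_ (fun j => ?_) i <;> simp [coneLift]

/-- For unit vectors the right side vanishes only when the two points coincide; this is how
orthogonality of lifts becomes equality of surfaces. -/
theorem lorentz_coneLift (y y' : ℂ → EuclideanSpace ℝ (Fin 7)) (z : ℂ) :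
    lorentz (coneLift y z) (coneLift y' z) = ((inner ℝ (y z) (y' z) - 1 : ℝ) : ℂ) := by
  simp [lorentz, coneLift, PiLp.inner_apply, mul_comm]
  ring

theorem lorentz_coneLift_self {z : ℂ} (hy : ‖y z‖ = 1) :
    lorentz (coneLift y z) (coneLift y z) = 0 := by
  rw [lorentz_coneLift, real_inner_self_eq_norm_sq, hy]
  simp

theorem fderiv_coneLift (hy : ContDiff ℝ ∞ y) (z v : ℂ) :
    fderiv ℝ (coneLift y) z v = Fin.cons 0 fun j => ((fderiv ℝ y z v j : ℝ) : ℂ) := by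
  have hd : ∀ j, HasFDerivAt (fun z => y z j) ((EuclideanSpace.proj j).comp (fderiv ℝ y z)) z :=
    fun j => (EuclideanSpace.proj (𝕜 := ℝ) j).hasFDerivAt.comp z
      (differentiableAt_of_contDiff hy z).hasFDerivAt
  have h := differentiableAt_of_contDiff (contDiff_coneLift hy) z
  have h' := hasFDerivAt_pi'.1 h.hasFDerivAt
  ext i
  refine Fin.cases ?_ (fun j => ?_) i
  · have := congrArg (fun A => A v) ((h' 0).unique (hasFDerivAt_const (1 : ℂ) z))
    simpa using this
  · have := congrArg (fun A => A v)
      ((h' j.succ).unique (ofRealCLM.hasFDerivAt.comp z (hd j)))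
    simpa using this

theorem dz_coneLift (hy : ContDiff ℝ ∞ y) (z : ℂ) :
    dz (coneLift y) z = Fin.cons 0 fun j =>
      (((fderiv ℝ y z 1 j : ℝ) : ℂ) - I * ((fderiv ℝ y z I j : ℝ) : ℂ)) / 2 := by
  rw [dz, fderiv_coneLift hy, fderiv_coneLift hy]
  ext i
  refine Fin.cases ?_ (fun j => ?_) i
  · simp
  · simp
    ring

theorem dzbar_coneLift (hy : ContDiff ℝ ∞ y) (z : ℂ) :
    dzbar (coneLift y) z = star (dz (coneLift y) z) := by
  rw [← dzbar_star (contDiff_coneLift hy)]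
  simp only [star_coneLift]

/-- Real and imaginary parts express `|y_u| = |y_v|` and `y_u ⊥ y_v`, so isotropy of the complex
derivative is conformality. -/
theorem lorentz_dz_coneLift (hy : ContDiff ℝ ∞ y) (z : ℂ) :
    lorentz (dz (coneLift y) z) (dz (coneLift y) z) =
      (((‖fderiv ℝ y z 1‖ ^ 2 - ‖fderiv ℝ y z I‖ ^ 2) / 4 : ℝ) : ℂ)
        - I * ((inner ℝ (fderiv ℝ y z 1) (fderiv ℝ y z I) / 2 : ℝ) : ℂ) := by
  rw [dz_coneLift hy, EuclideanSpace.real_norm_sq_eq, EuclideanSpace.real_norm_sq_eq,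
    PiLp.inner_apply]
  simp only [lorentz, Fin.sum_univ_seven, Fin.cons_zero, Fin.cons_succ]
  simp
  linear_combination (1 / 4 : ℂ) * ((fderiv ℝ y z I 0 : ℂ) ^ 2 + (fderiv ℝ y z I 1 : ℂ) ^ 2 +
    (fderiv ℝ y z I 2 : ℂ) ^ 2 + (fderiv ℝ y z I 3 : ℂ) ^ 2 + (fderiv ℝ y z I 4 : ℂ) ^ 2 +
    (fderiv ℝ y z I 5 : ℂ) ^ 2 + (fderiv ℝ y z I 6 : ℂ) ^ 2) * I_sq

theorem lorentz_dz_dzbar_coneLift (hy : ContDiff ℝ ∞ y) (z : ℂ) :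
    2 * lorentz (dz (coneLift y) z) (dzbar (coneLift y) z) =
      (((‖fderiv ℝ y z 1‖ ^ 2 + ‖fderiv ℝ y z I‖ ^ 2) / 2 : ℝ) : ℂ) := by
  rw [dzbar_coneLift hy, dz_coneLift hy, EuclideanSpace.real_norm_sq_eq,
    EuclideanSpace.real_norm_sq_eq]
  simp only [lorentz, Fin.sum_univ_seven, Pi.star_apply, Fin.cons_zero, Fin.cons_succ]
  simp
  linear_combination (-1 / 2 : ℂ) * ((fderiv ℝ y z I 0 : ℂ) ^ 2 + (fderiv ℝ y z I 1 : ℂ) ^ 2 +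
    (fderiv ℝ y z I 2 : ℂ) ^ 2 + (fderiv ℝ y z I 3 : ℂ) ^ 2 + (fderiv ℝ y z I 4 : ℂ) ^ 2 +
    (fderiv ℝ y z I 5 : ℂ) ^ 2 + (fderiv ℝ y z I 6 : ℂ) ^ 2) * I_sq

theorem ofReal_conformalFactor (hy : ContDiff ℝ ∞ y) (z : ℂ) :
    (conformalFactor y z : ℂ) = 2 * lorentz (dz (coneLift y) z) (dzbar (coneLift y) z) := by
  rw [conformalFactor, lorentz_dz_dzbar_coneLift hy, ofReal_re]

theorem conformalFactor_eq (hy : ContDiff ℝ ∞ y) (z : ℂ) :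
    conformalFactor y z = (‖fderiv ℝ y z 1‖ ^ 2 + ‖fderiv ℝ y z I‖ ^ 2) / 2 := by
  rw [conformalFactor, lorentz_dz_dzbar_coneLift hy, ofReal_re]

theorem contDiff_conformalFactor (hy : ContDiff ℝ ∞ y) : ContDiff ℝ ∞ (conformalFactor y) :=
  reCLM.contDiff.comp (contDiff_const.mul
    (contDiff_lorentz (contDiff_dz (contDiff_coneLift hy))
      (contDiff_dzbar (contDiff_coneLift hy))))

theorem IsConformalImmersion.conformalFactor_pos (hy : IsConformalImmersion y) (z : ℂ) :
    0 < conformalFactor y z := by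
  rw [conformalFactor_eq hy.smooth]
  have h : fderiv ℝ y z 1 ≠ 0 := fun h =>
    one_ne_zero (hy.immersion z (h.trans (map_zero _).symm))
  have := norm_pos_iff.2 h
  positivity

/-- A conformal differential scales all lengths by the same factor `|y_u|`, so it is injective as
soon as this factor is nonzero. -/
theorem isConformalImmersion_of_conformalFactor_pos (hy : ContDiff ℝ ∞ y)
    (hn : ∀ z, ‖y z‖ = 1) (hpos : ∀ z, 0 < conformalFactor y z)
    (hconf : ∀ z, lorentz (dz (coneLift y) z) (dz (coneLift y) z) = 0) :
    IsConformalImmersion y where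
  smooth := hy
  mem_sphere := hn
  conformal := hconf
  immersion z := by
    have h1 := hconf z
    have h2 := hpos z
    rw [conformalFactor_eq hy] at h2
    rw [lorentz_dz_coneLift hy] at h1
    have hre := congrArg re h1
    have him := congrArg im h1
    simp only [sub_re, mul_re, I_re, I_im, ofReal_re, ofReal_im, zero_re] at hre
    simp only [sub_im, mul_im, I_re, I_im, ofReal_re, ofReal_im, zero_im] at him
    rw [injective_iff_map_eq_zero]
    intro v hv
    have hv' : fderiv ℝ y z v = v.re • fderiv ℝ y z 1 + v.im • fderiv ℝ y z I := by
      rw [← map_smul, ← map_smul, ← map_add]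
      congr 1
      apply Complex.ext <;> simp
    have h3 : ‖v.re • fderiv ℝ y z 1 + v.im • fderiv ℝ y z I‖ ^ 2 = 0 := by
      rw [← hv', hv]
      simp
    rw [norm_add_sq_real, inner_smul_left, inner_smul_right, norm_smul, norm_smul, mul_pow,
      mul_pow, Real.norm_eq_abs, Real.norm_eq_abs, sq_abs, sq_abs] at h3
    have h4 : inner ℝ (fderiv ℝ y z 1) (fderiv ℝ y z I) = 0 := by linarith
    have h5 : ‖fderiv ℝ y z I‖ ^ 2 = ‖fderiv ℝ y z 1‖ ^ 2 := by linarith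
    rw [h4, h5] at h3
    rw [h5] at h2
    have h6 : (v.re ^ 2 + v.im ^ 2) * ‖fderiv ℝ y z 1‖ ^ 2 = 0 := by
      simp at h3
      linarith
    have h7 : v.re ^ 2 + v.im ^ 2 = 0 := by
      rcases mul_eq_zero.1 h6 with h | h
      · exact h
      · linarith
    apply Complex.ext
    · exact pow_eq_zero_iff two_ne_zero |>.1 (by nlinarith [sq_nonneg v.re, sq_nonneg v.im])
    · exact pow_eq_zero_iff two_ne_zero |>.1 (by nlinarith [sq_nonneg v.re, sq_nonneg v.im])

end Lift

/-! ### The canonical lift of a conformal immersion -/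

namespace IsConformalImmersion

variable {y : ℂ → EuclideanSpace ℝ (Fin 7)}

theorem contDiff_scale (hy : IsConformalImmersion y) :
    ContDiff ℝ ∞ fun z => (((Real.sqrt (conformalFactor y z))⁻¹ : ℝ) : ℂ) := by
  refine ofRealCLM.contDiff.comp (ContDiff.inv ?_ fun z => ?_)
  · exact (contDiff_conformalFactor hy.smooth).sqrt fun z => (hy.conformalFactor_pos z).ne'
  · exact (Real.sqrt_pos.2 (hy.conformalFactor_pos z)).ne'

theorem contDiff_canonicalLift (hy : IsConformalImmersion y) :
    ContDiff ℝ ∞ (canonicalLift y) :=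
  hy.contDiff_scale.smul (contDiff_coneLift hy.smooth)

theorem star_canonicalLift (z : ℂ) : star (canonicalLift y z) = canonicalLift y z := by
  rw [canonicalLift, star_smul, star_coneLift]
  simp

theorem wirtinger_canonicalLift (hy : IsConformalImmersion y) (a z : ℂ) :
    wirtinger a (canonicalLift y) z =
      wirtinger a (fun z => (((Real.sqrt (conformalFactor y z))⁻¹ : ℝ) : ℂ)) z • coneLift y z +
      (((Real.sqrt (conformalFactor y z))⁻¹ : ℝ) : ℂ) • wirtinger a (coneLift y) z :=
  wirtinger_smul (differentiableAt_of_contDiff hy.contDiff_scale z)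
    (differentiableAt_of_contDiff (contDiff_coneLift hy.smooth) z) a

theorem star_dz_canonicalLift (hy : IsConformalImmersion y) (z : ℂ) :
    star (dz (canonicalLift y) z) = dzbar (canonicalLift y) z := by
  rw [← dzbar_star hy.contDiff_canonicalLift]
  simp only [star_canonicalLift]

theorem star_dzbar_canonicalLift (hy : IsConformalImmersion y) (z : ℂ) :
    star (dzbar (canonicalLift y) z) = dz (canonicalLift y) z := by
  rw [← hy.star_dz_canonicalLift, star_star]

theorem star_dz_dz_canonicalLift (hy : IsConformalImmersion y) (z : ℂ) :
    star (dz (dz (canonicalLift y)) z) = dzbar (dzbar (canonicalLift y)) z := by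
  rw [← dzbar_star (contDiff_dz hy.contDiff_canonicalLift)]
  simp only [hy.star_dz_canonicalLift]

theorem star_dzbar_dz_canonicalLift (hy : IsConformalImmersion y) (z : ℂ) :
    star (dzbar (dz (canonicalLift y)) z) = dzbar (dz (canonicalLift y)) z := by
  rw [← dz_star (contDiff_dz hy.contDiff_canonicalLift),
    dzbar_dz_comm hy.contDiff_canonicalLift]
  simp only [hy.star_dz_canonicalLift]

theorem lorentz_Y_Y (hy : IsConformalImmersion y) (z : ℂ) :
    lorentz (canonicalLift y z) (canonicalLift y z) = 0 := by
  rw [canonicalLift, lorentz_smul_left, lorentz_smul_right,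
    lorentz_coneLift_self (hy.mem_sphere z)]
  ring

theorem lorentz_Yz_Y (hy : IsConformalImmersion y) (z : ℂ) :
    lorentz (dz (canonicalLift y) z) (canonicalLift y z) = 0 := by
  have h := dz_lorentz_eq_zero hy.contDiff_canonicalLift hy.contDiff_canonicalLift hy.lorentz_Y_Y z
  rw [lorentz_comm (canonicalLift y z)] at h
  linear_combination h / 2

theorem lorentz_Yzbar_Y (hy : IsConformalImmersion y) (z : ℂ) :
    lorentz (dzbar (canonicalLift y) z) (canonicalLift y z) = 0 := by
  have h := dzbar_lorentz_eq_zero hy.contDiff_canonicalLift hy.contDiff_canonicalLift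
    hy.lorentz_Y_Y z
  rw [lorentz_comm (canonicalLift y z)] at h
  linear_combination h / 2

theorem lorentz_dz_coneLift_coneLift (hy : IsConformalImmersion y) (z : ℂ) :
    lorentz (dz (coneLift y) z) (coneLift y z) = 0 := by
  have hL := contDiff_coneLift hy.smooth
  have h := dz_lorentz_eq_zero hL hL (fun z => lorentz_coneLift_self (hy.mem_sphere z)) z
  rw [lorentz_comm (coneLift y z)] at h
  linear_combination h / 2

theorem lorentz_dzbar_coneLift_coneLift (hy : IsConformalImmersion y) (z : ℂ) :
    lorentz (dzbar (coneLift y) z) (coneLift y z) = 0 := by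
  rw [dzbar_coneLift hy.smooth, ← star_coneLift,
    lorentz_star_eq_zero (hy.lorentz_dz_coneLift_coneLift z)]

/-- Differentiating the scale only adds a multiple of the cone lift, which is null and orthogonal to
its own derivatives. -/
theorem lorentz_Yz_Yz (hy : IsConformalImmersion y) (z : ℂ) :
    lorentz (dz (canonicalLift y) z) (dz (canonicalLift y) z) = 0 := by
  have h1 := hy.lorentz_dz_coneLift_coneLift z
  have h2 := hy.conformal z
  rw [dz_eq_wirtinger] at h1 h2 ⊢
  rw [hy.wirtinger_canonicalLift]
  simp only [lorentz_add_left, lorentz_add_right, lorentz_smul_left, lorentz_smul_right,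
    lorentz_comm (coneLift y z) (wirtinger _ _ _), h1, h2,
    lorentz_coneLift_self (hy.mem_sphere z)]
  ring

theorem lorentz_Yzbar_Yzbar (hy : IsConformalImmersion y) (z : ℂ) :
    lorentz (dzbar (canonicalLift y) z) (dzbar (canonicalLift y) z) = 0 := by
  rw [← hy.star_dz_canonicalLift, lorentz_star_eq_zero (hy.lorentz_Yz_Yz z)]

/-- The normalization of the lift at work: the product is `e^{-2ω}` times `e^{2ω} / 2`. -/
theorem lorentz_Yz_Yzbar (hy : IsConformalImmersion y) (z : ℂ) :
    lorentz (dz (canonicalLift y) z) (dzbar (canonicalLift y) z) = 1 / 2 := by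
  have h1 := hy.lorentz_dz_coneLift_coneLift z
  have h2 := hy.lorentz_dzbar_coneLift_coneLift z
  have h3 := ofReal_conformalFactor hy.smooth z
  rw [dz_eq_wirtinger, dzbar_eq_wirtinger] at *
  rw [hy.wirtinger_canonicalLift, hy.wirtinger_canonicalLift]
  simp only [lorentz_add_left, lorentz_add_right, lorentz_smul_left, lorentz_smul_right,
    lorentz_comm (coneLift y z) (wirtinger _ _ _), h1, h2,
    lorentz_coneLift_self (hy.mem_sphere z)]
  have h4 : (Real.sqrt (conformalFactor y z) : ℂ) ^ 2 = conformalFactor y z := by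
    rw [← ofReal_pow, Real.sq_sqrt (hy.conformalFactor_pos z).le]
  have h5 : (Real.sqrt (conformalFactor y z) : ℂ) ≠ 0 :=
    ofReal_ne_zero.2 (Real.sqrt_pos.2 (hy.conformalFactor_pos z)).ne'
  rw [ofReal_inv]
  field_simp
  rw [h4, h3]
  ring

theorem lorentz_Yzzbar_Y (hy : IsConformalImmersion y) (z : ℂ) :
    lorentz (dzbar (dz (canonicalLift y)) z) (canonicalLift y z) = -1 / 2 := by
  have h := dzbar_lorentz_eq_zero (contDiff_dz hy.contDiff_canonicalLift)
    hy.contDiff_canonicalLift hy.lorentz_Yz_Y z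
  rw [hy.lorentz_Yz_Yzbar] at h
  linear_combination h

theorem lorentz_Yzzbar_Yz (hy : IsConformalImmersion y) (z : ℂ) :
    lorentz (dzbar (dz (canonicalLift y)) z) (dz (canonicalLift y) z) = 0 := by
  have hs := contDiff_dz hy.contDiff_canonicalLift
  have h := dzbar_lorentz_eq_zero hs hs hy.lorentz_Yz_Yz z
  rw [lorentz_comm (dz _ z)] at h
  linear_combination h / 2

theorem contDiff_lightlikeN (hy : IsConformalImmersion y) : ContDiff ℝ ∞ (lightlikeN y) := by
  have h := contDiff_dzbar (contDiff_dz hy.contDiff_canonicalLift)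
  exact ((contDiff_const (c := (2 : ℂ))).smul h).add
    ((contDiff_const.mul (contDiff_lorentz h h)).smul hy.contDiff_canonicalLift)

theorem lorentz_N_Y (hy : IsConformalImmersion y) (z : ℂ) :
    lorentz (lightlikeN y z) (canonicalLift y z) = -1 := by
  simp only [lightlikeN, lorentz_add_left, lorentz_smul_left, hy.lorentz_Yzzbar_Y, hy.lorentz_Y_Y]
  ring

/-- With `q = ⟨Y_zz̄, Y_zz̄⟩` and `⟨Y_zz̄, Y⟩ = -1/2` the value is `4q - 4q`; this fixes the
coefficient of `Y` in `N`. -/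
theorem lorentz_N_N (hy : IsConformalImmersion y) (z : ℂ) :
    lorentz (lightlikeN y z) (lightlikeN y z) = 0 := by
  simp only [lightlikeN, lorentz_add_left, lorentz_smul_left, lorentz_add_right,
    lorentz_smul_right, hy.lorentz_Yzzbar_Y, hy.lorentz_Y_Y,
    lorentz_comm (canonicalLift y z) (dzbar (dz (canonicalLift y)) z)]
  ring

theorem lorentz_N_Yz (hy : IsConformalImmersion y) (z : ℂ) :
    lorentz (lightlikeN y z) (dz (canonicalLift y) z) = 0 := by
  simp only [lightlikeN, lorentz_add_left, lorentz_smul_left, hy.lorentz_Yzzbar_Yz,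
    lorentz_comm (canonicalLift y z) (dz (canonicalLift y) z), hy.lorentz_Yz_Y]
  ring

theorem star_lightlikeN (hy : IsConformalImmersion y) (z : ℂ) :
    star (lightlikeN y z) = lightlikeN y z := by
  have h := lorentz_star (dzbar (dz (canonicalLift y)) z) (dzbar (dz (canonicalLift y)) z)
  rw [hy.star_dzbar_dz_canonicalLift] at h
  simp only [lightlikeN, star_add, star_smul, hy.star_dzbar_dz_canonicalLift,
    star_canonicalLift]
  simp [← h]

theorem lorentz_N_Yzbar (hy : IsConformalImmersion y) (z : ℂ) :
    lorentz (lightlikeN y z) (dzbar (canonicalLift y) z) = 0 := by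
  rw [← hy.star_lightlikeN, ← hy.star_dz_canonicalLift,
    lorentz_star_eq_zero (hy.lorentz_N_Yz z)]

end IsConformalImmersion

/-! ### The conformal normal bundle -/

/-- A vector of the complexified conformal normal space at `z`. -/
structure IsNormal (y : ℂ → EuclideanSpace ℝ (Fin 7)) (z : ℂ) (w : Fin 8 → ℂ) : Prop where
  perp_Y : lorentz w (canonicalLift y z) = 0
  perp_Yz : lorentz w (dz (canonicalLift y) z) = 0
  perp_Yzbar : lorentz w (dzbar (canonicalLift y) z) = 0
  perp_N : lorentz w (lightlikeN y z) = 0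

namespace IsConformalImmersion

variable {y : ℂ → EuclideanSpace ℝ (Fin 7)}

theorem isNormal_normalPart (hy : IsConformalImmersion y) (z : ℂ) (w : Fin 8 → ℂ) :
    IsNormal y z (normalPart y z w) := by
  have e1 := lorentz_comm (dz (canonicalLift y) z) (lightlikeN y z)
  have e2 := lorentz_comm (dzbar (canonicalLift y) z) (lightlikeN y z)
  have e3 := lorentz_comm (canonicalLift y z) (lightlikeN y z)
  have e4 := lorentz_comm (canonicalLift y z) (dz (canonicalLift y) z)
  have e5 := lorentz_comm (canonicalLift y z) (dzbar (canonicalLift y) z)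
  have e6 := lorentz_comm (dzbar (canonicalLift y) z) (dz (canonicalLift y) z)
  constructor <;>
  · simp only [normalPart, lorentz_add_left, lorentz_sub_left, lorentz_smul_left, e1, e2, e3, e4,
      e5, e6, hy.lorentz_Y_Y, hy.lorentz_Yz_Y, hy.lorentz_Yzbar_Y, hy.lorentz_Yz_Yz,
      hy.lorentz_Yz_Yzbar, hy.lorentz_Yzbar_Yzbar, hy.lorentz_N_Y, hy.lorentz_N_N,
      hy.lorentz_N_Yz, hy.lorentz_N_Yzbar]
    ring

theorem contDiff_normalPart (hy : IsConformalImmersion y) {f : ℂ → Fin 8 → ℂ}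
    (hf : ContDiff ℝ ∞ f) : ContDiff ℝ ∞ fun z => normalPart y z (f z) := by
  have hY := hy.contDiff_canonicalLift
  have hN := hy.contDiff_lightlikeN
  exact (((hf.add ((contDiff_lorentz hf hN).smul hY)).add ((contDiff_lorentz hf hY).smul hN)).sub
    ((contDiff_const.mul (contDiff_lorentz hf (contDiff_dzbar hY))).smul (contDiff_dz hY))).sub
    ((contDiff_const.mul (contDiff_lorentz hf (contDiff_dz hY))).smul (contDiff_dzbar hY))

end IsConformalImmersion

/-- The projection changes a vector only by elements of `V`. Pairings of `κ` and of `D_z̄` with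
normal fields can thus be computed with ordinary derivatives. -/
theorem IsNormal.lorentz_normalPart {y : ℂ → EuclideanSpace ℝ (Fin 7)} {z : ℂ} {n : Fin 8 → ℂ}
    (hn : IsNormal y z n) (w : Fin 8 → ℂ) : lorentz (normalPart y z w) n = lorentz w n := by
  obtain ⟨h1, h2, h3, h4⟩ := hn
  rw [lorentz_comm] at h1 h2 h3 h4
  simp only [normalPart, lorentz_add_left, lorentz_sub_left, lorentz_smul_left, h1, h2, h3, h4]
  ring


/-! ### Surfaces with a holomorphic isotropic frame of the conformal normal bundle -/

/-- The vector fields `h₀`, `h₁` form a holomorphic frame of an isotropic plane bundle which is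
orthogonal to the lift of `y` to the light cone, such that `h₀, h₁, h₀', h₁'` span a maximal
isotropic subspace of `ℂ⁸` at every point. -/
structure IsIsotropicFrame (y : ℂ → EuclideanSpace ℝ (Fin 7))
    (h : Fin 2 → ℂ → Fin 8 → ℂ) : Prop where
  smooth : ∀ i, ContDiff ℝ ∞ (h i)
  hol : ∀ i z, dzbar (h i) z = 0
  iso : ∀ i j z, lorentz (h i z) (h j z) = 0
  iso_dz : ∀ i j z, lorentz (h i z) (dz (h j) z) = 0
  iso_dz_dz : ∀ i j z, lorentz (dz (h i) z) (dz (h j) z) = 0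
  perp : ∀ i z, lorentz (coneLift y z) (h i z) = 0
  perp_dz : ∀ i z, lorentz (coneLift y z) (dz (h i) z) = 0
  indep : ∀ z, LinearIndependent ℂ ![h 0 z, h 1 z, dz (h 0) z, dz (h 1) z]
  gram_ne_zero : ∀ z, lorentz (h 0 z) (star (h 0 z)) * lorentz (h 1 z) (star (h 1 z))
    - lorentz (h 0 z) (star (h 1 z)) * lorentz (h 1 z) (star (h 0 z)) ≠ 0

namespace IsIsotropicFrame

variable {y : ℂ → EuclideanSpace ℝ (Fin 7)} {h : Fin 2 → ℂ → Fin 8 → ℂ}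

theorem iso_dz_left (hh : IsIsotropicFrame y h) (i j : Fin 2) (z : ℂ) :
    lorentz (dz (h i) z) (h j z) = 0 := by
  rw [lorentz_comm, hh.iso_dz]

theorem dz_star_eq_zero (hh : IsIsotropicFrame y h) (i : Fin 2) (z : ℂ) :
    dz (fun z => star (h i z)) z = 0 := by
  rw [dz_star (hh.smooth i), hh.hol, star_zero]

theorem dzbar_dz_eq_zero (hh : IsIsotropicFrame y h) (i : Fin 2) (z : ℂ) :
    dzbar (dz (h i)) z = 0 := by
  rw [dzbar_dz_comm (hh.smooth i)]
  have : dzbar (h i) = fun _ => 0 := funext (hh.hol i)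
  rw [this, dz_eq_wirtinger, wirtinger_const]

theorem dz_star_dz_eq_zero (hh : IsIsotropicFrame y h) (i : Fin 2) (z : ℂ) :
    dz (fun z => star (dz (h i) z)) z = 0 := by
  rw [dz_star (contDiff_dz (hh.smooth i)), hh.dzbar_dz_eq_zero, star_zero]

/-- Vectors orthogonal to the maximal isotropic subspace lie in it. -/
theorem lorentz_eq_zero (hh : IsIsotropicFrame y h) {z : ℂ} {v w : Fin 8 → ℂ}
    (hv : ∀ i, lorentz v (h i z) = 0) (hv' : ∀ i, lorentz v (dz (h i) z) = 0)
    (hw : ∀ i, lorentz w (h i z) = 0) (hw' : ∀ i, lorentz w (dz (h i) z) = 0) :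
    lorentz v w = 0 := by
  refine lorentz_eq_zero_of_isotropic (hh.indep z) ?_ ?_ ?_
  · intro i j
    fin_cases i <;> fin_cases j <;>
      simp [hh.iso, hh.iso_dz, hh.iso_dz_left, hh.iso_dz_dz]
  · intro i
    fin_cases i <;> simp [hv, hv']
  · intro i
    fin_cases i <;> simp [hw, hw']

theorem lorentz_star_right {v w : Fin 8 → ℂ} : lorentz v (star w) = 0 ↔ lorentz (star v) w = 0 := by
  constructor <;> intro H <;> simpa using lorentz_star_eq_zero H

/-- Vectors orthogonal to the conjugate of the maximal isotropic subspace lie in it. -/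
theorem lorentz_eq_zero_of_star (hh : IsIsotropicFrame y h) {z : ℂ} {v w : Fin 8 → ℂ}
    (hv : ∀ i, lorentz v (star (h i z)) = 0) (hv' : ∀ i, lorentz v (star (dz (h i) z)) = 0)
    (hw : ∀ i, lorentz w (star (h i z)) = 0) (hw' : ∀ i, lorentz w (star (dz (h i) z)) = 0) :
    lorentz v w = 0 := by
  simp only [lorentz_star_right] at hv hv' hw hw'
  simpa using lorentz_star_eq_zero (hh.lorentz_eq_zero hv hv' hw hw')

theorem lorentz_star_dz_eq_zero (hh : IsIsotropicFrame y h) {f : ℂ → Fin 8 → ℂ}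
    (hf : ContDiff ℝ ∞ f) (hfh : ∀ i z, lorentz (f z) (star (h i z)) = 0) (i : Fin 2) (z : ℂ) :
    lorentz (dz f z) (star (h i z)) = 0 :=
  lorentz_dz_eq_zero hf (contDiff_star (hh.smooth i)) (hfh i) (hh.dz_star_eq_zero i) z

theorem lorentz_star_dz_dz_eq_zero (hh : IsIsotropicFrame y h) {f : ℂ → Fin 8 → ℂ}
    (hf : ContDiff ℝ ∞ f) (hfh : ∀ i z, lorentz (f z) (star (dz (h i) z)) = 0) (i : Fin 2)
    (z : ℂ) : lorentz (dz f z) (star (dz (h i) z)) = 0 :=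
  lorentz_dz_eq_zero hf (contDiff_star (contDiff_dz (hh.smooth i))) (hfh i)
    (hh.dz_star_dz_eq_zero i) z

theorem perp_star (hh : IsIsotropicFrame y h) (i : Fin 2) (z : ℂ) :
    lorentz (coneLift y z) (star (h i z)) = 0 := by
  rw [lorentz_star_right, star_coneLift, hh.perp]

theorem perp_star_dz (hh : IsIsotropicFrame y h) (i : Fin 2) (z : ℂ) :
    lorentz (coneLift y z) (star (dz (h i) z)) = 0 := by
  rw [lorentz_star_right, star_coneLift, hh.perp_dz]

/-- The `∂_z` derivative of the lift stays orthogonal to the conjugate maximal isotropic space,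
hence is isotropic. -/
theorem isConformalImmersion (hh : IsIsotropicFrame y h) (hy : ContDiff ℝ ∞ y)
    (hn : ∀ z, ‖y z‖ = 1) (hpos : ∀ z, 0 < conformalFactor y z) : IsConformalImmersion y := by
  refine isConformalImmersion_of_conformalFactor_pos hy hn hpos fun z => ?_
  have hL := contDiff_coneLift hy
  have h1 := hh.lorentz_star_dz_eq_zero hL hh.perp_star
  have h2 := hh.lorentz_star_dz_dz_eq_zero hL hh.perp_star_dz
  exact hh.lorentz_eq_zero_of_star (h1 · z) (h2 · z) (h1 · z) (h2 · z)

theorem lorentz_Y (hh : IsIsotropicFrame y h) (i : Fin 2) (z : ℂ) :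
    lorentz (canonicalLift y z) (h i z) = 0 := by
  rw [canonicalLift, lorentz_smul_left, hh.perp, mul_zero]

theorem lorentz_Y_dz (hh : IsIsotropicFrame y h) (i : Fin 2) (z : ℂ) :
    lorentz (canonicalLift y z) (dz (h i) z) = 0 := by
  rw [canonicalLift, lorentz_smul_left, hh.perp_dz, mul_zero]

theorem lorentz_Y_star (hh : IsIsotropicFrame y h) (i : Fin 2) (z : ℂ) :
    lorentz (canonicalLift y z) (star (h i z)) = 0 := by
  rw [canonicalLift, lorentz_smul_left, hh.perp_star, mul_zero]

theorem lorentz_Y_star_dz (hh : IsIsotropicFrame y h) (i : Fin 2) (z : ℂ) :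
    lorentz (canonicalLift y z) (star (dz (h i) z)) = 0 := by
  rw [canonicalLift, lorentz_smul_left, hh.perp_star_dz, mul_zero]

/-- A surface in `S⁶` is determined by an isotropic frame of its conformal normal bundle. -/
theorem eq_of_perp (hh : IsIsotropicFrame y h) (hn : ∀ z, ‖y z‖ = 1)
    {y' : ℂ → EuclideanSpace ℝ (Fin 7)} (hy' : IsConformalImmersion y')
    (hperp : ∀ i z, lorentz (canonicalLift y' z) (h i z) = 0)
    (hperp' : ∀ i z, lorentz (dz (canonicalLift y') z) (h i z) = 0) (z : ℂ) : y' z = y z := by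
  have hdz : ∀ i z, lorentz (canonicalLift y' z) (dz (h i) z) = 0 := fun i z => by
    have h1 := dz_lorentz_eq_zero hy'.contDiff_canonicalLift (hh.smooth i) (hperp i) z
    rwa [hperp', zero_add] at h1
  -- Both lifts lie in the same maximal isotropic space, so their product vanishes and the unit
  -- vectors `y' z`, `y z` have inner product one.
  have h0 := hh.lorentz_eq_zero (hperp · z) (hdz · z) (hh.perp · z) (hh.perp_dz · z)
  have h5 : (Real.sqrt (conformalFactor y' z))⁻¹ ≠ 0 :=
    inv_ne_zero (Real.sqrt_pos.2 (hy'.conformalFactor_pos z)).ne'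
  rw [canonicalLift, lorentz_smul_left, mul_eq_zero, ofReal_eq_zero, or_iff_right h5,
    lorentz_coneLift, ofReal_eq_zero, sub_eq_zero] at h0
  exact (inner_eq_one_iff_of_norm_eq_one (hy'.mem_sphere z) (hn z)).1 h0

/-- The conjugates of `hᵢ` and `hᵢ'` are antiholomorphic, so each application of `∂_z` keeps the
orthogonality. Total isotropy follows from it. -/
theorem iterate_dz_perp (hh : IsIsotropicFrame y h) (hy : IsConformalImmersion y) (m : ℕ) :
    ContDiff ℝ ∞ (dz^[m] (canonicalLift y)) ∧
      (∀ i z, lorentz (dz^[m] (canonicalLift y) z) (star (h i z)) = 0) ∧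
      ∀ i z, lorentz (dz^[m] (canonicalLift y) z) (star (dz (h i) z)) = 0 := by
  induction m with
  | zero => exact ⟨hy.contDiff_canonicalLift, hh.lorentz_Y_star, hh.lorentz_Y_star_dz⟩
  | succ m ih =>
    rw [Function.iterate_succ', Function.comp_apply]
    exact ⟨contDiff_dz ih.1, hh.lorentz_star_dz_eq_zero ih.1 ih.2.1,
      hh.lorentz_star_dz_dz_eq_zero ih.1 ih.2.2⟩

theorem lorentz_iterate_dz (hh : IsIsotropicFrame y h) (hy : IsConformalImmersion y) (m n : ℕ)
    (z : ℂ) : lorentz (dz^[m] (canonicalLift y) z) (dz^[n] (canonicalLift y) z) = 0 :=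
  hh.lorentz_eq_zero_of_star ((hh.iterate_dz_perp hy m).2.1 · z)
    ((hh.iterate_dz_perp hy m).2.2 · z) ((hh.iterate_dz_perp hy n).2.1 · z)
    ((hh.iterate_dz_perp hy n).2.2 · z)

theorem lorentz_Yz (hh : IsIsotropicFrame y h) (hy : IsConformalImmersion y) (i : Fin 2) (z : ℂ) :
    lorentz (dz (canonicalLift y) z) (h i z) = 0 := by
  have := dz_lorentz_eq_zero hy.contDiff_canonicalLift (hh.smooth i) (hh.lorentz_Y i) z
  rwa [hh.lorentz_Y_dz, add_zero] at this

theorem lorentz_Yzbar (hh : IsIsotropicFrame y h) (hy : IsConformalImmersion y) (i : Fin 2)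
    (z : ℂ) : lorentz (dzbar (canonicalLift y) z) (h i z) = 0 :=
  lorentz_dzbar_eq_zero hy.contDiff_canonicalLift (hh.smooth i) (hh.lorentz_Y i) (hh.hol i) z

theorem lorentz_Yzzbar (hh : IsIsotropicFrame y h) (hy : IsConformalImmersion y) (i : Fin 2)
    (z : ℂ) : lorentz (dzbar (dz (canonicalLift y)) z) (h i z) = 0 :=
  lorentz_dzbar_eq_zero (contDiff_dz hy.contDiff_canonicalLift) (hh.smooth i)
    (hh.lorentz_Yz hy i) (hh.hol i) z

/-- Orthogonality to `Y_z` uses `Y ⊥ hᵢ'`, orthogonality to `Y_z̄` and `Y_zz̄` uses holomorphy of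
`hᵢ`, and `N` is a combination of `Y` and `Y_zz̄`. -/
theorem isNormal (hh : IsIsotropicFrame y h) (hy : IsConformalImmersion y) (i : Fin 2) (z : ℂ) :
    IsNormal y z (h i z) where
  perp_Y := by rw [lorentz_comm, hh.lorentz_Y]
  perp_Yz := by rw [lorentz_comm, hh.lorentz_Yz hy]
  perp_Yzbar := by rw [lorentz_comm, hh.lorentz_Yzbar hy]
  perp_N := by
    rw [lorentz_comm]
    simp only [lightlikeN, lorentz_add_left, lorentz_smul_left, hh.lorentz_Y,
      hh.lorentz_Yzzbar hy, mul_zero, add_zero]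

theorem isNormal_star (hh : IsIsotropicFrame y h) (hy : IsConformalImmersion y) (i : Fin 2)
    (z : ℂ) : IsNormal y z (star (h i z)) := by
  obtain ⟨h1, h2, h3, h4⟩ := hh.isNormal hy i z
  constructor
  · rw [← IsConformalImmersion.star_canonicalLift, lorentz_star_eq_zero h1]
  · rw [← hy.star_dzbar_canonicalLift, lorentz_star_eq_zero h3]
  · rw [← hy.star_dz_canonicalLift, lorentz_star_eq_zero h2]
  · rw [← hy.star_lightlikeN, lorentz_star_eq_zero h4]

theorem iso_star (hh : IsIsotropicFrame y h) (i j : Fin 2) (z : ℂ) :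
    lorentz (star (h i z)) (star (h j z)) = 0 :=
  lorentz_star_eq_zero (hh.iso i j z)

theorem eq_zero_of_gram (hh : IsIsotropicFrame y h) {z a b : ℂ}
    (h0 : a * lorentz (h 0 z) (star (h 0 z)) + b * lorentz (h 1 z) (star (h 0 z)) = 0)
    (h1 : a * lorentz (h 0 z) (star (h 1 z)) + b * lorentz (h 1 z) (star (h 1 z)) = 0) :
    a = 0 ∧ b = 0 := by
  have hd := hh.gram_ne_zero z
  constructor
  · refine (mul_eq_zero.1 ?_).resolve_right hd
    linear_combination lorentz (h 1 z) (star (h 1 z)) * h0 - lorentz (h 1 z) (star (h 0 z)) * h1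
  · refine (mul_eq_zero.1 ?_).resolve_right hd
    linear_combination lorentz (h 0 z) (star (h 0 z)) * h1 - lorentz (h 0 z) (star (h 1 z)) * h0

/-- Pairing a relation with `N, Y_z̄, Y_z, Y` isolates the first four coefficients; the others
satisfy two 2×2 systems governed by the Gram matrix. -/
theorem linearIndependent_frame (hh : IsIsotropicFrame y h) (hy : IsConformalImmersion y) (z : ℂ) :
    LinearIndependent ℂ ![canonicalLift y z, dz (canonicalLift y) z, dzbar (canonicalLift y) z,
      lightlikeN y z, h 0 z, h 1 z, star (h 0 z), star (h 1 z)] := by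
  rw [Fintype.linearIndependent_iff]
  intro g hg
  rw [Fin.sum_univ_eight] at hg
  simp only [Matrix.cons_val] at hg
  have key := fun w => congrArg (fun v => lorentz v w) hg
  simp only [lorentz_add_left, lorentz_smul_left, lorentz_zero_left] at key
  have e1 := lorentz_comm (dz (canonicalLift y) z) (lightlikeN y z)
  have e2 := lorentz_comm (dzbar (canonicalLift y) z) (lightlikeN y z)
  have e3 := lorentz_comm (canonicalLift y z) (lightlikeN y z)
  have e4 := lorentz_comm (canonicalLift y z) (dz (canonicalLift y) z)
  have e5 := lorentz_comm (canonicalLift y z) (dzbar (canonicalLift y) z)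
  have e6 := lorentz_comm (dzbar (canonicalLift y) z) (dz (canonicalLift y) z)
  have n1 := fun i => (hh.isNormal hy i z).perp_Y
  have n2 := fun i => (hh.isNormal hy i z).perp_Yz
  have n3 := fun i => (hh.isNormal hy i z).perp_Yzbar
  have n4 := fun i => (hh.isNormal hy i z).perp_N
  have s1 := fun i => (hh.isNormal_star hy i z).perp_Y
  have s2 := fun i => (hh.isNormal_star hy i z).perp_Yz
  have s3 := fun i => (hh.isNormal_star hy i z).perp_Yzbar
  have s4 := fun i => (hh.isNormal_star hy i z).perp_N
  have k0 := key (lightlikeN y z)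
  have k1 := key (dzbar (canonicalLift y) z)
  have k2 := key (dz (canonicalLift y) z)
  have k3 := key (canonicalLift y z)
  simp only [e1, e2, e3, e4, e5, e6, n1, n2, n3, n4, s1, s2, s3, s4, hy.lorentz_Y_Y,
    hy.lorentz_Yz_Y, hy.lorentz_Yzbar_Y, hy.lorentz_Yz_Yz, hy.lorentz_Yz_Yzbar,
    hy.lorentz_Yzbar_Yzbar, hy.lorentz_N_Y, hy.lorentz_N_N, hy.lorentz_N_Yz,
    hy.lorentz_N_Yzbar] at k0 k1 k2 k3
  have g0 : g 0 = 0 := by linear_combination -k0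
  have g1 : g 1 = 0 := by linear_combination 2 * k1
  have g2 : g 2 = 0 := by linear_combination 2 * k2
  have g3 : g 3 = 0 := by linear_combination -k3
  have k4 := key (star (h 0 z))
  have k5 := key (star (h 1 z))
  have k6 := key (h 0 z)
  have k7 := key (h 1 z)
  simp only [g0, g1, g2, g3, hh.iso, hh.iso_star, zero_mul, mul_zero, zero_add, add_zero]
    at k4 k5 k6 k7
  obtain ⟨g4, g5⟩ := hh.eq_zero_of_gram k4 k5
  -- The system for the last two coefficients is the complex conjugate of the Gram system.
  have g67 : starRingEnd ℂ (g 6) = 0 ∧ starRingEnd ℂ (g 7) = 0 := by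
    apply hh.eq_zero_of_gram (z := z)
    · have := congrArg (starRingEnd ℂ) k6
      simpa only [map_add, map_mul, ← lorentz_star, star_star, map_zero] using this
    · have := congrArg (starRingEnd ℂ) k7
      simpa only [map_add, map_mul, ← lorentz_star, star_star, map_zero] using this
  simp only [map_eq_zero] at g67
  intro i
  fin_cases i
  exacts [g0, g1, g2, g3, g4, g5, g67.1, g67.2]

theorem eq_zero_of_isNormal (hh : IsIsotropicFrame y h) (hy : IsConformalImmersion y) {z : ℂ}
    {w : Fin 8 → ℂ} (hw : IsNormal y z w) (h1 : ∀ i, lorentz w (h i z) = 0)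
    (h2 : ∀ i, lorentz w (star (h i z)) = 0) : w = 0 := by
  have htop := (hh.linearIndependent_frame hy z).span_eq_top_of_card_eq_finrank' (by simp)
  apply eq_zero_of_lorentz_eq_zero
  intro v
  have hv : v ∈ (⊤ : Submodule ℂ (Fin 8 → ℂ)) := Submodule.mem_top
  rw [← htop] at hv
  induction hv using Submodule.span_induction with
  | mem u hu =>
    obtain ⟨i, rfl⟩ := hu
    fin_cases i
    exacts [hw.perp_Y, hw.perp_Yz, hw.perp_Yzbar, hw.perp_N, h1 0, h1 1, h2 0, h2 1]
  | zero => exact lorentz_zero_right w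
  | add u w _ _ h1 h2 => rw [lorentz_add_right, h1, h2, add_zero]
  | smul c u _ h1 => rw [lorentz_smul_right, h1, mul_zero]

/-- A normal vector orthogonal to the conjugate frame is a combination of the conjugate frame. -/
theorem exists_eq_of_isNormal (hh : IsIsotropicFrame y h) (hy : IsConformalImmersion y) {z : ℂ}
    {w : Fin 8 → ℂ} (hw : IsNormal y z w) (h2 : ∀ i, lorentz w (star (h i z)) = 0) :
    ∃ a b : ℂ, w = a • star (h 0 z) + b • star (h 1 z) := by
  have hd := hh.gram_ne_zero z
  set d := lorentz (h 0 z) (star (h 0 z)) * lorentz (h 1 z) (star (h 1 z))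
    - lorentz (h 0 z) (star (h 1 z)) * lorentz (h 1 z) (star (h 0 z)) with hd'
  -- Cramer's rule: the coefficients are chosen so that both sides have the same pairings with `h₀`
  -- and `h₁`.
  refine ⟨(lorentz w (h 0 z) * lorentz (h 1 z) (star (h 1 z))
      - lorentz w (h 1 z) * lorentz (h 0 z) (star (h 1 z))) / d,
    (lorentz w (h 1 z) * lorentz (h 0 z) (star (h 0 z))
      - lorentz w (h 0 z) * lorentz (h 1 z) (star (h 0 z))) / d, ?_⟩
  rw [← sub_eq_zero]
  apply hh.eq_zero_of_isNormal hy (z := z)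
  · have s1 := fun i => (hh.isNormal_star hy i z).perp_Y
    have s2 := fun i => (hh.isNormal_star hy i z).perp_Yz
    have s3 := fun i => (hh.isNormal_star hy i z).perp_Yzbar
    have s4 := fun i => (hh.isNormal_star hy i z).perp_N
    obtain ⟨h1, h2, h3, h4⟩ := hw
    constructor <;>
      simp only [lorentz_sub_left, lorentz_add_left, lorentz_smul_left, s1, s2, s3, s4, h1, h2,
        h3, h4, mul_zero, add_zero, sub_zero]
  · intro i
    simp only [lorentz_sub_left, lorentz_add_left, lorentz_smul_left, lorentz_comm (star _)]
    fin_cases i <;> simp only [Fin.zero_eta, Fin.mk_one] <;> field_simp <;> rw [hd'] <;> ring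
  · intro i
    simp only [lorentz_sub_left, lorentz_add_left, lorentz_smul_left, hh.iso_star, h2, mul_zero,
      add_zero, sub_zero]

theorem isNormal_hopf (hy : IsConformalImmersion y) (z : ℂ) : IsNormal y z (hopf y z) :=
  hy.isNormal_normalPart _ _

/-- The pairings of `Y_zz` with `Y`, `Y_z`, `Y_z̄` vanish, so the projection only removes the `Y`
component, whose coefficient is the Schwarzian. -/
theorem hopf_eq (hh : IsIsotropicFrame y h) (hy : IsConformalImmersion y) (z : ℂ) :
    hopf y z = dz (dz (canonicalLift y)) z + (schwarzian y z / 2) • canonicalLift y z := by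
  have h1 : lorentz (dz (dz (canonicalLift y)) z) (canonicalLift y z) = 0 :=
    hh.lorentz_iterate_dz hy 2 0 z
  have h2 : lorentz (dz (dz (canonicalLift y)) z) (dz (canonicalLift y) z) = 0 :=
    hh.lorentz_iterate_dz hy 2 1 z
  have h3 : lorentz (dz (dz (canonicalLift y)) z) (dzbar (canonicalLift y) z) = 0 := by
    have h4 := dz_lorentz_eq_zero (contDiff_dz hy.contDiff_canonicalLift)
      (contDiff_dzbar hy.contDiff_canonicalLift) hy.lorentz_Yz_Yzbar z
    rwa [← dzbar_dz_comm hy.contDiff_canonicalLift, lorentz_comm (dz _ _) (dzbar (dz _) _),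
      hy.lorentz_Yzzbar_Yz, add_zero] at h4
  rw [hopf, normalPart, schwarzian, h1, h2, h3]
  module

theorem contDiff_hopf (hy : IsConformalImmersion y) : ContDiff ℝ ∞ (hopf y) :=
  hy.contDiff_normalPart (contDiff_dz (contDiff_dz hy.contDiff_canonicalLift))

theorem contDiff_normalDzbar (hy : IsConformalImmersion y) {f : ℂ → Fin 8 → ℂ}
    (hf : ContDiff ℝ ∞ f) : ContDiff ℝ ∞ (normalDzbar y f) :=
  hy.contDiff_normalPart (contDiff_dzbar hf)

theorem hopf_star (hh : IsIsotropicFrame y h) (hy : IsConformalImmersion y) (i : Fin 2) (z : ℂ) :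
    lorentz (hopf y z) (star (h i z)) = 0 := by
  rw [hopf, (hh.isNormal_star hy i z).lorentz_normalPart]
  exact (hh.iterate_dz_perp hy 2).2.1 i z

/-- The derivative `D_z̄` preserves the conjugate of the isotropic plane bundle. -/
theorem normalDzbar_star (hh : IsIsotropicFrame y h) (hy : IsConformalImmersion y)
    {f : ℂ → Fin 8 → ℂ} (hf : ContDiff ℝ ∞ f) (hfn : ∀ z, IsNormal y z (f z))
    (hfh : ∀ i z, lorentz (f z) (star (h i z)) = 0) (i : Fin 2) (z : ℂ) :
    lorentz (normalDzbar y f z) (star (h i z)) = 0 := by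
  rw [normalDzbar, (hh.isNormal_star hy i z).lorentz_normalPart]
  have h1 := dzbar_lorentz_eq_zero hf (contDiff_star (hh.smooth i)) (hfh i) z
  -- `f` is a combination of `h̄₀, h̄₁`, and these are orthogonal to `∂_z̄ h̄ᵢ`, the conjugate of
  -- `hᵢ'`; so the second Leibniz term vanishes.
  obtain ⟨a, b, hab⟩ := hh.exists_eq_of_isNormal hy (hfn z) (hfh · z)
  rw [dzbar_star (hh.smooth i), hab, lorentz_add_left, lorentz_smul_left, lorentz_smul_left,
    lorentz_star_eq_zero (hh.iso_dz _ _ z), lorentz_star_eq_zero (hh.iso_dz _ _ z)] at h1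
  linear_combination h1

theorem dzbar_dz_dz_eq_zero (hh : IsIsotropicFrame y h) (i : Fin 2) (z : ℂ) :
    dzbar (dz (dz (h i))) z = 0 := by
  rw [dzbar_dz_comm (contDiff_dz (hh.smooth i))]
  have : dzbar (dz (h i)) = fun _ => 0 := funext (hh.dzbar_dz_eq_zero i)
  rw [this, dz_eq_wirtinger, wirtinger_const]

/-- Two applications of the Leibniz rule, to `⟨Y_z, hᵢ⟩ = 0` and to `⟨Y, hᵢ'⟩ = 0`, move both
derivatives onto `hᵢ`. -/
theorem lorentz_hopf (hh : IsIsotropicFrame y h) (hy : IsConformalImmersion y) (i : Fin 2)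
    (z : ℂ) : lorentz (hopf y z) (h i z) = lorentz (canonicalLift y z) (dz (dz (h i)) z) := by
  have hY := hy.contDiff_canonicalLift
  rw [hopf, (hh.isNormal hy i z).lorentz_normalPart]
  have h1 := dz_lorentz_eq_zero (contDiff_dz hY) (hh.smooth i) (hh.lorentz_Yz hy i) z
  have h2 := dz_lorentz_eq_zero hY (contDiff_dz (hh.smooth i)) (hh.lorentz_Y_dz i) z
  linear_combination h1 - h2

/-- For a field `f` and a holomorphic field `h`, pairings with `D_z̄ f` are `∂_z̄` of pairings. -/
theorem lorentz_normalDzbar (hh : IsIsotropicFrame y h) (hy : IsConformalImmersion y)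
    {f g : ℂ → Fin 8 → ℂ} (hf : ContDiff ℝ ∞ f) (hg : ContDiff ℝ ∞ g) (i : Fin 2)
    (hfg : ∀ z, lorentz (f z) (h i z) = lorentz (g z) (dz (dz (h i)) z)) (z : ℂ) :
    lorentz (normalDzbar y f z) (h i z) = lorentz (dzbar g z) (dz (dz (h i)) z) := by
  have hd := differentiableAt_of_contDiff (contDiff_dz (contDiff_dz (hh.smooth i))) z
  have h1 := wirtinger_lorentz (differentiableAt_of_contDiff hf z)
    (differentiableAt_of_contDiff (hh.smooth i) z) I
  have h2 := wirtinger_lorentz (differentiableAt_of_contDiff hg z) hd I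
  simp only [hfg] at h1
  rw [h2] at h1
  simp only [← dzbar_eq_wirtinger, hh.hol, hh.dzbar_dz_dz_eq_zero, lorentz_zero_right,
    add_zero] at h1
  rw [normalDzbar, (hh.isNormal hy i z).lorentz_normalPart, h1]

theorem lorentz_dz_dz (hh : IsIsotropicFrame y h) (i j : Fin 2) (z : ℂ) :
    lorentz (h i z) (dz (dz (h j)) z) = 0 := by
  have h1 := dz_lorentz_eq_zero (hh.smooth i) (contDiff_dz (hh.smooth j)) (hh.iso_dz i j) z
  rwa [hh.iso_dz_dz, zero_add] at h1

/-- The left side is normal and orthogonal to `h̄₀, h̄₁`, so it suffices to pair it with `hᵢ`.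
There, `D_z̄` acts as `∂_z̄` on the factor `Y` of `⟨Y, hᵢ''⟩`. -/
theorem willmoreEquation (hh : IsIsotropicFrame y h) (hy : IsConformalImmersion y) :
    WillmoreEquation y := by
  intro z
  have hY := hy.contDiff_canonicalLift
  have hK := contDiff_hopf hy
  have hK1 := contDiff_normalDzbar hy hK
  have hKn := isNormal_hopf hy
  have hKs := hh.hopf_star hy
  have hK1n : ∀ z, IsNormal y z (normalDzbar y (hopf y) z) := fun z =>
    hy.isNormal_normalPart _ _
  have hK1s := hh.normalDzbar_star hy hK hKn hKs
  have hK2s := hh.normalDzbar_star hy hK1 hK1n hK1s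
  obtain ⟨n1, n2, n3, n4⟩ := hKn z
  obtain ⟨m1, m2, m3, m4⟩ := hy.isNormal_normalPart z (dzbar (normalDzbar y (hopf y)) z)
  apply hh.eq_zero_of_isNormal hy (z := z)
  · constructor <;> rw [lorentz_add_left, lorentz_smul_left, normalDzbar]
    · rw [m1, n1, mul_zero, add_zero]
    · rw [m2, n2, mul_zero, add_zero]
    · rw [m3, n3, mul_zero, add_zero]
    · rw [m4, n4, mul_zero, add_zero]
  · intro i
    have h1 := hh.lorentz_hopf hy i
    have h2 := hh.lorentz_normalDzbar hy hK hY i h1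
    have h3 := hh.lorentz_normalDzbar hy hK1 (contDiff_dzbar hY) i h2
    obtain ⟨a, b, hab⟩ := hh.exists_eq_of_isNormal hy (hKn z) (hKs · z)
    -- `κ̄` is a combination of `h₀, h₁`. Writing `κ̄ = Y_z̄z̄ + (s̄/2) Y` turns this identity into
    -- the Willmore equation paired with `hᵢ`.
    have h4 : lorentz (star (hopf y z)) (dz (dz (h i)) z) = 0 := by
      rw [hab, star_add, star_smul, star_smul, star_star, star_star, lorentz_add_left,
        lorentz_smul_left, lorentz_smul_left, hh.lorentz_dz_dz, hh.lorentz_dz_dz]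
      ring
    rw [hh.hopf_eq hy, star_add, star_smul, hy.star_dz_dz_canonicalLift,
      IsConformalImmersion.star_canonicalLift, lorentz_add_left, lorentz_smul_left] at h4
    rw [lorentz_add_left, lorentz_smul_left, h3, h1]
    simpa using h4
  · intro i
    rw [lorentz_add_left, lorentz_smul_left, hK2s, hKs, mul_zero, add_zero]

/-- A criterion for `κ` and `D_z̄ κ` to be linearly independent at a point. -/
theorem linearIndependent_hopf (hh : IsIsotropicFrame y h) (hy : IsConformalImmersion y) {z : ℂ}
    (hne : lorentz (coneLift y z) (dz (dz (h 0)) z)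
        * lorentz (dzbar (coneLift y) z) (dz (dz (h 1)) z)
      - lorentz (coneLift y z) (dz (dz (h 1)) z)
        * lorentz (dzbar (coneLift y) z) (dz (dz (h 0)) z) ≠ 0) :
    LinearIndependent ℂ ![hopf y z, normalDzbar y (hopf y) z] := by
  have h1 := fun i => hh.lorentz_hopf hy i
  have h2 := fun i => hh.lorentz_normalDzbar hy (contDiff_hopf hy) hy.contDiff_canonicalLift i
    (h1 i)
  set s := (((Real.sqrt (conformalFactor y z))⁻¹ : ℝ) : ℂ) with hs
  have hs0 : s ≠ 0 := ofReal_ne_zero.2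
    (inv_ne_zero (Real.sqrt_pos.2 (hy.conformalFactor_pos z)).ne')
  rw [LinearIndependent.pair_iff]
  intro a b hab
  have key := fun w => congrArg (fun v => lorentz v w) hab
  simp only [lorentz_add_left, lorentz_smul_left, lorentz_zero_left] at key
  have k0 := key (h 0 z)
  have k1 := key (h 1 z)
  rw [h1, h2, dzbar_eq_wirtinger, hy.wirtinger_canonicalLift, canonicalLift, lorentz_add_left,
    lorentz_smul_left, lorentz_smul_left, lorentz_smul_left, ← dzbar_eq_wirtinger, ← hs] at k0 k1
  set t := wirtinger I (fun z => (((Real.sqrt (conformalFactor y z))⁻¹ : ℝ) : ℂ)) z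
  -- The derivative `t` of the scale adds a multiple of one row to the other, so it cancels in the
  -- determinant and the unnormalized lift suffices.
  have hb : b = 0 := by
    refine (mul_eq_zero.1 ?_).resolve_right (mul_ne_zero (mul_ne_zero hs0 hs0) hne)
    linear_combination s * lorentz (coneLift y z) (dz (dz (h 0)) z) * k1
      - s * lorentz (coneLift y z) (dz (dz (h 1)) z) * k0
  rw [hb] at k0 k1
  refine ⟨(mul_eq_zero.1 ?_).resolve_right (mul_ne_zero hs0 hne), hb⟩
  linear_combination lorentz (dzbar (coneLift y) z) (dz (dz (h 1)) z) * k0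
    - lorentz (dzbar (coneLift y) z) (dz (dz (h 0)) z) * k1

end IsIsotropicFrame


/-! ### Isometries of the sphere -/

/-- A linear map of `ℂ⁸` which preserves the Lorentzian form and the real structure. -/
structure IsRealIsometry (A : (Fin 8 → ℂ) →L[ℂ] (Fin 8 → ℂ)) : Prop where
  lorentz_map : ∀ v w, lorentz (A v) (A w) = lorentz v w
  star_map : ∀ v, star (A v) = A (star v)

theorem dz_clm (A : (Fin 8 → ℂ) →L[ℂ] (Fin 8 → ℂ)) {f : ℂ → Fin 8 → ℂ} (hf : ContDiff ℝ ∞ f)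
    (z : ℂ) : dz (fun z => A (f z)) z = A (dz f z) := by
  rw [dz_eq_wirtinger, dz_eq_wirtinger, wirtinger_clm A (differentiableAt_of_contDiff hf z)]

theorem dzbar_clm (A : (Fin 8 → ℂ) →L[ℂ] (Fin 8 → ℂ)) {f : ℂ → Fin 8 → ℂ}
    (hf : ContDiff ℝ ∞ f) (z : ℂ) : dzbar (fun z => A (f z)) z = A (dzbar f z) :=
  wirtinger_clm A (differentiableAt_of_contDiff hf z) I

theorem contDiff_clm (A : (Fin 8 → ℂ) →L[ℂ] (Fin 8 → ℂ)) {f : ℂ → Fin 8 → ℂ}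
    (hf : ContDiff ℝ ∞ f) : ContDiff ℝ ∞ fun z => A (f z) :=
  (A.restrictScalars ℝ).contDiff.comp hf

namespace IsRealIsometry

variable {A : (Fin 8 → ℂ) →L[ℂ] (Fin 8 → ℂ)} {y y' : ℂ → EuclideanSpace ℝ (Fin 7)}

theorem injective (hA : IsRealIsometry A) : Function.Injective A := by
  rw [injective_iff_map_eq_zero]
  intro v hv
  apply eq_zero_of_lorentz_eq_zero
  intro w
  rw [← hA.lorentz_map, hv, lorentz_zero_left]

theorem lorentz_star_map (hA : IsRealIsometry A) (v w : Fin 8 → ℂ) :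
    lorentz (A v) (star (A w)) = lorentz v (star w) := by
  rw [hA.star_map, hA.lorentz_map]

theorem conformalFactor_eq (hA : IsRealIsometry A) (hy : ContDiff ℝ ∞ y)
    (hyy' : ∀ z, coneLift y' z = A (coneLift y z)) (z : ℂ) :
    conformalFactor y' z = conformalFactor y z := by
  have hL := contDiff_coneLift hy
  rw [conformalFactor, funext hyy', dz_clm A hL, dzbar_clm A hL, hA.lorentz_map, conformalFactor]

theorem canonicalLift_eq (hA : IsRealIsometry A) (hy : ContDiff ℝ ∞ y)
    (hyy' : ∀ z, coneLift y' z = A (coneLift y z)) (z : ℂ) :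
    canonicalLift y' z = A (canonicalLift y z) := by
  rw [canonicalLift, hA.conformalFactor_eq hy hyy', hyy', canonicalLift, map_smul]

theorem fderiv_canonicalLift_eq (hA : IsRealIsometry A) (hy : IsConformalImmersion y)
    (hyy' : ∀ z, coneLift y' z = A (coneLift y z)) (z v : ℂ) :
    fderiv ℝ (canonicalLift y') z v = A (fderiv ℝ (canonicalLift y) z v) := by
  rw [funext (hA.canonicalLift_eq hy.smooth hyy')]
  have h := ((A.restrictScalars ℝ).hasFDerivAt.comp z
    (differentiableAt_of_contDiff hy.contDiff_canonicalLift z).hasFDerivAt).fderiv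
  exact congrArg (fun B => B v) h

theorem lightlikeN_eq (hA : IsRealIsometry A) (hy : IsConformalImmersion y)
    (hyy' : ∀ z, coneLift y' z = A (coneLift y z)) (z : ℂ) :
    lightlikeN y' z = A (lightlikeN y z) := by
  have hY := hy.contDiff_canonicalLift
  simp only [lightlikeN]
  rw [funext (hA.canonicalLift_eq hy.smooth hyy'), funext (dz_clm A hY),
    dzbar_clm A (contDiff_dz hY), hA.lorentz_map, map_add, map_smul, map_smul]

/-- All conditions are expressed by the form, conjugation and derivatives, so one verification at `λ
= 1` serves the whole family. -/
theorem isIsotropicFrame (hA : IsRealIsometry A)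
    (hyy' : ∀ z, coneLift y' z = A (coneLift y z)) {h : Fin 2 → ℂ → Fin 8 → ℂ}
    (hh : IsIsotropicFrame y h) : IsIsotropicFrame y' fun i z => A (h i z) where
  smooth i := contDiff_clm A (hh.smooth i)
  hol i z := by rw [dzbar_clm A (hh.smooth i), hh.hol, map_zero]
  iso i j z := by rw [hA.lorentz_map, hh.iso]
  iso_dz i j z := by rw [dz_clm A (hh.smooth j), hA.lorentz_map, hh.iso_dz]
  iso_dz_dz i j z := by
    rw [dz_clm A (hh.smooth j), dz_clm A (hh.smooth i), hA.lorentz_map, hh.iso_dz_dz]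
  perp i z := by rw [hyy', hA.lorentz_map, hh.perp]
  perp_dz i z := by rw [hyy', dz_clm A (hh.smooth i), hA.lorentz_map, hh.perp_dz]
  indep z := by
    have h1 := (hh.indep z).map' A.toLinearMap (LinearMap.ker_eq_bot.2 hA.injective)
    have h2 : ![A (h 0 z), A (h 1 z), dz (fun z => A (h 0 z)) z, dz (fun z => A (h 1 z)) z] =
        A.toLinearMap ∘ ![h 0 z, h 1 z, dz (h 0) z, dz (h 1) z] := by
      ext i
      fin_cases i <;> simp [dz_clm A (hh.smooth _)]
    rw [h2]
    exact h1
  gram_ne_zero z := by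
    simp only [hA.lorentz_star_map]
    exact hh.gram_ne_zero z

end IsRealIsometry

/-! ### Immersions of the two-sphere -/

instance factFinrankThree : Fact (Module.finrank ℝ (EuclideanSpace ℝ (Fin 3)) = 2 + 1) :=
  ⟨finrank_euclideanSpace_fin⟩

instance factFinrankSeven : Fact (Module.finrank ℝ (EuclideanSpace ℝ (Fin 7)) = 6 + 1) :=
  ⟨finrank_euclideanSpace_fin⟩

theorem contMDiff_chartZero : ContMDiff 𝓘(ℝ, ℂ) (𝓡 2) ∞ chartZero := by
  apply ContMDiff.codRestrict_sphere
  rw [contMDiff_iff_contDiff, contDiff_piLp]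
  have h0 : ContDiff ℝ ∞ fun z : ℂ => 1 + normSq z := by
    simp only [normSq_apply]
    exact contDiff_const.add ((reCLM.contDiff.mul reCLM.contDiff).add
      (imCLM.contDiff.mul imCLM.contDiff))
  have h1 : ∀ z : ℂ, 1 + normSq z ≠ 0 := fun z => by have := normSq_nonneg z; positivity
  have hre : ContDiff ℝ ∞ re := reCLM.contDiff
  have him : ContDiff ℝ ∞ im := imCLM.contDiff
  have hn : ContDiff ℝ ∞ fun z : ℂ => normSq z - 1 := by
    have := h0.sub (contDiff_const (c := (2 : ℝ)))
    convert this using 2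
    ring
  intro i
  fin_cases i
  · exact (contDiff_const.mul hre).div h0 h1
  · exact (contDiff_const.mul him).div h0 h1
  · exact hn.div h0 h1

theorem contMDiff_chartInfty : ContMDiff 𝓘(ℝ, ℂ) (𝓡 2) ∞ chartInfty := by
  apply ContMDiff.codRestrict_sphere
  rw [contMDiff_iff_contDiff, contDiff_piLp]
  have h0 : ContDiff ℝ ∞ fun z : ℂ => 1 + normSq z := by
    simp only [normSq_apply]
    exact contDiff_const.add ((reCLM.contDiff.mul reCLM.contDiff).add
      (imCLM.contDiff.mul imCLM.contDiff))
  have h1 : ∀ z : ℂ, 1 + normSq z ≠ 0 := fun z => by have := normSq_nonneg z; positivity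
  have hre : ContDiff ℝ ∞ re := reCLM.contDiff
  have him : ContDiff ℝ ∞ im := imCLM.contDiff
  have hn : ContDiff ℝ ∞ fun z : ℂ => 1 - normSq z := by
    have := (contDiff_const (c := (2 : ℝ))).sub h0
    convert this using 2
    ring
  intro i
  fin_cases i
  · exact (contDiff_const.mul hre).div h0 h1
  · exact (contDiff_const.mul him).div h0 h1
  · exact hn.div h0 h1

/-- Splitting by hemisphere keeps the denominators `1 - p 2` and `1 + p 2` of the stereographic
projections away from zero. -/
theorem exists_chart_eq (p : S2) : (∃ z, chartZero z = p) ∨ ∃ w, chartInfty w = p := by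
  obtain ⟨p, hp⟩ := p
  have hp' : p 0 ^ 2 + p 1 ^ 2 + p 2 ^ 2 = 1 := by
    have := mem_sphere_zero_iff_norm.1 hp
    rw [EuclideanSpace.norm_eq, Real.sqrt_eq_one, Fin.sum_univ_three] at this
    simpa using this
  rcases le_total (p 2) 0 with h | h
  · left
    have hn : 1 - p 2 ≠ 0 := by linarith
    refine ⟨⟨p 0 / (1 - p 2), p 1 / (1 - p 2)⟩, Subtype.ext ?_⟩
    have h1 : 1 + normSq ⟨p 0 / (1 - p 2), p 1 / (1 - p 2)⟩ = 2 / (1 - p 2) := by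
      rw [normSq_mk]
      field_simp
      linear_combination hp'
    have h2 : normSq ⟨p 0 / (1 - p 2), p 1 / (1 - p 2)⟩ - 1 = 2 * p 2 / (1 - p 2) := by
      rw [eq_sub_of_add_eq' h1]
      field_simp
      ring
    ext j
    fin_cases j <;> simp only [chartZero, h1, h2] <;> simp <;> field_simp
  · right
    have hn : 1 + p 2 ≠ 0 := by linarith
    refine ⟨⟨p 0 / (1 + p 2), -p 1 / (1 + p 2)⟩, Subtype.ext ?_⟩
    have h1 : 1 + normSq ⟨p 0 / (1 + p 2), -p 1 / (1 + p 2)⟩ = 2 / (1 + p 2) := by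
      rw [normSq_mk]
      field_simp
      linear_combination hp'
    have h2 : 1 - normSq ⟨p 0 / (1 + p 2), -p 1 / (1 + p 2)⟩ = 2 * p 2 / (1 + p 2) := by
      rw [eq_sub_of_add_eq' h1]
      field_simp
      ring
    ext j
    fin_cases j <;> simp only [chartInfty, h1, h2] <;> simp <;> field_simp

/-- By the chain rule, injectivity of the composite differential makes that of the chart injective,
hence bijective by dimension; the chart can then be cancelled. -/
theorem injective_mfderiv_of_inCoord {X : S2 → S6} (hX : ContMDiff (𝓡 2) (𝓡 6) ∞ X)
    {φ : ℂ → S2} (hφ : ContMDiff 𝓘(ℝ, ℂ) (𝓡 2) ∞ φ) {z : ℂ}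
    (h : Function.Injective (fderiv ℝ (inCoord φ X) z)) :
    Function.Injective (mfderiv (𝓡 2) (𝓡 6) X (φ z)) := by
  have hc : ContMDiff (𝓡 6) 𝓘(ℝ, EuclideanSpace ℝ (Fin 7)) ∞
      ((↑) : S6 → EuclideanSpace ℝ (Fin 7)) := contMDiff_coe_sphere
  have d1 := (hφ z).mdifferentiableAt (by norm_num)
  have d2 := (hX (φ z)).mdifferentiableAt (by norm_num)
  have d3 := (hc (X (φ z))).mdifferentiableAt (by norm_num)
  have h1 : mfderiv 𝓘(ℝ, ℂ) 𝓘(ℝ, EuclideanSpace ℝ (Fin 7)) (inCoord φ X) z =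
      (mfderiv (𝓡 6) 𝓘(ℝ, EuclideanSpace ℝ (Fin 7)) ((↑) : S6 → EuclideanSpace ℝ (Fin 7)) (X (φ z))).comp
        ((mfderiv (𝓡 2) (𝓡 6) X (φ z)).comp (mfderiv 𝓘(ℝ, ℂ) (𝓡 2) φ z)) := by
    rw [← mfderiv_comp z d2 d1]
    exact mfderiv_comp z d3 (d2.comp z d1)
  rw [← mfderiv_eq_fderiv, h1] at h
  have h2 : Function.Injective ((mfderiv (𝓡 2) (𝓡 6) X (φ z)).comp
      (mfderiv 𝓘(ℝ, ℂ) (𝓡 2) φ z)) := Function.Injective.of_comp h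
  have h3 : Function.Injective (mfderiv 𝓘(ℝ, ℂ) (𝓡 2) φ z) := Function.Injective.of_comp h2
  -- The tangent spaces are unfolded to their model spaces so that real dimensions can be compared.
  let L : ℂ →ₗ[ℝ] EuclideanSpace ℝ (Fin 2) := (mfderiv 𝓘(ℝ, ℂ) (𝓡 2) φ z).toLinearMap
  have h4 : Function.Surjective L :=
    (LinearMap.injective_iff_surjective_of_finrank_eq_finrank (by simp)).1 h3
  intro u v huv
  obtain ⟨u, rfl⟩ := h4 u
  obtain ⟨v, rfl⟩ := h4 v
  exact congrArg L (h2 huv)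

theorem isWillmoreImmersion_of_isIsotropicFrame {X : S2 → S6}
    (hX : ContMDiff (𝓡 2) (𝓡 6) ∞ X) (h0 : IsConformalImmersion (inCoord chartZero X))
    (h1 : IsConformalImmersion (inCoord chartInfty X)) {h h' : Fin 2 → ℂ → Fin 8 → ℂ}
    (hh : IsIsotropicFrame (inCoord chartZero X) h)
    (hh' : IsIsotropicFrame (inCoord chartInfty X) h') :
    IsWillmoreImmersion X ∧ IsTotallyIsotropic X := by
  refine ⟨⟨hX, fun p => ?_, ⟨h0, h1⟩, ⟨hh.willmoreEquation h0, hh'.willmoreEquation h1⟩⟩,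
    fun m n _ _ z => hh.lorentz_iterate_dz h0 m n z,
    fun m n _ _ z => hh'.lorentz_iterate_dz h1 m n z⟩
  rcases exists_chart_eq p with ⟨z, rfl⟩ | ⟨w, rfl⟩
  · exact injective_mfderiv_of_inCoord hX contMDiff_chartZero (h0.immersion z)
  · exact injective_mfderiv_of_inCoord hX contMDiff_chartInfty (h1.immersion w)


/-! ### The explicit surface -/

section Rules

variable {f g : ℂ → ℂ} {z : ℂ}

theorem wirtinger_pow (hf : DifferentiableAt ℝ f z) (a : ℂ) (n : ℕ) :
    wirtinger a (fun z => f z ^ n) z = n * f z ^ (n - 1) * wirtinger a f z := by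
  induction n with
  | zero => simp [wirtinger_const]
  | succ n ih =>
    simp only [pow_succ]
    rw [wirtinger_mul (f := fun z => f z ^ n) (hf.pow n) hf, ih]
    rcases n with _ | n
    · simp
    · simp [pow_succ]
      ring

theorem dz_id (z : ℂ) : wirtinger (-I) (fun z => z) z = 1 := by
  rw [wirtinger_id]
  linear_combination (-1 / 2 : ℂ) * I_sq

theorem dzbar_id (z : ℂ) : wirtinger I (fun z => z) z = 0 := by
  rw [wirtinger_id]
  linear_combination (1 / 2 : ℂ) * I_sq

theorem dz_conj (z : ℂ) : wirtinger (-I) (fun z => starRingEnd ℂ z) z = 0 := by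
  rw [wirtinger_conj_id]
  linear_combination (1 / 2 : ℂ) * I_sq

theorem dzbar_conj (z : ℂ) : wirtinger I (fun z => starRingEnd ℂ z) z = 1 := by
  rw [wirtinger_conj_id]
  linear_combination (-1 / 2 : ℂ) * I_sq

theorem dz_mul_id (c z : ℂ) : wirtinger (-I) (fun z => c * z) z = c := by
  rw [wirtinger_mul (differentiableAt_const c) differentiableAt_fun_id, dz_id, wirtinger_const]
  ring

theorem dzbar_mul_id (c z : ℂ) : wirtinger I (fun z => c * z) z = 0 := by
  rw [wirtinger_mul (differentiableAt_const c) differentiableAt_fun_id, dzbar_id, wirtinger_const]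
  ring

theorem contDiff_conj : ContDiff ℝ ∞ fun z => starRingEnd ℂ z := conjCLE.contDiff

theorem differentiableAt_conj (z : ℂ) : DifferentiableAt ℝ (fun z => starRingEnd ℂ z) z :=
  conjCLE.differentiableAt

end Rules

/-- The common denominator of the surface in homogeneous coordinates. -/
noncomputable def denominator {R : Type*} [Field R] (t s : R) : R :=
  t ^ 4 + t ^ 3 * s + 5 / 4 * t ^ 2 * s ^ 2 + 4 / 9 * t * s ^ 3 + s ^ 4 / 36

/-- The polynomial lightlike lift of the surface in homogeneous coordinates. -/
noncomputable def lightVector (t s a b : ℂ) : Fin 8 → ℂ :=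
  ![denominator t s,
    t ^ 4 - t ^ 3 * s - 3 / 4 * t ^ 2 * s ^ 2 + 4 / 9 * t * s ^ 3 - s ^ 4 / 36,
    -I * ((a - b) * (t ^ 3 + s ^ 3 / 9)),
    (a + b) * (t ^ 3 + s ^ 3 / 9),
    -I * ((a ^ 2 - b ^ 2) * (t ^ 2 - s ^ 2 / 12)),
    (a ^ 2 + b ^ 2) * (t ^ 2 - s ^ 2 / 12),
    -I * ((a - b) * (s * t / 2 * (t + 4 / 3 * s))),
    (a + b) * (s * t / 2 * (t + 4 / 3 * s))]

/-- The polynomial lift in the coordinate `z`. -/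
noncomputable def liftZero (z : ℂ) : Fin 8 → ℂ := lightVector 1 (z * starRingEnd ℂ z) z (starRingEnd ℂ z)

/-- The polynomial lift in the coordinate `w = 1 / z`. -/
noncomputable def liftInfty (w : ℂ) : Fin 8 → ℂ := lightVector (w * starRingEnd ℂ w) 1 (starRingEnd ℂ w) w

/-- Only the relation `t s = a b` is used, so both charts are covered by the same identity. -/
theorem lightVector_null {t s a b : ℂ} (h : t * s = a * b) :
    lorentz (lightVector t s a b) (lightVector t s a b) = 0 := by
  simp only [lorentz, Fin.sum_univ_seven, lightVector, denominator]
  simp [Fin.succ]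
  linear_combination (-4 * (t ^ 3 + s ^ 3 / 9) ^ 2 - 4 * (a * b + t * s) * (t ^ 2 - s ^ 2 / 12) ^ 2
    - 4 * (s * t / 2 * (t + 4 / 3 * s)) ^ 2) * h + (((a - b) * (t ^ 3 + s ^ 3 / 9)) ^ 2
    + ((a ^ 2 - b ^ 2) * (t ^ 2 - s ^ 2 / 12)) ^ 2
    + ((a - b) * (s * t / 2 * (t + 4 / 3 * s))) ^ 2) * I_sq

theorem contDiff_liftZero : ContDiff ℝ ∞ liftZero := by
  have := contDiff_conj
  rw [contDiff_pi]
  intro i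
  fin_cases i <;> simp only [liftZero, lightVector, denominator] <;> simp <;> fun_prop

theorem contDiff_liftInfty : ContDiff ℝ ∞ liftInfty := by
  have := contDiff_conj
  rw [contDiff_pi]
  intro i
  fin_cases i <;> simp only [liftInfty, lightVector, denominator] <;> simp <;> fun_prop

/-- What matters is that every coefficient is positive: the conformal factor then has no zero in
this chart. The other chart has the same coefficients in reverse order. -/
theorem lorentz_dz_liftZero (z : ℂ) :
    lorentz (dz liftZero z) (dzbar liftZero z) =
      2 + 8 * (z * starRingEnd ℂ z) + 1 / 2 * (z * starRingEnd ℂ z) ^ 2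
      + 4 / 9 * (z * starRingEnd ℂ z) ^ 3 + 8 / 9 * (z * starRingEnd ℂ z) ^ 4
      + 1 / 18 * (z * starRingEnd ℂ z) ^ 5 + 2 / 81 * (z * starRingEnd ℂ z) ^ 6 := by
  have := differentiableAt_conj
  have hd := differentiableAt_of_contDiff contDiff_liftZero z
  simp only [dz_eq_wirtinger, dzbar_eq_wirtinger, lorentz, Fin.sum_univ_seven, wirtinger_pi hd]
  simp only [liftZero, lightVector, denominator]
  simp [Fin.succ]
  simp (disch := fun_prop) [div_eq_mul_inv, wirtinger_add, wirtinger_sub, wirtinger_mul,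
    wirtinger_pow, wirtinger_neg, wirtinger_const, dz_id, dzbar_id, dz_conj, dzbar_conj]
  ring_nf
  simp only [I_sq]
  ring

theorem lorentz_dz_liftInfty (z : ℂ) :
    lorentz (dz liftInfty z) (dzbar liftInfty z) =
      2 / 81 + 1 / 18 * (z * starRingEnd ℂ z) + 8 / 9 * (z * starRingEnd ℂ z) ^ 2
      + 4 / 9 * (z * starRingEnd ℂ z) ^ 3 + 1 / 2 * (z * starRingEnd ℂ z) ^ 4
      + 8 * (z * starRingEnd ℂ z) ^ 5 + 2 * (z * starRingEnd ℂ z) ^ 6 := by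
  have := differentiableAt_conj
  have hd := differentiableAt_of_contDiff contDiff_liftInfty z
  simp only [dz_eq_wirtinger, dzbar_eq_wirtinger, lorentz, Fin.sum_univ_seven, wirtinger_pi hd]
  simp only [liftInfty, lightVector, denominator]
  simp [Fin.succ]
  simp (disch := fun_prop) [div_eq_mul_inv, wirtinger_add, wirtinger_sub, wirtinger_mul,
    wirtinger_pow, wirtinger_neg, wirtinger_const, dz_id, dzbar_id, dz_conj, dzbar_conj]
  ring_nf
  simp only [I_sq]
  ring

/-! ### The isotropic frames -/

/-- The isotropic frame in the coordinate `z`. -/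
noncomputable def frameZero : Fin 2 → ℂ → Fin 8 → ℂ :=
  ![fun z => ![I * z ^ 2, -I * z ^ 2, -2 * z, 2 * I * z, 1, -I, z ^ 3 / 3, I * z ^ 3 / 3],
    fun z => ![-I * z, -I * z, -z ^ 2 / 2, -I * z ^ 2 / 2, -z ^ 3 / 3, -I * z ^ 3 / 3, 1, -I]]

/-- The derivative of the isotropic frame in the coordinate `z`. -/
noncomputable def frameZeroDeriv : Fin 2 → ℂ → Fin 8 → ℂ :=
  ![fun z => ![2 * I * z, -2 * I * z, -2, 2 * I, 0, 0, z ^ 2, I * z ^ 2],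
    fun z => ![-I, -I, -z, -I * z, -z ^ 2, -I * z ^ 2, 0, 0]]

/-- The isotropic frame in the coordinate `w = 1 / z`. -/
noncomputable def frameInfty : Fin 2 → ℂ → Fin 8 → ℂ :=
  ![fun w => ![I * w, -I * w, -2 * w ^ 2, 2 * I * w ^ 2, w ^ 3, -I * w ^ 3, 1 / 3, I / 3],
    fun w => ![-I * w ^ 2, -I * w ^ 2, -w / 2, -I * w / 2, -1 / 3, -I / 3, w ^ 3, -I * w ^ 3]]

/-- The derivative of the isotropic frame in the coordinate `w = 1 / z`. -/
noncomputable def frameInftyDeriv : Fin 2 → ℂ → Fin 8 → ℂ :=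
  ![fun w => ![I, -I, -4 * w, 4 * I * w, 3 * w ^ 2, -3 * I * w ^ 2, 0, 0],
    fun w => ![-2 * I * w, -2 * I * w, -1 / 2, -I / 2, 0, 0, 3 * w ^ 2, -3 * I * w ^ 2]]

theorem contDiff_frameZero (i : Fin 2) : ContDiff ℝ ∞ (frameZero i) := by
  rw [contDiff_pi]
  intro j
  fin_cases i <;> fin_cases j <;> simp only [frameZero] <;> simp <;> fun_prop

theorem contDiff_frameInfty (i : Fin 2) : ContDiff ℝ ∞ (frameInfty i) := by
  rw [contDiff_pi]
  intro j
  fin_cases i <;> fin_cases j <;> simp only [frameInfty] <;> simp <;> fun_prop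

theorem dzbar_frameZero (i : Fin 2) (z : ℂ) : dzbar (frameZero i) z = 0 := by
  have hd := differentiableAt_of_contDiff (contDiff_frameZero i) z
  ext j
  rw [dzbar_eq_wirtinger, wirtinger_pi hd]
  fin_cases i <;> fin_cases j <;> simp only [frameZero] <;>
  simp (disch := fun_prop) [div_eq_mul_inv, wirtinger_mul, wirtinger_pow, wirtinger_neg,
    wirtinger_const, dzbar_id, dzbar_mul_id]

theorem dzbar_frameInfty (i : Fin 2) (z : ℂ) : dzbar (frameInfty i) z = 0 := by
  have hd := differentiableAt_of_contDiff (contDiff_frameInfty i) z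
  ext j
  rw [dzbar_eq_wirtinger, wirtinger_pi hd]
  fin_cases i <;> fin_cases j <;> simp only [frameInfty] <;>
  simp (disch := fun_prop) [div_eq_mul_inv, wirtinger_mul, wirtinger_pow, wirtinger_neg,
    wirtinger_const, dzbar_id, dzbar_mul_id]

theorem dz_frameZero (i : Fin 2) (z : ℂ) : dz (frameZero i) z = frameZeroDeriv i z := by
  have hd := differentiableAt_of_contDiff (contDiff_frameZero i) z
  ext j
  rw [dz_eq_wirtinger, wirtinger_pi hd]
  fin_cases i <;> fin_cases j <;> simp only [frameZero, frameZeroDeriv] <;>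
  simp (disch := fun_prop) [div_eq_mul_inv, wirtinger_mul, wirtinger_pow, wirtinger_neg,
    wirtinger_const, dz_id, dz_mul_id] <;> ring

theorem dz_frameInfty (i : Fin 2) (z : ℂ) : dz (frameInfty i) z = frameInftyDeriv i z := by
  have hd := differentiableAt_of_contDiff (contDiff_frameInfty i) z
  ext j
  rw [dz_eq_wirtinger, wirtinger_pi hd]
  fin_cases i <;> fin_cases j <;> simp only [frameInfty, frameInftyDeriv] <;>
  simp (disch := fun_prop) [div_eq_mul_inv, wirtinger_mul, wirtinger_pow, wirtinger_neg,
    wirtinger_const, dz_id, dz_mul_id] <;> ring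


theorem lorentz_frameZero (i j : Fin 2) (z : ℂ) :
    lorentz (frameZero i z) (frameZero j z) = 0 := by
  fin_cases i <;> fin_cases j <;> simp [lorentz, Fin.sum_univ_seven, frameZero, Fin.succ] <;>
    ring_nf <;> simp only [I_sq] <;> ring

theorem lorentz_frameZero_deriv (i j : Fin 2) (z : ℂ) :
    lorentz (frameZero i z) (frameZeroDeriv j z) = 0 := by
  fin_cases i <;> fin_cases j <;>
    simp [lorentz, Fin.sum_univ_seven, frameZero, frameZeroDeriv, Fin.succ] <;>
    ring_nf <;> simp only [I_sq] <;> ring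

theorem lorentz_frameZeroDeriv (i j : Fin 2) (z : ℂ) :
    lorentz (frameZeroDeriv i z) (frameZeroDeriv j z) = 0 := by
  fin_cases i <;> fin_cases j <;>
    simp [lorentz, Fin.sum_univ_seven, frameZeroDeriv, Fin.succ] <;>
    ring_nf <;> simp only [I_sq] <;> ring

theorem lorentz_liftZero_frameZero (i : Fin 2) (z : ℂ) :
    lorentz (liftZero z) (frameZero i z) = 0 := by
  fin_cases i <;>
    simp [lorentz, Fin.sum_univ_seven, frameZero, liftZero, lightVector, denominator, Fin.succ] <;>
    ring_nf

theorem lorentz_liftZero_frameZeroDeriv (i : Fin 2) (z : ℂ) :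
    lorentz (liftZero z) (frameZeroDeriv i z) = 0 := by
  fin_cases i <;>
    simp [lorentz, Fin.sum_univ_seven, frameZeroDeriv, liftZero, lightVector, denominator,
      Fin.succ] <;>
    ring_nf

/-- The frame at infinity is `w³` times the first frame at `1 / w`, cubic being the maximal degree.
Direct verification also includes the point `w = 0`. -/
theorem lorentz_frameInfty (i j : Fin 2) (z : ℂ) :
    lorentz (frameInfty i z) (frameInfty j z) = 0 := by
  fin_cases i <;> fin_cases j <;> simp [lorentz, Fin.sum_univ_seven, frameInfty, Fin.succ] <;>
    ring_nf <;> simp only [I_sq] <;> ring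

theorem lorentz_frameInfty_deriv (i j : Fin 2) (z : ℂ) :
    lorentz (frameInfty i z) (frameInftyDeriv j z) = 0 := by
  fin_cases i <;> fin_cases j <;>
    simp [lorentz, Fin.sum_univ_seven, frameInfty, frameInftyDeriv, Fin.succ] <;>
    ring_nf <;> simp only [I_sq] <;> ring

theorem lorentz_frameInftyDeriv (i j : Fin 2) (z : ℂ) :
    lorentz (frameInftyDeriv i z) (frameInftyDeriv j z) = 0 := by
  fin_cases i <;> fin_cases j <;>
    simp [lorentz, Fin.sum_univ_seven, frameInftyDeriv, Fin.succ] <;>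
    ring_nf <;> simp only [I_sq] <;> ring

theorem lorentz_liftInfty_frameInfty (i : Fin 2) (z : ℂ) :
    lorentz (liftInfty z) (frameInfty i z) = 0 := by
  fin_cases i <;>
    simp [lorentz, Fin.sum_univ_seven, frameInfty, liftInfty, lightVector, denominator,
      Fin.succ] <;>
    ring_nf

theorem lorentz_liftInfty_frameInftyDeriv (i : Fin 2) (z : ℂ) :
    lorentz (liftInfty z) (frameInftyDeriv i z) = 0 := by
  fin_cases i <;>
    simp [lorentz, Fin.sum_univ_seven, frameInftyDeriv, liftInfty, lightVector, denominator,
      Fin.succ] <;>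
    ring_nf

theorem linearIndependent_frameZero (z : ℂ) : LinearIndependent ℂ
    ![frameZero 0 z, frameZero 1 z, frameZeroDeriv 0 z, frameZeroDeriv 1 z] := by
  rw [Fintype.linearIndependent_iff]
  intro g hg
  rw [Fin.sum_univ_four] at hg
  have key := fun i => congrFun hg i
  have k0 := key 0
  have k1 := key 1
  have k2 := key 2
  have k4 := key 4
  have k5 := key 5
  have k6 := key 6
  have k7 := key 7
  simp [frameZero, frameZeroDeriv] at k0 k1 k2 k4 k5 k6 k7
  -- In slots 4, 5 every vector except `h₀` is a multiple of `(1, i)`, which the functional `(1, i)`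
  -- kills while taking the value 2 on `(1, -i)`. Slots 6, 7 isolate `g 1` likewise.
  have g0 : g 0 = 0 := by
    linear_combination (k4 + I * k5) / 2 + (g 0 / 2 + g 1 * z ^ 3 / 6 + g 3 * z ^ 2 / 2) * I_sq
  have g1 : g 1 = 0 := by
    linear_combination (k6 + I * k7) / 2 + (g 1 / 2 - g 0 * z ^ 3 / 6 - g 2 * z ^ 2 / 2) * I_sq
  rw [g0, g1] at k0 k1 k2
  have g3 : g 3 = 0 := by
    linear_combination I * (k0 + k1) / 2 + g 3 * I_sq
  rw [g3] at k2
  have g2 : g 2 = 0 := by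
    linear_combination -k2 / 2
  intro i
  fin_cases i
  exacts [g0, g1, g2, g3]

theorem linearIndependent_frameInfty (z : ℂ) : LinearIndependent ℂ
    ![frameInfty 0 z, frameInfty 1 z, frameInftyDeriv 0 z, frameInftyDeriv 1 z] := by
  rw [Fintype.linearIndependent_iff]
  intro g hg
  rw [Fin.sum_univ_four] at hg
  have key := fun i => congrFun hg i
  have k0 := key 0
  have k1 := key 1
  have k2 := key 2
  have k4 := key 4
  have k5 := key 5
  have k6 := key 6
  have k7 := key 7
  simp [frameInfty, frameInftyDeriv] at k0 k1 k2 k4 k5 k6 k7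
  -- The roles of `(1, i)` and `(1, -i)` are exchanged at infinity: slots 6, 7 now isolate `g 0` and
  -- slots 4, 5 isolate `g 1`.
  have g0 : g 0 = 0 := by
    linear_combination 3 / 2 * (k6 - I * k7)
      + (g 0 / 2 - 3 / 2 * g 1 * z ^ 3 - 9 / 2 * g 3 * z ^ 2) * I_sq
  have g1 : g 1 = 0 := by
    linear_combination -3 / 2 * (k4 - I * k5)
      + (g 1 / 2 + 3 / 2 * g 0 * z ^ 3 + 9 / 2 * g 2 * z ^ 2) * I_sq
  rw [g0, g1] at k0 k1 k2
  have g2 : g 2 = 0 := by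
    linear_combination -I * (k0 - k1) / 2 + g 2 * I_sq
  rw [g2] at k2
  have g3 : g 3 = 0 := by
    linear_combination -2 * k2
  intro i
  fin_cases i
  exacts [g0, g1, g2, g3]

theorem lorentz_frameZero_star (z : ℂ) :
    lorentz (frameZero 0 z) (star (frameZero 0 z)) = 2 + 8 * (z * starRingEnd ℂ z)
      + 2 / 9 * (z * starRingEnd ℂ z) ^ 3 ∧
    lorentz (frameZero 1 z) (star (frameZero 1 z)) = 2 + 1 / 2 * (z * starRingEnd ℂ z) ^ 2
      + 2 / 9 * (z * starRingEnd ℂ z) ^ 3 ∧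
    lorentz (frameZero 0 z) (star (frameZero 1 z)) = 2 * z ^ 2 * starRingEnd ℂ z ∧
    lorentz (frameZero 1 z) (star (frameZero 0 z)) = 2 * z * starRingEnd ℂ z ^ 2 := by
  refine ⟨?_, ?_, ?_, ?_⟩ <;>
    simp [lorentz, Fin.sum_univ_seven, frameZero, Fin.succ, conj_ofNat] <;>
    ring_nf <;> simp only [I_sq] <;> ring

theorem lorentz_frameInfty_star (z : ℂ) :
    lorentz (frameInfty 0 z) (star (frameInfty 0 z)) = 2 / 9 + 8 * (z * starRingEnd ℂ z) ^ 2
      + 2 * (z * starRingEnd ℂ z) ^ 3 ∧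
    lorentz (frameInfty 1 z) (star (frameInfty 1 z)) = 2 / 9 + 1 / 2 * (z * starRingEnd ℂ z)
      + 2 * (z * starRingEnd ℂ z) ^ 3 ∧
    lorentz (frameInfty 0 z) (star (frameInfty 1 z)) = 2 * z * starRingEnd ℂ z ^ 2 ∧
    lorentz (frameInfty 1 z) (star (frameInfty 0 z)) = 2 * z ^ 2 * starRingEnd ℂ z := by
  refine ⟨?_, ?_, ?_, ?_⟩ <;>
    simp [lorentz, Fin.sum_univ_seven, frameInfty, Fin.succ, conj_ofNat] <;>
    ring_nf <;> simp only [I_sq] <;> ring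

theorem gram_frameZero_ne_zero (z : ℂ) :
    lorentz (frameZero 0 z) (star (frameZero 0 z)) * lorentz (frameZero 1 z) (star (frameZero 1 z))
    - lorentz (frameZero 0 z) (star (frameZero 1 z))
      * lorentz (frameZero 1 z) (star (frameZero 0 z)) ≠ 0 := by
  obtain ⟨h1, h2, h3, h4⟩ := lorentz_frameZero_star z
  have hn := normSq_nonneg z
  -- The expanded determinant: the diagonal product has cubic coefficient `4 + 8/9`, and the
  -- off-diagonal product removes only the 4.
  have hpos : 0 < 4 + 16 * normSq z + normSq z ^ 2 + 8 / 9 * normSq z ^ 3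
      + 16 / 9 * normSq z ^ 4 + 1 / 9 * normSq z ^ 5 + 4 / 81 * normSq z ^ 6 := by positivity
  have := ofReal_ne_zero.2 hpos.ne'
  convert this using 1
  rw [h1, h2, h3, h4]
  push_cast
  rw [normSq_eq_conj_mul_self]
  ring

theorem gram_frameInfty_ne_zero (z : ℂ) :
    lorentz (frameInfty 0 z) (star (frameInfty 0 z))
      * lorentz (frameInfty 1 z) (star (frameInfty 1 z))
    - lorentz (frameInfty 0 z) (star (frameInfty 1 z))
      * lorentz (frameInfty 1 z) (star (frameInfty 0 z)) ≠ 0 := by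
  obtain ⟨h1, h2, h3, h4⟩ := lorentz_frameInfty_star z
  have hn := normSq_nonneg z
  have hpos : 0 < 4 / 81 + 1 / 9 * normSq z + 16 / 9 * normSq z ^ 2 + 8 / 9 * normSq z ^ 3
      + normSq z ^ 4 + 16 * normSq z ^ 5 + 4 * normSq z ^ 6 := by positivity
  have := ofReal_ne_zero.2 hpos.ne'
  convert this using 1
  rw [h1, h2, h3, h4]
  push_cast
  rw [normSq_eq_conj_mul_self]
  ring


/-! ### The surface as a smooth map on the whole two-sphere -/

/-- The numerator of the surface in homogeneous coordinates. -/
noncomputable def surfaceVector (t s α β : ℝ) : EuclideanSpace ℝ (Fin 7) :=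
  !₂[t ^ 4 - t ^ 3 * s - 3 / 4 * t ^ 2 * s ^ 2 + 4 / 9 * t * s ^ 3 - s ^ 4 / 36,
    2 * β * (t ^ 3 + s ^ 3 / 9),
    2 * α * (t ^ 3 + s ^ 3 / 9),
    4 * α * β * (t ^ 2 - s ^ 2 / 12),
    2 * (α ^ 2 - β ^ 2) * (t ^ 2 - s ^ 2 / 12),
    β * (s * t * (t + 4 / 3 * s)),
    α * (s * t * (t + 4 / 3 * s))]

/-- The point of the surface with the given homogeneous coordinates. -/
noncomputable def surfacePoint (t s α β : ℝ) : EuclideanSpace ℝ (Fin 7) :=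
  (denominator t s)⁻¹ • surfaceVector t s α β

theorem denominator_pos {t s : ℝ} (ht : 0 ≤ t) (hs : 0 ≤ s) (h : 0 < t + s) :
    0 < denominator t s := by
  rw [denominator]
  rcases ht.eq_or_lt with rfl | ht
  · have : 0 < s := by linarith
    positivity
  · positivity

theorem norm_surfacePoint {t s α β : ℝ} (ht : 0 ≤ t) (hs : 0 ≤ s) (h : 0 < t + s)
    (hst : t * s = α ^ 2 + β ^ 2) : ‖surfacePoint t s α β‖ = 1 := by
  have hD := denominator_pos ht hs h
  have hv : ‖surfaceVector t s α β‖ = denominator t s := by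
    rw [EuclideanSpace.norm_eq, Real.sqrt_eq_iff_mul_self_eq (by positivity) hD.le]
    simp only [Fin.sum_univ_seven, Real.norm_eq_abs, sq_abs]
    simp [surfaceVector, denominator]
    linear_combination -(4 * (t ^ 3 + s ^ 3 / 9) ^ 2
      + 4 * (α ^ 2 + β ^ 2 + t * s) * (t ^ 2 - s ^ 2 / 12) ^ 2
      + (s * t * (t + 4 / 3 * s)) ^ 2) * hst
  rw [surfacePoint, norm_smul, hv, norm_inv, Real.norm_eq_abs, abs_of_pos hD,
    inv_mul_cancel₀ hD.ne']

/-- Numerator and denominator are homogeneous of degree four. This invariance glues the two charts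
to a single map. -/
theorem surfacePoint_smul {k : ℝ} (hk : k ≠ 0) (t s α β : ℝ) :
    surfacePoint (k * t) (k * s) (k * α) (k * β) = surfacePoint t s α β := by
  have h1 : denominator (k * t) (k * s) = k ^ 4 * denominator t s := by
    rw [denominator, denominator]
    ring
  have h2 : surfaceVector (k * t) (k * s) (k * α) (k * β) = k ^ 4 • surfaceVector t s α β := by
    ext i
    fin_cases i <;> simp [surfaceVector] <;> ring
  rw [surfacePoint, surfacePoint, h1, h2, smul_smul, mul_inv, mul_right_comm,
    inv_mul_cancel₀ (pow_ne_zero 4 hk), one_mul]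

theorem coneLift_surfacePoint {y : ℂ → EuclideanSpace ℝ (Fin 7)} {t s α β : ℝ} {z : ℂ}
    (hD : denominator t s ≠ 0) (hy : y z = surfacePoint t s α β) :
    coneLift y z = (denominator (t : ℂ) s)⁻¹ • lightVector t s (α + β * I) (α - β * I) := by
  have hc : denominator (t : ℂ) s = ((denominator t s : ℝ) : ℂ) := by
    simp [denominator]
  have hD' : denominator (t : ℂ) s ≠ 0 := by
    rw [hc]
    exact ofReal_ne_zero.2 hD
  ext i
  rw [coneLift, hy, surfacePoint]
  refine Fin.cases ?_ (fun j => ?_) i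
  · simp [lightVector, inv_mul_cancel₀ hD']
  · rw [Fin.cons_succ]
    fin_cases j <;> simp [surfaceVector, lightVector, hc, Fin.succ] <;>
      first | left | (rw [← mul_neg, mul_eq_mul_left_iff]; left)
    · linear_combination (2 * (β : ℂ) * ((t : ℂ) ^ 3 + s ^ 3 / 9)) * I_sq
    · left
      ring
    · linear_combination (4 * (α : ℂ) * β * ((t : ℂ) ^ 2 - s ^ 2 / 12)) * I_sq
    · left
      linear_combination (-2 * (β : ℂ) ^ 2) * I_sq
    · linear_combination ((β : ℂ) * (s * t * (t + 4 / 3 * s))) * I_sq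
    · ring

theorem sphere_coord (p : S2) : (p : EuclideanSpace ℝ (Fin 3)) 0 ^ 2
    + (p : EuclideanSpace ℝ (Fin 3)) 1 ^ 2 + (p : EuclideanSpace ℝ (Fin 3)) 2 ^ 2 = 1 := by
  have := mem_sphere_zero_iff_norm.1 p.2
  rw [EuclideanSpace.norm_eq, Real.sqrt_eq_one, Fin.sum_univ_three] at this
  simpa using this

/-- The surface of the example at a point of the two-sphere, for `λ = 1`. -/
noncomputable def basePoint (p : EuclideanSpace ℝ (Fin 3)) : EuclideanSpace ℝ (Fin 7) :=
  surfacePoint ((1 - p 2) / 2) ((1 + p 2) / 2) (p 0 / 2) (p 1 / 2)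

theorem denominator_sphere_pos (p : S2) :
    0 < denominator ((1 - (p : EuclideanSpace ℝ (Fin 3)) 2) / 2)
      ((1 + (p : EuclideanSpace ℝ (Fin 3)) 2) / 2) := by
  have := sphere_coord p
  apply denominator_pos <;> nlinarith [sq_nonneg ((p : EuclideanSpace ℝ (Fin 3)) 0),
    sq_nonneg ((p : EuclideanSpace ℝ (Fin 3)) 1)]

theorem norm_basePoint (p : S2) : ‖basePoint p‖ = 1 := by
  have := sphere_coord p
  apply norm_surfacePoint <;> nlinarith [sq_nonneg ((p : EuclideanSpace ℝ (Fin 3)) 0),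
    sq_nonneg ((p : EuclideanSpace ℝ (Fin 3)) 1)]

/-- The surface is the restriction of a rational map of the ambient `ℝ³` whose denominator does not
vanish on the sphere, so the point at infinity needs no separate treatment. -/
theorem contDiffAt_basePoint (p : S2) :
    ContDiffAt ℝ ∞ basePoint (p : EuclideanSpace ℝ (Fin 3)) := by
  have hp : ∀ i, ContDiff ℝ ∞ fun q : EuclideanSpace ℝ (Fin 3) => q i := fun i =>
    (EuclideanSpace.proj (𝕜 := ℝ) i).contDiff
  have hD : ContDiff ℝ ∞ fun q : EuclideanSpace ℝ (Fin 3) =>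
      denominator ((1 - q 2) / 2) ((1 + q 2) / 2) := by
    simp only [denominator]
    fun_prop
  have hv : ContDiff ℝ ∞ fun q : EuclideanSpace ℝ (Fin 3) =>
      surfaceVector ((1 - q 2) / 2) ((1 + q 2) / 2) (q 0 / 2) (q 1 / 2) := by
    rw [contDiff_piLp]
    intro i
    fin_cases i <;> simp [surfaceVector] <;> fun_prop
  exact (hD.contDiffAt.inv (denominator_sphere_pos p).ne').smul hv.contDiffAt

/-- Stereographic projection gives the homogeneous coordinates `(1, |z|², Re z, Im z)` divided by `1
+ |z|²`, and the common factor drops out. -/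
theorem basePoint_chartZero (z : ℂ) :
    basePoint (chartZero z) = surfacePoint 1 (normSq z) z.re z.im := by
  have h : 1 + normSq z ≠ 0 := by have := normSq_nonneg z; positivity
  rw [← surfacePoint_smul (inv_ne_zero h) 1, basePoint]
  congr 1 <;> simp [chartZero] <;> field_simp <;> ring

theorem basePoint_chartInfty (w : ℂ) :
    basePoint (chartInfty w) = surfacePoint (normSq w) 1 w.re (-w.im) := by
  have h : 1 + normSq w ≠ 0 := by have := normSq_nonneg w; positivity
  rw [← surfacePoint_smul (inv_ne_zero h) (normSq w), basePoint]
  congr 1 <;> simp [chartInfty] <;> field_simp <;> ring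

/-- The surface of the example for `λ = 1`. -/
noncomputable def baseSurface (p : S2) : S6 :=
  ⟨basePoint p, mem_sphere_zero_iff_norm.2 (norm_basePoint p)⟩

theorem conj_eq_sub (z : ℂ) : starRingEnd ℂ z = z.re - z.im * I := by
  apply Complex.ext <;> simp

theorem normSq_eq (z : ℂ) : (normSq z : ℂ) = z * starRingEnd ℂ z := by
  rw [normSq_eq_conj_mul_self, mul_comm]

theorem coneLift_baseSurface_zero (z : ℂ) : coneLift (inCoord chartZero baseSurface) z =
    (denominator (1 : ℂ) (normSq z))⁻¹ • liftZero z := by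
  have h := denominator_pos zero_le_one (normSq_nonneg z) (by have := normSq_nonneg z; linarith)
  rw [coneLift_surfacePoint h.ne' (basePoint_chartZero z), liftZero, ← normSq_eq, ofReal_one]
  congr 2
  · exact re_add_im z
  · exact (conj_eq_sub z).symm

theorem coneLift_baseSurface_infty (w : ℂ) : coneLift (inCoord chartInfty baseSurface) w =
    (denominator (normSq w : ℂ) 1)⁻¹ • liftInfty w := by
  have h := denominator_pos (normSq_nonneg w) zero_le_one (by have := normSq_nonneg w; linarith)
  rw [coneLift_surfacePoint h.ne' (basePoint_chartInfty w), liftInfty, ← normSq_eq, ofReal_one]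
  congr 2
  · rw [conj_eq_sub, ofReal_neg]
    ring
  · rw [ofReal_neg]
    conv_rhs => rw [← re_add_im w]
    ring

theorem contDiff_inCoord {X : S2 → S6} (hX : ContMDiff (𝓡 2) (𝓡 6) ∞ X) {φ : ℂ → S2}
    (hφ : ContMDiff 𝓘(ℝ, ℂ) (𝓡 2) ∞ φ) : ContDiff ℝ ∞ (inCoord φ X) := by
  rw [← contMDiff_iff_contDiff]
  exact (contMDiff_coe_sphere (n := 6)).comp (hX.comp hφ)

theorem contMDiff_clm_basePoint
    (A : EuclideanSpace ℝ (Fin 7) →L[ℝ] EuclideanSpace ℝ (Fin 7)) :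
    ContMDiff (𝓡 2) 𝓘(ℝ, EuclideanSpace ℝ (Fin 7)) ∞
      fun p : S2 => A (basePoint (p : EuclideanSpace ℝ (Fin 3))) := fun p =>
  ((A.contDiff.contDiffAt.comp _ (contDiffAt_basePoint p)).contMDiffAt).comp p
    (contMDiff_coe_sphere (n := 2) p)

theorem contMDiff_baseSurface : ContMDiff (𝓡 2) (𝓡 6) ∞ baseSurface :=
  ContMDiff.codRestrict_sphere
    (contMDiff_clm_basePoint (ContinuousLinearMap.id ℝ (EuclideanSpace ℝ (Fin 7))))
    fun p => (baseSurface p).2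

/-! ### Conformal factor and isotropic frames of the surface at `λ = 1` -/

/-- The conformal factor of a surface with a lightlike lift `P`. -/
theorem conformalFactor_of_lift {y : ℂ → EuclideanSpace ℝ (Fin 7)} {P : ℂ → Fin 8 → ℂ}
    {d : ℂ → ℂ} (hP : ContDiff ℝ ∞ P) (hd : ContDiff ℝ ∞ d) (hd0 : ∀ z, d z ≠ 0)
    (hy : ContDiff ℝ ∞ y) (hn : ∀ z, lorentz (P z) (P z) = 0)
    (h : ∀ z, coneLift y z = (d z)⁻¹ • P z) (z : ℂ) :
    (conformalFactor y z : ℂ) = 2 * lorentz (dz P z) (dzbar P z) / d z ^ 2 := by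
  have h1 := dz_lorentz_eq_zero hP hP hn z
  have h2 := dzbar_lorentz_eq_zero hP hP hn z
  rw [lorentz_comm (P z), ← two_mul, mul_eq_zero, or_iff_right two_ne_zero] at h1 h2
  have hdi : DifferentiableAt ℝ (fun z => (d z)⁻¹) z := differentiableAt_of_contDiff (hd.inv hd0) z
  rw [ofReal_conformalFactor hy, funext h, dz_eq_wirtinger, dzbar_eq_wirtinger,
    wirtinger_smul hdi (differentiableAt_of_contDiff hP z),
    wirtinger_smul hdi (differentiableAt_of_contDiff hP z), ← dz_eq_wirtinger,
    ← dzbar_eq_wirtinger]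
  simp only [lorentz_add_left, lorentz_add_right, lorentz_smul_left, lorentz_smul_right, hn, h1,
    lorentz_comm (P z), h2]
  field_simp [hd0 z]
  ring

theorem contDiff_normSq : ContDiff ℝ ∞ fun z : ℂ => (normSq z : ℂ) := by
  simp only [normSq_eq]
  exact contDiff_id.mul contDiff_conj

theorem denominator_zero_ne_zero (z : ℂ) : denominator (1 : ℂ) (normSq z) ≠ 0 := by
  have h := denominator_pos zero_le_one (normSq_nonneg z) (by have := normSq_nonneg z; linarith)
  convert ofReal_ne_zero.2 h.ne' using 1
  simp [denominator]

theorem denominator_infty_ne_zero (w : ℂ) : denominator (normSq w : ℂ) 1 ≠ 0 := by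
  have h := denominator_pos (normSq_nonneg w) zero_le_one (by have := normSq_nonneg w; linarith)
  convert ofReal_ne_zero.2 h.ne' using 1
  simp [denominator]

theorem conformalFactor_zero (z : ℂ) :
    conformalFactor (inCoord chartZero baseSurface) z =
      2 * (2 + 8 * normSq z + 1 / 2 * normSq z ^ 2 + 4 / 9 * normSq z ^ 3 + 8 / 9 * normSq z ^ 4
        + 1 / 18 * normSq z ^ 5 + 2 / 81 * normSq z ^ 6) / denominator 1 (normSq z) ^ 2 := by
  have hn := contDiff_normSq
  have h := conformalFactor_of_lift contDiff_liftZero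
    (by simp only [denominator]; fun_prop) denominator_zero_ne_zero
    (contDiff_inCoord contMDiff_baseSurface contMDiff_chartZero)
    (fun z => lightVector_null (one_mul _)) coneLift_baseSurface_zero z
  rw [lorentz_dz_liftZero, ← normSq_eq] at h
  apply ofReal_injective
  rw [h]
  simp [denominator]

theorem conformalFactor_infty (w : ℂ) :
    conformalFactor (inCoord chartInfty baseSurface) w =
      2 * (2 / 81 + 1 / 18 * normSq w + 8 / 9 * normSq w ^ 2 + 4 / 9 * normSq w ^ 3
        + 1 / 2 * normSq w ^ 4 + 8 * normSq w ^ 5 + 2 * normSq w ^ 6)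
        / denominator (normSq w) 1 ^ 2 := by
  have hn := contDiff_normSq
  have h := conformalFactor_of_lift contDiff_liftInfty
    (by simp only [denominator]; fun_prop) denominator_infty_ne_zero
    (contDiff_inCoord contMDiff_baseSurface contMDiff_chartInfty)
    (fun z => lightVector_null (by ring)) coneLift_baseSurface_infty w
  rw [lorentz_dz_liftInfty, ← normSq_eq] at h
  apply ofReal_injective
  rw [h]
  simp [denominator]

theorem isIsotropicFrame_zero :
    IsIsotropicFrame (inCoord chartZero baseSurface) frameZero where
  smooth := contDiff_frameZero
  hol := dzbar_frameZero
  iso := lorentz_frameZero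
  iso_dz i j z := by rw [dz_frameZero, lorentz_frameZero_deriv]
  iso_dz_dz i j z := by rw [dz_frameZero, dz_frameZero, lorentz_frameZeroDeriv]
  perp i z := by
    rw [coneLift_baseSurface_zero, lorentz_smul_left, lorentz_liftZero_frameZero, mul_zero]
  perp_dz i z := by
    rw [coneLift_baseSurface_zero, lorentz_smul_left, dz_frameZero,
      lorentz_liftZero_frameZeroDeriv, mul_zero]
  indep z := by
    rw [dz_frameZero, dz_frameZero]
    exact linearIndependent_frameZero z
  gram_ne_zero := gram_frameZero_ne_zero

theorem isIsotropicFrame_infty :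
    IsIsotropicFrame (inCoord chartInfty baseSurface) frameInfty where
  smooth := contDiff_frameInfty
  hol := dzbar_frameInfty
  iso := lorentz_frameInfty
  iso_dz i j z := by rw [dz_frameInfty, lorentz_frameInfty_deriv]
  iso_dz_dz i j z := by rw [dz_frameInfty, dz_frameInfty, lorentz_frameInftyDeriv]
  perp i z := by
    rw [coneLift_baseSurface_infty, lorentz_smul_left, lorentz_liftInfty_frameInfty, mul_zero]
  perp_dz i z := by
    rw [coneLift_baseSurface_infty, lorentz_smul_left, dz_frameInfty,
      lorentz_liftInfty_frameInftyDeriv, mul_zero]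
  indep z := by
    rw [dz_frameInfty, dz_frameInfty]
    exact linearIndependent_frameInfty z
  gram_ne_zero := gram_frameInfty_ne_zero

theorem conformalFactor_zero_pos (z : ℂ) :
    0 < conformalFactor (inCoord chartZero baseSurface) z := by
  have hn := normSq_nonneg z
  have h := denominator_pos zero_le_one hn (by linarith)
  rw [conformalFactor_zero]
  positivity

theorem conformalFactor_infty_pos (w : ℂ) :
    0 < conformalFactor (inCoord chartInfty baseSurface) w := by
  have hn := normSq_nonneg w
  have h := denominator_pos hn zero_le_one (by linarith)
  rw [conformalFactor_infty]
  positivity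


/-! ### The associated family -/

/-- The complex orthogonal matrix which rotates the planes `e₄, e₅` and `e₆, e₇` by `l`. -/
noncomputable def rotMatrix (l : ℂ) : Matrix (Fin 8) (Fin 8) ℂ :=
  !![1, 0, 0, 0, 0, 0, 0, 0;
     0, 1, 0, 0, 0, 0, 0, 0;
     0, 0, 1, 0, 0, 0, 0, 0;
     0, 0, 0, 1, 0, 0, 0, 0;
     0, 0, 0, 0, (l + l⁻¹) / 2, I * (l - l⁻¹) / 2, 0, 0;
     0, 0, 0, 0, -I * (l - l⁻¹) / 2, (l + l⁻¹) / 2, 0, 0;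
     0, 0, 0, 0, 0, 0, (l + l⁻¹) / 2, I * (l - l⁻¹) / 2;
     0, 0, 0, 0, 0, 0, -I * (l - l⁻¹) / 2, (l + l⁻¹) / 2]

theorem rotMatrix_mulVec (l : ℂ) (v : Fin 8 → ℂ) : (rotMatrix l).mulVec v =
    ![v 0, v 1, v 2, v 3,
      (l + l⁻¹) / 2 * v 4 + I * (l - l⁻¹) / 2 * v 5, -I * (l - l⁻¹) / 2 * v 4 + (l + l⁻¹) / 2 * v 5,
      (l + l⁻¹) / 2 * v 6 + I * (l - l⁻¹) / 2 * v 7,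
      -I * (l - l⁻¹) / 2 * v 6 + (l + l⁻¹) / 2 * v 7] := by
  ext i
  fin_cases i <;> simp [rotMatrix, Matrix.mulVec, dotProduct, Fin.sum_univ_eight]

/-- The rotation by `l` as a continuous linear map. -/
noncomputable def rotMap (l : ℂ) : (Fin 8 → ℂ) →L[ℂ] (Fin 8 → ℂ) :=
  LinearMap.toContinuousLinearMap (rotMatrix l).mulVecLin

theorem rotMap_apply (l : ℂ) (v : Fin 8 → ℂ) : rotMap l v = (rotMatrix l).mulVec v := rfl

theorem lorentz_rotMatrix {l : ℂ} (hl : l ≠ 0) (v w : Fin 8 → ℂ) :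
    lorentz ((rotMatrix l).mulVec v) ((rotMatrix l).mulVec w) = lorentz v w := by
  have h : l * l⁻¹ = 1 := mul_inv_cancel₀ hl
  rw [rotMatrix_mulVec, rotMatrix_mulVec]
  simp [lorentz, Fin.sum_univ_seven, Fin.succ]
  linear_combination (v 4 * w 4 + v 5 * w 5 + v 6 * w 6 + v 7 * w 7) * h
    + ((l - l⁻¹) ^ 2 / 4 * (v 4 * w 4 + v 5 * w 5 + v 6 * w 6 + v 7 * w 7)) * I_sq

theorem circle_inv (l : Circle) : (l : ℂ)⁻¹ = starRingEnd ℂ l := by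
  rw [← Circle.coe_inv, Circle.coe_inv_eq_conj]

theorem isRealIsometry_rotMap (l : Circle) : IsRealIsometry (rotMap l) where
  lorentz_map v w := lorentz_rotMatrix l.coe_ne_zero v w
  star_map v := by
    rw [rotMap_apply, rotMap_apply, rotMatrix_mulVec, rotMatrix_mulVec, circle_inv]
    ext i
    fin_cases i <;> simp <;> ring

/-- The linear isometry of `ℝ⁷` underlying the rotation by `l`. -/
noncomputable def rotIsometry (l : Circle) :
    EuclideanSpace ℝ (Fin 7) ≃ₗᵢ[ℝ] EuclideanSpace ℝ (Fin 7) :=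
  LinearIsometry.toLinearIsometryEquiv
    { toFun := fun v => !₂[v 0, v 1, v 2,
        (l : ℂ).re * v 3 - (l : ℂ).im * v 4, (l : ℂ).im * v 3 + (l : ℂ).re * v 4,
        (l : ℂ).re * v 5 - (l : ℂ).im * v 6, (l : ℂ).im * v 5 + (l : ℂ).re * v 6]
      map_add' := fun v w => by
        ext i
        fin_cases i <;> simp <;> ring
      map_smul' := fun c v => by
        ext i
        fin_cases i <;> simp <;> ring
      norm_map' := fun v => by
        have h : (l : ℂ).re ^ 2 + (l : ℂ).im ^ 2 = 1 := by
          have := Circle.normSq_coe l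
          rw [normSq_apply] at this
          linarith
        rw [EuclideanSpace.norm_eq, EuclideanSpace.norm_eq]
        congr 1
        simp [Fin.sum_univ_seven]
        linear_combination (v 3 ^ 2 + v 4 ^ 2 + v 5 ^ 2 + v 6 ^ 2) * h } rfl

theorem rotIsometry_apply (l : Circle) (v : EuclideanSpace ℝ (Fin 7)) : rotIsometry l v =
    !₂[v 0, v 1, v 2,
        (l : ℂ).re * v 3 - (l : ℂ).im * v 4, (l : ℂ).im * v 3 + (l : ℂ).re * v 4,
        (l : ℂ).re * v 5 - (l : ℂ).im * v 6, (l : ℂ).im * v 5 + (l : ℂ).re * v 6] := rfl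

theorem coneLift_rotIsometry (l : Circle) (y : ℂ → EuclideanSpace ℝ (Fin 7)) (z : ℂ) :
    coneLift (fun z => rotIsometry l (y z)) z = rotMap l (coneLift y z) := by
  have h1 : ((l : ℂ) + (l : ℂ)⁻¹) / 2 = (l : ℂ).re := by
    rw [circle_inv, add_conj]
    push_cast
    ring
  have h2 : I * ((l : ℂ) - (l : ℂ)⁻¹) / 2 = -(l : ℂ).im := by
    rw [circle_inv, sub_conj]
    push_cast
    linear_combination ((l : ℂ).im : ℂ) * I_sq
  have h3 : -I * ((l : ℂ) - (l : ℂ)⁻¹) / 2 = (l : ℂ).im := by linear_combination -h2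
  rw [rotMap_apply, rotMatrix_mulVec, h1, h2, h3]
  ext i
  refine Fin.cases ?_ (fun j => ?_) i
  · simp [coneLift]
  · rw [coneLift, Fin.cons_succ, rotIsometry_apply]
    have c1 : coneLift y z 1 = (y z 0 : ℝ) := rfl
    have c2 : coneLift y z 2 = (y z 1 : ℝ) := rfl
    have c3 : coneLift y z 3 = (y z 2 : ℝ) := rfl
    have c4 : coneLift y z 4 = (y z 3 : ℝ) := rfl
    have c5 : coneLift y z 5 = (y z 4 : ℝ) := rfl
    have c6 : coneLift y z 6 = (y z 5 : ℝ) := rfl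
    have c7 : coneLift y z 7 = (y z 6 : ℝ) := rfl
    rw [c1, c2, c3, c4, c5, c6, c7]
    fin_cases j <;> simp [Fin.succ] <;> ring

/-- The family of surfaces of the example. -/
noncomputable def exampleSurface (l : Circle) (p : S2) : S6 :=
  ⟨rotIsometry l (baseSurface p), mem_sphere_zero_iff_norm.2 (by
    rw [LinearIsometryEquiv.norm_map]
    exact norm_basePoint p)⟩

theorem contMDiff_exampleSurface (l : Circle) :
    ContMDiff (𝓡 2) (𝓡 6) ∞ (exampleSurface l) :=
  ContMDiff.codRestrict_sphere
    (contMDiff_clm_basePoint (rotIsometry l).toContinuousLinearEquiv.toContinuousLinearMap)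
    fun p => (exampleSurface l p).2

theorem coneLift_exampleSurface (l : Circle) (φ : ℂ → S2) (z : ℂ) :
    coneLift (inCoord φ (exampleSurface l)) z = rotMap l (coneLift (inCoord φ baseSurface) z) :=
  coneLift_rotIsometry l (inCoord φ baseSurface) z

theorem isIsotropicFrame_example_zero (l : Circle) :
    IsIsotropicFrame (inCoord chartZero (exampleSurface l)) fun i z => rotMap l (frameZero i z) :=
  (isRealIsometry_rotMap l).isIsotropicFrame (coneLift_exampleSurface l _) isIsotropicFrame_zero

theorem isIsotropicFrame_example_infty (l : Circle) :
    IsIsotropicFrame (inCoord chartInfty (exampleSurface l))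
      fun i z => rotMap l (frameInfty i z) :=
  (isRealIsometry_rotMap l).isIsotropicFrame (coneLift_exampleSurface l _) isIsotropicFrame_infty

theorem norm_inCoord (φ : ℂ → S2) (X : S2 → S6) (z : ℂ) : ‖inCoord φ X z‖ = 1 :=
  mem_sphere_zero_iff_norm.1 (X (φ z)).2

theorem isConformalImmersion_base :
    IsConformalImmersion (inCoord chartZero baseSurface) :=
  isIsotropicFrame_zero.isConformalImmersion
    (contDiff_inCoord contMDiff_baseSurface contMDiff_chartZero) (norm_inCoord _ _)
    conformalFactor_zero_pos

theorem isConformalImmersion_example_zero (l : Circle) :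
    IsConformalImmersion (inCoord chartZero (exampleSurface l)) :=
  (isIsotropicFrame_example_zero l).isConformalImmersion
    (contDiff_inCoord (contMDiff_exampleSurface l) contMDiff_chartZero) (norm_inCoord _ _)
    fun z => by
      rw [(isRealIsometry_rotMap l).conformalFactor_eq
        (contDiff_inCoord contMDiff_baseSurface contMDiff_chartZero)
        (coneLift_exampleSurface l _)]
      exact conformalFactor_zero_pos z

theorem isConformalImmersion_example_infty (l : Circle) :
    IsConformalImmersion (inCoord chartInfty (exampleSurface l)) :=
  (isIsotropicFrame_example_infty l).isConformalImmersion
    (contDiff_inCoord (contMDiff_exampleSurface l) contMDiff_chartInfty) (norm_inCoord _ _)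
    fun z => by
      rw [(isRealIsometry_rotMap l).conformalFactor_eq
        (contDiff_inCoord contMDiff_baseSurface contMDiff_chartInfty)
        (coneLift_exampleSurface l _)]
      exact conformalFactor_infty_pos z

theorem exampleSurface_willmore (l : Circle) :
    IsWillmoreImmersion (exampleSurface l) ∧ IsTotallyIsotropic (exampleSurface l) :=
  isWillmoreImmersion_of_isIsotropicFrame (contMDiff_exampleSurface l)
    (isConformalImmersion_example_zero l) (isConformalImmersion_example_infty l)
    (isIsotropicFrame_example_zero l) (isIsotropicFrame_example_infty l)

theorem exampleSurface_isometry (l m : Circle) :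
    ∃ A : EuclideanSpace ℝ (Fin 7) ≃ₗᵢ[ℝ] EuclideanSpace ℝ (Fin 7),
      ∀ p, (exampleSurface m p : EuclideanSpace ℝ (Fin 7)) = A (exampleSurface l p) :=
  ⟨(rotIsometry l).symm.trans (rotIsometry m), fun p => by
    simp [exampleSurface]⟩

theorem exampleSurface_formula (l : Circle) (z : ℂ) (j : Fin 7) :
    (((exampleSurface l (chartZero z) : EuclideanSpace ℝ (Fin 7)) j : ℝ) : ℂ)
      = exampleFormula (l : ℂ) z j := by
  have h1 : (((exampleSurface l (chartZero z) : EuclideanSpace ℝ (Fin 7)) j : ℝ) : ℂ) =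
      coneLift (inCoord chartZero (exampleSurface l)) z j.succ := by
    rw [coneLift, Fin.cons_succ, inCoord]
  -- Only even powers of `r` occur in the formula, so all of it is polynomial in `z` and `z̄` up to
  -- the denominator.
  have h2 : ∀ n : ℕ, ((‖z‖ : ℝ) : ℂ) ^ (2 * n) = (z * starRingEnd ℂ z) ^ n := fun n => by
    rw [pow_mul, ← ofReal_pow, ← normSq_eq_norm_sq, normSq_eq]
  have e1 := h2 1
  have e2 := h2 2
  have e3 := h2 3
  have e4 := h2 4
  norm_num at e1 e2 e3 e4
  rw [h1, coneLift_exampleSurface, coneLift_baseSurface_zero, map_smul, rotMap_apply,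
    rotMatrix_mulVec, normSq_eq]
  simp only [exampleFormula, Pi.smul_apply, liftZero, lightVector, denominator, e1, e2, e3, e4]
  rw [show (1 : ℂ) ^ 4 + 1 ^ 3 * (z * starRingEnd ℂ z) + 5 / 4 * 1 ^ 2 * (z * starRingEnd ℂ z) ^ 2
      + 4 / 9 * 1 * (z * starRingEnd ℂ z) ^ 3 + (z * starRingEnd ℂ z) ^ 4 / 36 =
      1 + z * starRingEnd ℂ z + 5 * (z * starRingEnd ℂ z) ^ 2 / 4
      + 4 * (z * starRingEnd ℂ z) ^ 3 / 9 + (z * starRingEnd ℂ z) ^ 4 / 36 by ring]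
  congr 1
  fin_cases j <;> simp [Fin.succ]
  · ring
  · ring
  · linear_combination (((l : ℂ) - (l : ℂ)⁻¹) / 2 * ((z ^ 2 - (starRingEnd ℂ) z ^ 2) *
      (1 - (z * (starRingEnd ℂ) z) ^ 2 / 12))) * I_sq
  · ring
  · linear_combination (((l : ℂ) - (l : ℂ)⁻¹) / 2 * ((z - (starRingEnd ℂ) z) *
      (z * (starRingEnd ℂ) z / 2 * (1 + 4 / 3 * (z * (starRingEnd ℂ) z))))) * I_sq

/-! ### Failure of the S-Willmore condition, and fullness -/

theorem dz_dz_frameZero_at_zero :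
    dz (dz (frameZero 0)) 0 = ![2 * I, -2 * I, 0, 0, 0, 0, 0, 0] ∧
    dz (dz (frameZero 1)) 0 = ![0, 0, -1, -I, 0, 0, 0, 0] := by
  have hd := fun i => differentiableAt_of_contDiff (contDiff_dz (contDiff_frameZero i)) 0
  simp only [funext (dz_frameZero _)] at hd ⊢
  constructor <;> ext j <;> rw [dz_eq_wirtinger, wirtinger_pi (hd _)] <;>
    fin_cases j <;> simp only [frameZeroDeriv] <;>
    simp (disch := fun_prop) [wirtinger_mul, wirtinger_pow, wirtinger_neg, wirtinger_const,
      dz_id, dz_mul_id]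
  rw [wirtinger_neg fun z : ℂ => z, dz_id]

theorem dzbar_liftZero_at_zero : dzbar liftZero 0 = ![0, 0, I, 1, 0, 0, 0, 0] := by
  have := differentiableAt_conj
  have hd := differentiableAt_of_contDiff contDiff_liftZero 0
  ext j
  rw [dzbar_eq_wirtinger, wirtinger_pi hd]
  simp only [liftZero, lightVector, denominator]
  fin_cases j <;> simp <;>
  simp (disch := fun_prop) [div_eq_mul_inv, wirtinger_add, wirtinger_sub, wirtinger_mul,
    wirtinger_pow, wirtinger_neg, wirtinger_const, dzbar_id, dzbar_conj]
  norm_num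

/-- The criterion is tested at the origin. After the rotation is removed, `⟨L, h₁''⟩ = 0` and the
determinant is `⟨L, h₀''⟩ ⟨L_z̄, h₁''⟩ = (-4i)(-2i) = -8`, with `L` the cone lift. -/
theorem not_isSWillmore_exampleSurface (l : Circle) : ¬ IsSWillmore (exampleSurface l) := by
  intro h
  refine h.2.1 0 ((isIsotropicFrame_example_zero l).linearIndependent_hopf
    (isConformalImmersion_example_zero l) ?_)
  have hL := contDiff_coneLift (contDiff_inCoord contMDiff_baseSurface contMDiff_chartZero)
  have hF := fun i => contDiff_frameZero i
  have hA := isRealIsometry_rotMap l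
  rw [funext (dz_clm (rotMap l) (hF 0)), funext (dz_clm (rotMap l) (hF 1)),
    dz_clm (rotMap l) (contDiff_dz (hF 0)), dz_clm (rotMap l) (contDiff_dz (hF 1)),
    funext (coneLift_exampleSurface l chartZero), dzbar_clm (rotMap l) hL]
  simp only [hA.lorentz_map]
  rw [dz_dz_frameZero_at_zero.1, dz_dz_frameZero_at_zero.2]
  have hn := contDiff_normSq
  have hdn : ContDiff ℝ ∞ fun z : ℂ => denominator (1 : ℂ) (normSq z) := by
    simp only [denominator]
    fun_prop
  have hdi : DifferentiableAt ℝ (fun z : ℂ => (denominator (1 : ℂ) (normSq z))⁻¹) 0 :=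
    differentiableAt_of_contDiff (hdn.inv denominator_zero_ne_zero) 0
  rw [dzbar_eq_wirtinger, funext coneLift_baseSurface_zero,
    wirtinger_smul hdi (differentiableAt_of_contDiff contDiff_liftZero 0), ← dzbar_eq_wirtinger,
    dzbar_liftZero_at_zero]
  simp [lorentz, Fin.sum_univ_seven, liftZero, lightVector, denominator, Fin.succ]

theorem isFull_exampleSurface (l : Circle) : IsFull (exampleSurface l) := by
  have hbase : affineSpan ℝ (Set.range fun p => (baseSurface p : EuclideanSpace ℝ (Fin 7))) = ⊤ := by
    rw [AffineSubspace.affineSpan_eq_top_iff_vectorSpan_eq_top_of_nonempty ℝ _ _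
      ⟨_, Set.mem_range_self (chartZero 0)⟩, ← Submodule.orthogonal_eq_bot_iff, Submodule.eq_bot_iff]
    intro v hv
    have h1 : ∀ α β : ℝ, inner ℝ (surfacePoint 1 (α ^ 2 + β ^ 2) α β - surfacePoint 1 0 0 0) v
        = 0 := fun α β => by
      have h2 := (Submodule.mem_orthogonal _ _).1 hv
        ((baseSurface (chartZero ⟨α, β⟩) : EuclideanSpace ℝ (Fin 7)) - baseSurface (chartZero 0))
        (vsub_mem_vectorSpan ℝ ⟨_, rfl⟩ ⟨_, rfl⟩)
      have h3 := basePoint_chartZero ⟨α, β⟩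
      have h4 := basePoint_chartZero 0
      simp only [normSq_mk, ← pow_two, map_zero, zero_re, zero_im] at h3 h4
      rwa [← h3, ← h4]
    -- Sample points giving enough linear equations on a vector `v` orthogonal to all differences:
    -- four on each axis, and one off the axes because the product coordinate `α β` vanishes on
    -- them.
    have e1 := h1 1 0
    have e2 := h1 (-1) 0
    have e3 := h1 2 0
    have e4 := h1 (-2) 0
    have e5 := h1 0 1
    have e6 := h1 0 (-1)
    have e7 := h1 0 2
    have e8 := h1 0 (-2)
    have e9 := h1 1 1
    simp [surfacePoint, surfaceVector, denominator, PiLp.inner_apply, Fin.sum_univ_seven]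
      at e1 e2 e3 e4 e5 e6 e7 e8 e9
    ext i
    fin_cases i <;> simp <;> linarith
  have h : Set.range (fun p => (exampleSurface l p : EuclideanSpace ℝ (Fin 7))) =
      (rotIsometry l).toLinearEquiv.toLinearMap.toAffineMap ''
        Set.range fun p => (baseSurface p : EuclideanSpace ℝ (Fin 7)) := by
    rw [← Set.range_comp]
    rfl
  rw [IsFull, h, ← AffineSubspace.map_span, hbase]
  exact AffineMap.map_top_of_surjective _ (rotIsometry l).surjective


/-! ### Uniqueness in the Iwasawa decomposition -/

/-- A function on the closed disk which is holomorphic in the interior and real on the circle is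
constant. -/
theorem eq_of_diffContOnCl_of_im_eq_zero {f : ℂ → ℂ} (hf : DiffContOnCl ℂ f (Metric.ball 0 1))
    (hr : ∀ l : Circle, (f l).im = 0) {l : ℂ} (hl : l ∈ Metric.closedBall (0 : ℂ) 1) :
    f l = f 0 := by
  have hcl : closure (Metric.ball (0 : ℂ) 1) = Metric.closedBall 0 1 :=
    closure_ball 0 one_ne_zero
  have hfr : frontier (Metric.ball (0 : ℂ) 1) = Metric.sphere 0 1 := frontier_ball 0 one_ne_zero
  -- The modulus of `exp(-i c f)` is `exp(c Im f)`, which is 1 on the circle; the maximum principle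
  -- bounds it by 1 inside. Taking `c = ±1` kills the imaginary part.
  have key : ∀ c : ℝ, ∀ z ∈ Metric.closedBall (0 : ℂ) 1, c * (f z).im ≤ 0 := by
    intro c z hz
    have h1 : DiffContOnCl ℂ (fun z => exp (-I * c * f z)) (Metric.ball 0 1) := by
      exact Complex.differentiable_exp.comp_diffContOnCl (hf.const_smul (-I * c))
    have h3 := norm_le_of_forall_mem_frontier_norm_le Metric.isBounded_ball h1 (C := 1)
      (fun w hw => by
        rw [hfr] at hw
        have : (f w).im = 0 := hr ⟨w, hw⟩
        simp [norm_exp, this]) (z := z) (by rwa [hcl])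
    rw [norm_exp, Real.exp_le_one_iff] at h3
    simpa using h3
  have him : ∀ z ∈ Metric.ball (0 : ℂ) 1, (f z).im = 0 := fun z hz => by
    have h1 := key 1 z (Metric.ball_subset_closedBall hz)
    have h2 := key (-1) z (Metric.ball_subset_closedBall hz)
    linarith
  have hconst : Set.EqOn f (fun _ => f 0) (Metric.ball 0 1) := by
    obtain ⟨a, ha⟩ := (hf.differentiableOn.analyticOnNhd Metric.isOpen_ball).eq_const_of_im_eq_const
      (c₀ := 0) him Metric.isOpen_ball ((convex_ball _ _).isConnected ⟨0, by simp⟩)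
    intro z hz
    simp only
    rw [ha z hz, ha 0 (Metric.mem_ball_self one_pos)]
  exact (hconst.of_subset_closure hf.continuousOn continuousOn_const
    subset_closure subset_rfl) (hcl ▸ hl)

theorem hasDerivAt_matrix_mul {n : Type*} [Fintype n] {A B : ℂ → Matrix n n ℂ}
    {A' B' : Matrix n n ℂ} {z : ℂ} (hA : ∀ i j, HasDerivAt (fun w => A w i j) (A' i j) z)
    (hB : ∀ i j, HasDerivAt (fun w => B w i j) (B' i j) z) (i j : n) :
    HasDerivAt (fun w => (A w * B w) i j) ((A' * B z + A z * B') i j) z := by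
  simp only [Matrix.mul_apply, Matrix.add_apply, ← Finset.sum_add_distrib]
  exact HasDerivAt.fun_sum fun k _ => (hA i k).mul (hB k j)

/-- The adjoint of a matrix with respect to the Lorentzian form. -/
def lorentzAdjoint {R : Type*} [CommRing R] (A : Matrix (Fin 8) (Fin 8) R) :
    Matrix (Fin 8) (Fin 8) R := I17 R * A.transpose * I17 R

section Adjoint

variable {R : Type*} [CommRing R]

theorem I17_mul_self : I17 R * I17 R = 1 := by
  rw [I17, Matrix.diagonal_mul_diagonal, ← Matrix.diagonal_one]
  congr 1
  ext i
  refine Fin.cases ?_ (fun j => ?_) i <;> simp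

theorem involD_mul_self : involD R * involD R = 1 := by
  rw [involD, Matrix.diagonal_mul_diagonal, ← Matrix.diagonal_one]
  congr 1
  ext i
  fin_cases i <;> simp

theorem involD_mul_I17 : involD R * I17 R = I17 R * involD R := by
  rw [involD, I17, Matrix.diagonal_mul_diagonal, Matrix.diagonal_mul_diagonal]
  simp only [mul_comm]

theorem lorentzAdjoint_mul (A B : Matrix (Fin 8) (Fin 8) R) :
    lorentzAdjoint (A * B) = lorentzAdjoint B * lorentzAdjoint A := by
  have : I17 R * B.transpose * I17 R * (I17 R * A.transpose * I17 R) =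
      I17 R * B.transpose * (I17 R * I17 R) * A.transpose * I17 R := by noncomm_ring
  simp only [lorentzAdjoint, this, I17_mul_self, Matrix.transpose_mul]
  noncomm_ring

theorem I17_apply (i j : Fin 8) :
    I17 R i j = if i = j then (Fin.cons (-1) fun _ => 1 : Fin 8 → R) i else 0 := by
  rw [I17, Matrix.diagonal_apply]

theorem lorentzAdjoint_apply (A : Matrix (Fin 8) (Fin 8) R) (i j : Fin 8) :
    lorentzAdjoint A i j = (Fin.cons (-1) fun _ => 1 : Fin 8 → R) i * A j i *
      (Fin.cons (-1) fun _ => 1 : Fin 8 → R) j := by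
  rw [lorentzAdjoint, I17, Matrix.mul_diagonal, Matrix.diagonal_mul, Matrix.transpose_apply]

/-- For isometries the adjoint is the inverse, so inverses stay polynomial in the entries, which
preserves holomorphy and continuity. -/
theorem lorentzAdjoint_mul_eq_one {A : Matrix (Fin 8) (Fin 8) R}
    (hA : A.transpose * I17 R * A = I17 R) : lorentzAdjoint A * A = 1 := by
  rw [lorentzAdjoint, Matrix.mul_assoc, Matrix.mul_assoc, ← Matrix.mul_assoc A.transpose, hA,
    I17_mul_self]

theorem transpose_mul_I17_mul_of_lorentzAdjoint {A : Matrix (Fin 8) (Fin 8) R}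
    (hA : lorentzAdjoint A * A = 1) :
    A.transpose * I17 R * A = I17 R := by
  calc A.transpose * I17 R * A = (I17 R * I17 R) * (A.transpose * I17 R * A) := by
        rw [I17_mul_self, Matrix.one_mul]
    _ = I17 R * (lorentzAdjoint A * A) := by
        rw [lorentzAdjoint]
        noncomm_ring
    _ = I17 R := by rw [hA, Matrix.mul_one]

theorem mul_lorentzAdjoint_eq_one {A : Matrix (Fin 8) (Fin 8) R}
    (hA : A.transpose * I17 R * A = I17 R) : A * lorentzAdjoint A = 1 :=
  mul_eq_one_comm.1 (lorentzAdjoint_mul_eq_one hA)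

theorem lorentzAdjoint_map (A : Matrix (Fin 8) (Fin 8) ℝ) :
    lorentzAdjoint (A.map ofReal) = (lorentzAdjoint A).map ofReal := by
  ext i j
  rw [Matrix.map_apply, lorentzAdjoint_apply, lorentzAdjoint_apply]
  refine Fin.cases ?_ (fun i => ?_) i <;> refine Fin.cases ?_ (fun j => ?_) j <;> simp

/-- A matrix which commutes with `D` is block diagonal. -/
theorem apply_eq_zero_of_twisted [NoZeroDivisors R] [CharZero R] {A : Matrix (Fin 8) (Fin 8) R}
    (hA : A = involD R * A * involD R) (i j : Fin 4) :
    A (Fin.natAdd 4 i) (Fin.castAdd 4 j) = 0 := by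
  have h := congrFun (congrFun hA (Fin.natAdd 4 i)) (Fin.castAdd 4 j)
  rw [involD, Matrix.mul_diagonal, Matrix.diagonal_mul] at h
  have h1 : (![-1, -1, -1, -1, 1, 1, 1, 1] : Fin 8 → R) (Fin.natAdd 4 i) = 1 := by
    fin_cases i <;> rfl
  have h2 : (![-1, -1, -1, -1, 1, 1, 1, 1] : Fin 8 → R) (Fin.castAdd 4 j) = -1 := by
    fin_cases j <;> rfl
  rw [h1, h2, one_mul, mul_neg_one] at h
  exact self_eq_neg.1 h

end Adjoint

/-- The wedge product of linear combinations. -/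
theorem alternatingMap_sum_smul {R M N : Type*} [CommRing R] [AddCommGroup M] [Module R M]
    [AddCommGroup N] [Module R N] {n : ℕ} (f : M [⋀^Fin n]→ₗ[R] N) (v : Fin n → M)
    (A : Matrix (Fin n) (Fin n) R) :
    f (fun k => ∑ j, A j k • v j) = A.det • f v := by
  have h : f.compLinearMap (Fintype.linearCombination R v) =
      (LinearMap.toSpanSingleton R N (f v)).compAlternatingMap Matrix.detRowAlternating := by
    -- Both sides are alternating in the coefficient vectors, so it is enough to compare them on
    -- permutations of the standard basis, where each gives a sign.
    refine Module.Basis.ext_alternating (Pi.basisFun R (Fin n)) fun s hs => ?_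
    obtain ⟨σ, rfl⟩ : ∃ σ : Equiv.Perm (Fin n), s = σ :=
      ⟨Equiv.ofBijective s hs.bijective_of_finite, rfl⟩
    have h1 : (fun i => Fintype.linearCombination R v ((Pi.basisFun R (Fin n)) (σ i))) = v ∘ σ := by
      ext i
      simp [Fintype.linearCombination_apply, Pi.single_apply]
    have h2 : Matrix.detRowAlternating (fun i => (Pi.basisFun R (Fin n)) (σ i)) =
        ((Equiv.Perm.sign σ : ℤ) : R) := by
      have := (Matrix.detRowAlternating (R := R) (n := Fin n)).map_perm
        (fun i => Pi.basisFun R (Fin n) i) σ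
      have h3 : (Matrix.detRowAlternating fun i => (Pi.basisFun R (Fin n)) i) = 1 := by
        have : (fun i => (Pi.basisFun R (Fin n)) i) = (1 : Matrix (Fin n) (Fin n) R) := by
          ext i j
          simp [Matrix.one_apply, Pi.single_apply, eq_comm]
        rw [this]
        exact Matrix.det_one
      rw [h3] at this
      simpa [Units.smul_def, Function.comp_def] using this
    rw [AlternatingMap.compLinearMap_apply, LinearMap.compAlternatingMap_apply, h1, h2,
      f.map_perm]
    simp [Units.smul_def, Int.cast_smul_eq_zsmul]
  have h3 := congrArg (fun g => g fun k j => A j k) h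
  simp only [AlternatingMap.compLinearMap_apply, LinearMap.compAlternatingMap_apply,
    Fintype.linearCombination_apply, LinearMap.toSpanSingleton_apply] at h3
  rw [h3]
  congr 1
  exact Matrix.det_transpose A


theorem circle_mem_closedBall (l : Circle) : (l : ℂ) ∈ Metric.closedBall (0 : ℂ) 1 := by
  simp [Circle.norm_coe]

/-- The potential takes values in the Lie algebra of the complex Lorentz group. -/
theorem lorentzAdjoint_offDiagonal (A : Matrix (Fin 4) (Fin 4) ℂ) :
    lorentzAdjoint (offDiagonal A) = -offDiagonal A := by
  have hs : (Fin.cons (-1) fun _ => 1 : Fin 8 → ℂ) = ![-1, 1, 1, 1, 1, 1, 1, 1] := by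
    ext i
    fin_cases i <;> rfl
  ext i j
  rw [lorentzAdjoint_apply, hs]
  fin_cases i <;> fin_cases j <;>
    simp [offDiagonal, finSumFinEquiv, Fin.addCases, I13, Fin.castLT, Fin.subNat]

theorem hasDerivAt_lorentzAdjoint {A : ℂ → Matrix (Fin 8) (Fin 8) ℂ}
    {A' : Matrix (Fin 8) (Fin 8) ℂ} {z : ℂ}
    (hA : ∀ i j, HasDerivAt (fun w => A w i j) (A' i j) z) (i j : Fin 8) :
    HasDerivAt (fun w => lorentzAdjoint (A w) i j) (lorentzAdjoint A' i j) z := by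
  simp only [lorentzAdjoint_apply]
  exact ((hA j i).const_mul _).mul_const _

theorem lorentzAdjoint_smul_offDiagonal (c : ℂ) (A : Matrix (Fin 4) (Fin 4) ℂ) :
    lorentzAdjoint (c • offDiagonal A) = -(c • offDiagonal A) := by
  rw [← smul_neg, ← lorentzAdjoint_offDiagonal]
  simp [lorentzAdjoint]

/-- The product has derivative `H η H'* + H η* H'* = 0`, `*` being the adjoint. With `H = H'` this
gives orthogonality of the solution, with `H ≠ H'` its uniqueness. -/
theorem mul_lorentzAdjoint_eq_one_of_hasDerivAt {H H' η : ℂ → Matrix (Fin 8) (Fin 8) ℂ}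
    (hη : ∀ z, lorentzAdjoint (η z) = -η z)
    (hH : ∀ z i j, HasDerivAt (fun w => H w i j) ((H z * η z) i j) z)
    (hH' : ∀ z i j, HasDerivAt (fun w => H' w i j) ((H' z * η z) i j) z)
    (h0 : H 0 = 1) (h0' : H' 0 = 1) (z : ℂ) : H z * lorentzAdjoint (H' z) = 1 := by
  have hd : ∀ w i j, HasDerivAt (fun w => (H w * lorentzAdjoint (H' w)) i j) 0 w := by
    intro w i j
    have h := hasDerivAt_matrix_mul (hH w) (hasDerivAt_lorentzAdjoint (hH' w)) i j
    convert h using 1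
    have h3 : H w * η w * lorentzAdjoint (H' w) + H w * (-η w * lorentzAdjoint (H' w)) = 0 := by
      noncomm_ring
    rw [lorentzAdjoint_mul, hη, h3, Matrix.zero_apply]
  ext i j
  rw [is_const_of_deriv_eq_zero (f := fun w => (H w * lorentzAdjoint (H' w)) i j)
    (fun w => (hd w i j).differentiableAt) (fun w => (hd w i j).deriv) z 0]
  simp [h0, h0', lorentzAdjoint, I17_mul_self]

namespace IsExtendedFrame

variable {B : ℂ → Matrix (Fin 4) (Fin 4) ℂ}
  {H H' : ℂ → Circle → Matrix (Fin 8) (Fin 8) ℂ} {F F' : ℂ → Circle → Matrix (Fin 8) (Fin 8) ℝ}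
  {P P' : ℂ → ℂ → Matrix (Fin 8) (Fin 8) ℂ}

theorem orthogonal_map (hF : IsExtendedFrame B H F P) (z : ℂ) (l : Circle) :
    lorentzAdjoint ((F z l).map ofReal) * (F z l).map ofReal = 1 := by
  rw [lorentzAdjoint_map]
  have h := congrArg (fun M : Matrix (Fin 8) (Fin 8) ℝ => M.map ofRealHom)
    (lorentzAdjoint_mul_eq_one (hF.frame_orthogonal z l))
  simp only [Matrix.map_mul] at h
  rw [Matrix.map_one _ (map_zero _) (map_one _)] at h
  exact h

theorem lorentzAdjoint_H_mul (hF : IsExtendedFrame B H F P) (z : ℂ) (l : Circle) :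
    lorentzAdjoint (H z l) * H z l = 1 := by
  rw [hF.iwasawa, lorentzAdjoint_mul, Matrix.mul_assoc, ← Matrix.mul_assoc (lorentzAdjoint
    ((F z l).map ofReal)), hF.orthogonal_map, Matrix.one_mul]
  exact lorentzAdjoint_mul_eq_one (hF.plus_orthogonal z l (circle_mem_closedBall l))

/-- The solution of the initial value problem `H⁻¹ dH = η`, `H(0) = I` is unique. -/
theorem eq_H (hF : IsExtendedFrame B H F P) (hF' : IsExtendedFrame B H' F' P') (z : ℂ)
    (l : Circle) : H z l = H' z l := by
  have hc := mul_lorentzAdjoint_eq_one_of_hasDerivAt (fun w => lorentzAdjoint_smul_offDiagonal _ _)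
    (hF.hol_deriv l) (hF'.hol_deriv l) (hF.hol_init l) (hF'.hol_init l) z
  calc H z l = H z l * (lorentzAdjoint (H' z l) * H' z l) := by
        rw [hF'.lorentzAdjoint_H_mul, Matrix.mul_one]
    _ = H' z l := by rw [← Matrix.mul_assoc, hc, Matrix.one_mul]

/-- Two extended frames of the same potential differ by a block diagonal matrix which does not
depend on the spectral parameter. -/
theorem frame_eq (hF : IsExtendedFrame B H F P) (hF' : IsExtendedFrame B H' F' P') (z : ℂ)
    (l : Circle) : (F' z l).map ofReal = (F z l).map ofReal * (P z 0 * lorentzAdjoint (P' z 0)) := by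
  -- Two factorizations of the same `H`: the quotient of the plus factors equals the quotient of the
  -- real frames on the circle.
  have hG : ∀ m : Circle, P z m * lorentzAdjoint (P' z m) =
      (lorentzAdjoint (F z m) * F' z m).map ofReal := by
    intro m
    have h1 : (F z m).map ofReal * P z m = (F' z m).map ofReal * P' z m := by
      rw [← hF.iwasawa, ← hF'.iwasawa, hF.eq_H hF']
    have h2 := mul_lorentzAdjoint_eq_one (hF'.plus_orthogonal z m (circle_mem_closedBall m))
    have h3 : (lorentzAdjoint (F z m) * F' z m).map ofReal =
        lorentzAdjoint ((F z m).map ofReal) * (F' z m).map ofReal := by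
      rw [lorentzAdjoint_map]
      exact Matrix.map_mul (f := ofRealHom)
    calc P z m * lorentzAdjoint (P' z m)
        = lorentzAdjoint ((F z m).map ofReal) * ((F z m).map ofReal * P z m) *
            lorentzAdjoint (P' z m) := by
          rw [← Matrix.mul_assoc (lorentzAdjoint ((F z m).map ofReal)), hF.orthogonal_map,
            Matrix.one_mul]
      _ = _ := by
          rw [h1, h3, Matrix.mul_assoc, Matrix.mul_assoc, h2, Matrix.mul_one]
  have hd : ∀ i j, DiffContOnCl ℂ (fun m => (P z m * lorentzAdjoint (P' z m)) i j)
      (Metric.ball 0 1) := by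
    intro i j
    simp only [Matrix.mul_apply, lorentzAdjoint_apply]
    have h : ∀ k, DiffContOnCl ℂ (fun m => P z m i k * ((Fin.cons (-1) fun _ => 1 : Fin 8 → ℂ) k *
        P' z m j k * (Fin.cons (-1) fun _ => 1 : Fin 8 → ℂ) j)) (Metric.ball 0 1) := by
      intro k
      refine (hF.plus_hol z i k).smul ?_
      simp only [mul_comm _ (P' z _ j k), mul_assoc]
      exact (hF'.plus_hol z j k).smul diffContOnCl_const
    refine ⟨DifferentiableOn.fun_sum fun k _ => (h k).differentiableOn,
      continuousOn_finsetSum _ fun k _ => (h k).continuousOn⟩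
  -- Entries are holomorphic in the disk and real on its boundary, hence constant in the spectral
  -- parameter.
  have hc : P z l * lorentzAdjoint (P' z l) = P z 0 * lorentzAdjoint (P' z 0) := by
    ext i j
    refine eq_of_diffContOnCl_of_im_eq_zero (hd i j) (fun m => ?_) (circle_mem_closedBall l)
    simp only [hG m, Matrix.map_apply, ofReal_im]
  have h4 : (F z l).map ofReal * lorentzAdjoint ((F z l).map ofReal) = 1 :=
    mul_eq_one_comm.1 (hF.orthogonal_map z l)
  rw [← hc, hG l, show (lorentzAdjoint (F z l) * F' z l).map ofReal =
    (lorentzAdjoint (F z l)).map ofReal * (F' z l).map ofReal from Matrix.map_mul (f := ofRealHom),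
    ← Matrix.mul_assoc, ← lorentzAdjoint_map, h4, Matrix.one_mul]

/-- The harmonic map of a potential does not depend on the extended frame. -/
theorem ιMulti_eq (hF : IsExtendedFrame B H F P) (hF' : IsExtendedFrame B H' F' P') (z : ℂ)
    (l : Circle) :
    ExteriorAlgebra.ιMulti ℂ 4 (fun k : Fin 4 => fun i : Fin 8 =>
      ((F' z l i (Fin.castAdd 4 k) : ℝ) : ℂ)) =
    ExteriorAlgebra.ιMulti ℂ 4 (fun k : Fin 4 => fun i : Fin 8 =>
      ((F z l i (Fin.castAdd 4 k) : ℝ) : ℂ)) := by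
  set K := P z 0 * lorentzAdjoint (P' z 0) with hK
  have h0 : (0 : ℂ) ∈ Metric.closedBall (0 : ℂ) 1 := by simp
  -- At `λ = 0` the twisting condition relates the loop to itself, so its value commutes with `D`
  -- and is block diagonal.
  have t1 : P z 0 = involD ℂ * P z 0 * involD ℂ := by
    have := hF.plus_twisted z 0 h0
    rwa [neg_zero] at this
  have t2 : lorentzAdjoint (P' z 0) = involD ℂ * lorentzAdjoint (P' z 0) * involD ℂ := by
    have := hF'.plus_twisted z 0 h0
    rw [neg_zero] at this
    conv_lhs => rw [this]
    have hD : lorentzAdjoint (involD ℂ) = involD ℂ := by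
      rw [lorentzAdjoint, involD, Matrix.diagonal_transpose, ← involD, ← involD_mul_I17,
        Matrix.mul_assoc, I17_mul_self, Matrix.mul_one]
    rw [lorentzAdjoint_mul, lorentzAdjoint_mul, hD, Matrix.mul_assoc]
  have t3 : K = involD ℂ * K * involD ℂ := by
    rw [hK]
    conv_lhs => rw [t1, t2]
    have : involD ℂ * P z 0 * involD ℂ * (involD ℂ * lorentzAdjoint (P' z 0) * involD ℂ) =
      involD ℂ * P z 0 * (involD ℂ * involD ℂ) * lorentzAdjoint (P' z 0) * involD ℂ := by
      noncomm_ring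
    rw [this, involD_mul_self, Matrix.mul_one]
    noncomm_ring
  -- Block diagonality makes the upper block of the product the product of the upper blocks, both of
  -- determinant one. Without this normalization the orientation of the 4-space would be ambiguous.
  have hdet : (K.submatrix (Fin.castAdd 4 : Fin 4 → Fin 8) (Fin.castAdd 4)).det = 1 := by
    have h1 : K.submatrix (Fin.castAdd 4 : Fin 4 → Fin 8) (Fin.castAdd 4) =
        (P z 0).submatrix (Fin.castAdd 4 : Fin 4 → Fin 8) (Fin.castAdd 4) *
        (I13 * ((P' z 0).submatrix (Fin.castAdd 4 : Fin 4 → Fin 8) (Fin.castAdd 4)).transpose *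
          I13) := by
      ext i j
      rw [Matrix.submatrix_apply, hK, Matrix.mul_apply, Matrix.mul_apply,
        Fin.sum_univ_add (a := 4) (b := 4)]
      have h2 : ∀ k : Fin 4, lorentzAdjoint (P' z 0) (Fin.natAdd 4 k) (Fin.castAdd 4 j) = 0 :=
        fun k => apply_eq_zero_of_twisted t2 k j
      simp only [h2, mul_zero, Finset.sum_const_zero, add_zero]
      refine Finset.sum_congr rfl fun k _ => ?_
      rw [Matrix.submatrix_apply, lorentzAdjoint_apply, I13, Matrix.mul_diagonal,
        Matrix.diagonal_mul, Matrix.transpose_apply, Matrix.submatrix_apply]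
      congr 1
      have h3 : ∀ k : Fin 4, (Fin.cons (-1) fun _ => 1 : Fin 8 → ℂ) (Fin.castAdd 4 k) =
          (![-1, 1, 1, 1] : Fin 4 → ℂ) k := fun k => by fin_cases k <;> rfl
      rw [h3, h3]
    have h4 : I13.det * I13.det = 1 := by
      simp [I13, Matrix.det_diagonal, Fin.prod_univ_four]
    rw [h1, Matrix.det_mul, Matrix.det_mul, Matrix.det_mul, Matrix.det_transpose, hF.plus_zero,
      hF'.plus_zero]
    linear_combination h4
  have h := alternatingMap_sum_smul (ExteriorAlgebra.ιMulti ℂ 4)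
    (fun k : Fin 4 => fun i : Fin 8 => ((F z l i (Fin.castAdd 4 k) : ℝ) : ℂ))
    (K.submatrix (Fin.castAdd 4 : Fin 4 → Fin 8) (Fin.castAdd 4))
  rw [hdet, one_smul] at h
  rw [← h]
  congr 1
  ext k i
  have h5 := congrFun (congrFun (hF.frame_eq hF' z l) i) (Fin.castAdd 4 k)
  rw [Matrix.map_apply, ← hK, Matrix.mul_apply, Fin.sum_univ_add (a := 4) (b := 4)] at h5
  have h6 : ∀ m : Fin 4, K (Fin.natAdd 4 m) (Fin.castAdd 4 k) = 0 :=
    fun m => apply_eq_zero_of_twisted t3 m k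
  simp only [h6, mul_zero, Finset.sum_const_zero, add_zero] at h5
  rw [h5, Finset.sum_apply]
  simp [mul_comm]

end IsExtendedFrame

/-- The pairing of a decomposable 4-vector with four vectors. -/
theorem det_lorentz_eq_of_ιMulti_eq {v w : Fin 4 → Fin 8 → ℂ}
    (h : ExteriorAlgebra.ιMulti ℂ 4 v = ExteriorAlgebra.ιMulti ℂ 4 w) (t : Fin 4 → Fin 8 → ℂ) :
    (Matrix.of fun i j => lorentz (v i) (t j)).det =
      (Matrix.of fun i j => lorentz (w i) (t j)).det := by
  let f : (Fin 8 → ℂ) →ₗ[ℂ] (Fin 4 → ℂ) :=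
    { toFun := fun x j => lorentz x (t j)
      map_add' := fun x y => by
        ext j
        exact lorentz_add_left _ _ _
      map_smul' := fun c x => by
        ext j
        exact lorentz_smul_left _ _ _ }
  -- The determinant of pairings is alternating in `v`, so it extends to a linear functional on the
  -- exterior algebra, taken to be zero outside degree four.
  have h1 := congrArg (ExteriorAlgebra.liftAlternating fun n =>
    if hn : n = 4 then (hn ▸ Matrix.detRowAlternating.compLinearMap f :
      (Fin 8 → ℂ) [⋀^Fin n]→ₗ[ℂ] ℂ) else 0) h
  rw [ExteriorAlgebra.liftAlternating_apply_ιMulti,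
    ExteriorAlgebra.liftAlternating_apply_ιMulti] at h1
  exact h1


/-! ### The surface is determined by its conformal Gauss map -/

namespace IsConformalImmersion

variable {y : ℂ → EuclideanSpace ℝ (Fin 7)}

theorem fderiv_one (y : ℂ → EuclideanSpace ℝ (Fin 7)) (z : ℂ) :
    fderiv ℝ (canonicalLift y) z 1 = dz (canonicalLift y) z + dzbar (canonicalLift y) z := by
  simp only [dz, dzbar]
  module

theorem fderiv_I (y : ℂ → EuclideanSpace ℝ (Fin 7)) (z : ℂ) :
    fderiv ℝ (canonicalLift y) z I =
      I • (dz (canonicalLift y) z - dzbar (canonicalLift y) z) := by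
  have h : dz (canonicalLift y) z - dzbar (canonicalLift y) z =
      -I • fderiv ℝ (canonicalLift y) z I := by
    simp only [dz, dzbar]
    module
  rw [h, smul_smul, mul_neg, I_mul_I, neg_neg, one_smul]

/-- The products of the frame `Y, Y_u, Y_v, N`. -/
theorem lorentz_gaussFrame (hy : IsConformalImmersion y) (z : ℂ) (i j : Fin 4) :
    lorentz ((![canonicalLift y z, fderiv ℝ (canonicalLift y) z 1,
      fderiv ℝ (canonicalLift y) z I, lightlikeN y z] : Fin 4 → Fin 8 → ℂ) i)
      ((![canonicalLift y z, fderiv ℝ (canonicalLift y) z 1,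
      fderiv ℝ (canonicalLift y) z I, lightlikeN y z] : Fin 4 → Fin 8 → ℂ) j) =
    !![0, 0, 0, -1; 0, 1, 0, 0; 0, 0, 1, 0; -1, 0, 0, 0] i j := by
  have c1 := lorentz_comm (canonicalLift y z) (dz (canonicalLift y) z)
  have c2 := lorentz_comm (canonicalLift y z) (dzbar (canonicalLift y) z)
  have c3 := lorentz_comm (canonicalLift y z) (lightlikeN y z)
  have c4 := lorentz_comm (dzbar (canonicalLift y) z) (dz (canonicalLift y) z)
  have c5 := lorentz_comm (dz (canonicalLift y) z) (lightlikeN y z)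
  have c6 := lorentz_comm (dzbar (canonicalLift y) z) (lightlikeN y z)
  rw [fderiv_one, fderiv_I]
  fin_cases i <;> fin_cases j <;>
    simp [lorentz_add_left, lorentz_add_right, lorentz_smul_left, lorentz_smul_right,
      lorentz_sub_left, lorentz_sub_right, c1, c2, c3, c4, c5, c6, hy.lorentz_Y_Y,
      hy.lorentz_Yz_Y, hy.lorentz_Yzbar_Y, hy.lorentz_N_Y, hy.lorentz_N_N, hy.lorentz_N_Yz,
      hy.lorentz_N_Yzbar, hy.lorentz_Yz_Yz, hy.lorentz_Yz_Yzbar, hy.lorentz_Yzbar_Yzbar] <;>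
    ring_nf <;> simp only [I_sq] <;> norm_num

/-- If the conformal Gauss map is annihilated by `h`, then so is the surface. -/
theorem perp_of_det_eq_zero (hy : IsConformalImmersion y) {z : ℂ} {h : Fin 8 → ℂ}
    (hdet : ∀ (t : Fin 4 → Fin 8 → ℂ) (k : Fin 4), t k = h → (Matrix.of fun i j => lorentz
      ((![canonicalLift y z, fderiv ℝ (canonicalLift y) z 1, fderiv ℝ (canonicalLift y) z I,
        lightlikeN y z] : Fin 4 → Fin 8 → ℂ) i) (t j)).det = 0) :
    lorentz (canonicalLift y z) h = 0 ∧ lorentz (dz (canonicalLift y) z) h = 0 := by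
  have g := hy.lorentz_gaussFrame z
  set v : Fin 4 → Fin 8 → ℂ := ![canonicalLift y z, fderiv ℝ (canonicalLift y) z 1,
    fderiv ℝ (canonicalLift y) z I, lightlikeN y z] with hv
  -- The remaining slots hold vectors dual, up to sign, to the rest of the frame, so each
  -- determinant reduces to plus or minus one pairing with `h`.
  have h0 := hdet ![h, v 1, v 2, v 0] 0 rfl
  have h1 := hdet ![v 3, h, v 2, v 0] 1 rfl
  have h2 := hdet ![v 3, v 1, h, v 0] 2 rfl
  simp [Matrix.det_succ_row_zero, Fin.sum_univ_succ, Fin.succAbove, g] at h0 h1 h2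
  have e0 : lorentz (v 0) h = 0 := by simpa using h0
  have e1 : lorentz (v 1) h = 0 := by simpa using h1
  have e2 : lorentz (v 2) h = 0 := by simpa using h2
  refine ⟨e0, ?_⟩
  have e3 : dz (canonicalLift y) z = (1 / 2 : ℂ) • (v 1 - I • v 2) := rfl
  rw [e3, lorentz_smul_left, lorentz_sub_left, lorentz_smul_left, e1, e2]
  simp

end IsConformalImmersion

/-- Since `hᵢ` is normal to `y`, putting it in any slot gives a zero column and a zero determinant.
Equal 4-vectors transfer this to `y'`, so its lift is orthogonal to the same frame. -/
theorem IsIsotropicFrame.eq_of_conformalGaussMap_eq {y y' : ℂ → EuclideanSpace ℝ (Fin 7)}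
    {h : Fin 2 → ℂ → Fin 8 → ℂ} (hh : IsIsotropicFrame y h) (hy : IsConformalImmersion y)
    (hy' : IsConformalImmersion y') (hG : ∀ z, conformalGaussMap y' z = conformalGaussMap y z)
    (z : ℂ) : y' z = y z := by
  have key : ∀ i z, lorentz (canonicalLift y' z) (h i z) = 0 ∧
      lorentz (dz (canonicalLift y') z) (h i z) = 0 := by
    intro i z
    refine hy'.perp_of_det_eq_zero fun t k ht => ?_
    rw [det_lorentz_eq_of_ιMulti_eq (hG z) t]
    refine Matrix.det_eq_zero_of_column_eq_zero k fun j => ?_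
    have hn := hh.isNormal hy i z
    have c1 := lorentz_comm (canonicalLift y z) (h i z)
    have c2 := lorentz_comm (dz (canonicalLift y) z) (h i z)
    have c3 := lorentz_comm (dzbar (canonicalLift y) z) (h i z)
    have c4 := lorentz_comm (lightlikeN y z) (h i z)
    rw [Matrix.of_apply, ht, IsConformalImmersion.fderiv_one, IsConformalImmersion.fderiv_I]
    fin_cases j <;>
      simp [lorentz_add_left, lorentz_smul_left, lorentz_sub_left, c1, c2, c3, c4, hn.perp_Y,
        hn.perp_Yz, hn.perp_Yzbar, hn.perp_N]
  exact hh.eq_of_perp hy.mem_sphere hy' (fun i z => (key i z).1) (fun i z => (key i z).2) z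


/-! ### The grading of `ℂ⁸` by the eigenvalues of the rotations -/

/-- The vectors `e₄ - i e₅` and `e₆ - i e₇`, on which the rotations act by multiplication. -/
noncomputable def weightVector : Fin 2 → Fin 8 → ℂ :=
  ![![0, 0, 0, 0, 1, -I, 0, 0], ![0, 0, 0, 0, 0, 0, 1, -I]]

/-- The projection onto the fixed space of the rotations. -/
noncomputable def projZero : Matrix (Fin 8) (Fin 8) ℂ := Matrix.diagonal ![1, 1, 1, 1, 0, 0, 0, 0]

/-- The projection onto the eigenspace of the rotation by `l` for the eigenvalue `l`. -/
noncomputable def projPos : Matrix (Fin 8) (Fin 8) ℂ :=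
  (1 / 2 : ℂ) • (Matrix.vecMulVec (weightVector 0) (star (weightVector 0)) +
    Matrix.vecMulVec (weightVector 1) (star (weightVector 1)))

/-- The projection onto the eigenspace of the rotation by `l` for the eigenvalue `l⁻¹`. -/
noncomputable def projNeg : Matrix (Fin 8) (Fin 8) ℂ := projPos.transpose

theorem projZero_mulVec (v : Fin 8 → ℂ) :
    projZero.mulVec v = ![v 0, v 1, v 2, v 3, 0, 0, 0, 0] := by
  ext i
  rw [projZero, Matrix.mulVec_diagonal]
  fin_cases i <;> simp

theorem involD_mulVec (v : Fin 8 → ℂ) :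
    (involD ℂ).mulVec v = ![-v 0, -v 1, -v 2, -v 3, v 4, v 5, v 6, v 7] := by
  ext i
  rw [involD, Matrix.mulVec_diagonal]
  fin_cases i <;> simp

theorem signs_eq (R : Type*) [CommRing R] :
    (Fin.cons (-1) fun _ => 1 : Fin 8 → R) = ![-1, 1, 1, 1, 1, 1, 1, 1] := by
  ext i
  fin_cases i <;> rfl

theorem I17_mulVec (v : Fin 8 → ℂ) :
    (I17 ℂ).mulVec v = ![-v 0, v 1, v 2, v 3, v 4, v 5, v 6, v 7] := by
  ext i
  rw [I17, Matrix.mulVec_diagonal, signs_eq]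
  fin_cases i <;> simp

theorem projPos_mulVec (v : Fin 8 → ℂ) : projPos.mulVec v =
    ![0, 0, 0, 0, (v 4 + I * v 5) / 2, (v 5 - I * v 4) / 2, (v 6 + I * v 7) / 2,
      (v 7 - I * v 6) / 2] := by
  rw [projPos, Matrix.smul_mulVec, Matrix.add_mulVec, Matrix.vecMulVec_mulVec,
    Matrix.vecMulVec_mulVec]
  ext i
  fin_cases i <;> simp [weightVector, dotProduct, Fin.sum_univ_eight] <;> ring_nf <;> simp [I_sq] <;> ring

theorem projNeg_mulVec (v : Fin 8 → ℂ) : projNeg.mulVec v =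
    ![0, 0, 0, 0, (v 4 - I * v 5) / 2, (v 5 + I * v 4) / 2, (v 6 - I * v 7) / 2,
      (v 7 + I * v 6) / 2] := by
  rw [projNeg, projPos, Matrix.transpose_smul, Matrix.transpose_add, Matrix.transpose_vecMulVec,
    Matrix.transpose_vecMulVec, Matrix.smul_mulVec, Matrix.add_mulVec, Matrix.vecMulVec_mulVec,
    Matrix.vecMulVec_mulVec]
  ext i
  fin_cases i <;> simp [weightVector, dotProduct, Fin.sum_univ_eight] <;> ring_nf <;> simp [I_sq] <;> ring

theorem rotMatrix_eq (l : ℂ) : rotMatrix l = projZero + l • projPos + l⁻¹ • projNeg := by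
  refine Matrix.mulVec_injective (funext fun v => ?_)
  rw [Matrix.add_mulVec, Matrix.add_mulVec, Matrix.smul_mulVec, Matrix.smul_mulVec,
    rotMatrix_mulVec, projZero_mulVec, projPos_mulVec, projNeg_mulVec]
  ext i
  fin_cases i <;> simp <;> ring

theorem lorentzAdjoint_projZero : lorentzAdjoint projZero = projZero := by
  refine Matrix.mulVec_injective (funext fun v => ?_)
  rw [lorentzAdjoint, projZero, Matrix.diagonal_transpose, ← projZero, ← Matrix.mulVec_mulVec,
    ← Matrix.mulVec_mulVec, I17_mulVec, I17_mulVec, projZero_mulVec, projZero_mulVec]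
  ext i
  fin_cases i <;> simp

theorem lorentzAdjoint_projPos : lorentzAdjoint projPos = projNeg := by
  refine Matrix.mulVec_injective (funext fun v => ?_)
  rw [lorentzAdjoint, ← projNeg, ← Matrix.mulVec_mulVec,
    ← Matrix.mulVec_mulVec, I17_mulVec, I17_mulVec, projNeg_mulVec, projNeg_mulVec]
  ext i
  fin_cases i <;> simp

theorem involD_mul_proj : involD ℂ * projZero = -projZero ∧ involD ℂ * projPos = projPos ∧
    involD ℂ * projNeg = projNeg := by
  refine ⟨?_, ?_, ?_⟩ <;> refine Matrix.mulVec_injective (funext fun v => ?_) <;>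
    simp only [← Matrix.mulVec_mulVec, Matrix.neg_mulVec, projZero_mulVec, projPos_mulVec,
      projNeg_mulVec, involD_mulVec] <;> ext i <;> fin_cases i <;> simp

theorem proj_mul_involD : projZero * involD ℂ = -projZero ∧ projPos * involD ℂ = projPos ∧
    projNeg * involD ℂ = projNeg := by
  refine ⟨?_, ?_, ?_⟩ <;> refine Matrix.mulVec_injective (funext fun v => ?_) <;>
    simp only [← Matrix.mulVec_mulVec, Matrix.neg_mulVec, projZero_mulVec, projPos_mulVec,
      projNeg_mulVec, involD_mulVec] <;> ext i <;> fin_cases i <;> simp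

theorem proj_mulVec_weightVector (k : Fin 2) : projZero.mulVec (weightVector k) = 0 ∧
    projNeg.mulVec (weightVector k) = 0 := by
  rw [projZero_mulVec, projNeg_mulVec]
  constructor <;> ext i <;> fin_cases k <;> fin_cases i <;> simp [weightVector]

theorem mul_projPos_eq_zero {X : Matrix (Fin 8) (Fin 8) ℂ}
    (hX : ∀ k, X.mulVec (weightVector k) = 0) : X * projPos = 0 := by
  rw [projPos, Matrix.mul_smul, Matrix.mul_add, Matrix.mul_vecMulVec, Matrix.mul_vecMulVec, hX, hX]
  simp

theorem lorentzAdjoint_lorentzAdjoint {R : Type*} [CommRing R] (A : Matrix (Fin 8) (Fin 8) R) :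
    lorentzAdjoint (lorentzAdjoint A) = A := by
  ext i j
  rw [lorentzAdjoint_apply, lorentzAdjoint_apply, signs_eq]
  fin_cases i <;> fin_cases j <;> simp

/-- The loop `l ↦ A_l M A_l⁻¹` for a matrix `M` which does not lower the weights. -/
noncomputable def conjLoop (M : Matrix (Fin 8) (Fin 8) ℂ) (l : ℂ) : Matrix (Fin 8) (Fin 8) ℂ :=
  projZero * M * projZero + projPos * M * projPos + projNeg * M * projNeg
    + l • (projPos * M * projZero + projZero * M * projNeg) + l ^ 2 • (projPos * M * projNeg)

/-- Conjugation multiplies the block of `M` that changes the weight by `k` by `l ^ k`. The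
hypotheses kill the three blocks with negative `k`, so the loop is a quadratic polynomial in `l`. -/
theorem conjLoop_eq {M : Matrix (Fin 8) (Fin 8) ℂ}
    (h1 : ∀ k, projZero.mulVec (M.mulVec (weightVector k)) = 0)
    (h2 : ∀ k, projNeg.mulVec (M.mulVec (weightVector k)) = 0)
    (h3 : ∀ k, projZero.mulVec ((lorentzAdjoint M).mulVec (weightVector k)) = 0) {l : ℂ}
    (hl : l ≠ 0) : conjLoop M l = rotMatrix l * M * rotMatrix l⁻¹ := by
  have e1 : projZero * M * projPos = 0 :=
    mul_projPos_eq_zero fun k => by rw [← Matrix.mulVec_mulVec, h1]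
  have e2 : projNeg * M * projPos = 0 :=
    mul_projPos_eq_zero fun k => by rw [← Matrix.mulVec_mulVec, h2]
  -- This block is the adjoint of the block of `M*` from weight one to weight zero, since the
  -- adjoint exchanges the weights `1` and `-1`.
  have e3 : projNeg * M * projZero = 0 := by
    have h4 : projZero * lorentzAdjoint M * projPos = 0 :=
      mul_projPos_eq_zero fun k => by rw [← Matrix.mulVec_mulVec, h3]
    have h5 := congrArg lorentzAdjoint h4
    rw [lorentzAdjoint_mul, lorentzAdjoint_mul, lorentzAdjoint_projZero, lorentzAdjoint_projPos,
      lorentzAdjoint_lorentzAdjoint, ← Matrix.mul_assoc] at h5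
    rw [h5]
    simp [lorentzAdjoint]
  rw [rotMatrix_eq, rotMatrix_eq, inv_inv, conjLoop]
  simp only [Matrix.add_mul, Matrix.mul_add, Matrix.smul_mul, Matrix.mul_smul, smul_add, e1, e2,
    e3, smul_smul, smul_zero, add_zero, inv_mul_cancel₀ hl, mul_inv_cancel₀ hl, one_smul]
  module

/-- `D` is `-1` on weight zero and `1` on weights `±1`, so conjugation by it flips exactly the
blocks carrying an odd power of `l`. -/
theorem conjLoop_neg (M : Matrix (Fin 8) (Fin 8) ℂ) (l : ℂ) :
    conjLoop M (-l) = involD ℂ * conjLoop M l * involD ℂ := by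
  obtain ⟨h1, h2, h3⟩ := involD_mul_proj
  obtain ⟨h4, h5, h6⟩ := proj_mul_involD
  have k : ∀ A C : Matrix (Fin 8) (Fin 8) ℂ, involD ℂ * (A * M * C) * involD ℂ =
      (involD ℂ * A) * M * (C * involD ℂ) := fun A C => by noncomm_ring
  simp only [conjLoop, Matrix.mul_add, Matrix.add_mul, Matrix.mul_smul, Matrix.smul_mul, k, h1, h2,
    h3, h4, h5, h6]
  simp only [Matrix.neg_mul, Matrix.mul_neg, neg_neg]
  module

theorem conjLoop_one (l : ℂ) : conjLoop 1 l = 1 := by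
  refine Matrix.mulVec_injective (funext fun v => ?_)
  simp only [conjLoop, Matrix.mul_one, Matrix.add_mulVec, Matrix.smul_mulVec,
    ← Matrix.mulVec_mulVec, projZero_mulVec, projPos_mulVec, projNeg_mulVec, Matrix.one_mulVec]
  ext i
  fin_cases i <;> simp <;> ring_nf <;> simp [I_sq] <;> ring

theorem continuous_conjLoop {X : Type*} [TopologicalSpace X] {M : X → Matrix (Fin 8) (Fin 8) ℂ}
    {l : X → ℂ} (hM : Continuous M) (hl : Continuous l) :
    Continuous fun x => conjLoop (M x) (l x) := by
  have h : ∀ A C : Matrix (Fin 8) (Fin 8) ℂ, Continuous fun x => A * M x * C := fun A C =>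
    (continuous_const.matrix_mul hM).matrix_mul continuous_const
  exact ((((h _ _).add (h _ _)).add (h _ _)).add (hl.smul ((h _ _).add (h _ _)))).add
    ((hl.pow 2).smul (h _ _))

theorem rotMatrix_mul_inv {l : ℂ} (hl : l ≠ 0) : rotMatrix l * rotMatrix l⁻¹ = 1 := by
  have h := fun M h1 h2 h3 => conjLoop_eq (M := M) h1 h2 h3 hl
  have h1 := h 1 (by simp [proj_mulVec_weightVector]) (by simp [proj_mulVec_weightVector])
    (by simp [lorentzAdjoint, I17_mul_self, proj_mulVec_weightVector])
  rw [Matrix.mul_one, conjLoop_one] at h1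
  exact h1.symm

theorem rotMatrix_orthogonal {l : ℂ} (hl : l ≠ 0) :
    (rotMatrix l).transpose * I17 ℂ * rotMatrix l = I17 ℂ := by
  have h : lorentzAdjoint (rotMatrix l) = rotMatrix l⁻¹ := by
    have h1 : lorentzAdjoint projNeg = projPos := by
      rw [← lorentzAdjoint_projPos, lorentzAdjoint_lorentzAdjoint]
    have h2 : lorentzAdjoint (rotMatrix l) =
        lorentzAdjoint projZero + l • lorentzAdjoint projPos + l⁻¹ • lorentzAdjoint projNeg := by
      rw [rotMatrix_eq]
      simp [lorentzAdjoint, Matrix.mul_add, Matrix.add_mul]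
    rw [h2, lorentzAdjoint_projZero, lorentzAdjoint_projPos, h1, rotMatrix_eq, inv_inv]
    module
  refine transpose_mul_I17_mul_of_lorentzAdjoint ?_
  rw [h]
  exact mul_eq_one_comm.1 (rotMatrix_mul_inv hl)

/-- Rotation by `-1` is `-D`; hence conjugation by the rotations produces twisted loops. -/
theorem rotMatrix_neg (l : ℂ) : rotMatrix (-l) = -(involD ℂ * rotMatrix l) ∧
    rotMatrix (-l) = -(rotMatrix l * involD ℂ) := by
  obtain ⟨h1, h2, h3⟩ := involD_mul_proj
  obtain ⟨h4, h5, h6⟩ := proj_mul_involD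
  simp only [rotMatrix_eq, Matrix.mul_add, Matrix.add_mul, Matrix.mul_smul, Matrix.smul_mul, h1, h2,
    h3, h4, h5, h6, inv_neg]
  constructor <;> module


/-! ### The solution of the initial value problem -/

/-- The coefficients of the entries of `initialSolution`, which are monomials. -/
noncomputable def initialCoeff : Matrix (Fin 8) (Fin 8) ℂ :=
  !![1, 0, 0, 0, I / 2, -1 / 2, -I / 2, 1 / 2;
     0, 1, 0, 0, -I / 2, 1 / 2, -I / 2, 1 / 2;
     0, 0, 1, 0, -1, -I, -1 / 4, -I / 4;
     0, 0, 0, 1, I, -1, -I / 4, 1 / 4;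
     I / 2, I / 2, 1, -I, 1, 0, -1 / 6, -I / 6;
     -1 / 2, -1 / 2, I, 1, 0, 1, -I / 6, 1 / 6;
     -I / 2, I / 2, 1 / 4, I / 4, 1 / 6, I / 6, 1, 0;
     1 / 2, -1 / 2, I / 4, -1 / 4, I / 6, -1 / 6, 0, 1]

/-- The degrees of the entries of `initialSolution`. -/
def initialDegree : Matrix (Fin 8) (Fin 8) ℕ :=
  !![0, 0, 0, 0, 2, 2, 1, 1;
     0, 0, 0, 0, 2, 2, 1, 1;
     0, 0, 0, 0, 1, 1, 2, 2;
     0, 0, 0, 0, 1, 1, 2, 2;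
     2, 2, 1, 1, 0, 0, 3, 3;
     2, 2, 1, 1, 0, 0, 3, 3;
     1, 1, 2, 2, 3, 3, 0, 0;
     1, 1, 2, 2, 3, 3, 0, 0]

/-- The solution `H` of `H⁻¹ dH = η`, `H(0) = I` for `λ = 1`. -/
noncomputable def initialSolution (z : ℂ) : Matrix (Fin 8) (Fin 8) ℂ :=
  Matrix.of fun i j => initialCoeff i j * z ^ initialDegree i j

theorem initialSolution_mulVec (z : ℂ) (v : Fin 8 → ℂ) : (initialSolution z).mulVec v =
    ![v 0 + z ^ 2 / 2 * (I * v 4 - v 5) + z / 2 * (v 7 - I * v 6),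
      v 1 - z ^ 2 / 2 * (I * v 4 - v 5) + z / 2 * (v 7 - I * v 6),
      v 2 - z * (v 4 + I * v 5) - z ^ 2 / 4 * (v 6 + I * v 7),
      v 3 + z * (I * v 4 - v 5) + z ^ 2 / 4 * (v 7 - I * v 6),
      I * z ^ 2 / 2 * (v 0 + v 1) + z * (v 2 - I * v 3) + v 4 - z ^ 3 / 6 * (v 6 + I * v 7),
      -z ^ 2 / 2 * (v 0 + v 1) + z * (I * v 2 + v 3) + v 5 + z ^ 3 / 6 * (v 7 - I * v 6),
      I * z / 2 * (v 1 - v 0) + z ^ 2 / 4 * (v 2 + I * v 3) + z ^ 3 / 6 * (v 4 + I * v 5) + v 6,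
      z / 2 * (v 0 - v 1) + z ^ 2 / 4 * (I * v 2 - v 3) + z ^ 3 / 6 * (I * v 4 - v 5) + v 7] := by
  ext i
  fin_cases i <;>
    simp [initialSolution, initialCoeff, initialDegree, Matrix.mulVec, dotProduct,
      Fin.sum_univ_eight] <;> ring

/-- The derivative of `initialSolution`. -/
noncomputable def initialSolutionDeriv (z : ℂ) : Matrix (Fin 8) (Fin 8) ℂ :=
  Matrix.of fun i j => initialCoeff i j * (initialDegree i j * z ^ (initialDegree i j - 1))

theorem hasDerivAt_initialSolution (z : ℂ) (i j : Fin 8) :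
    HasDerivAt (fun w => initialSolution w i j) (initialSolutionDeriv z i j) z :=
  (hasDerivAt_pow _ _).const_mul _

theorem initialSolutionDeriv_mulVec (z : ℂ) (v : Fin 8 → ℂ) : (initialSolutionDeriv z).mulVec v =
    ![z * (I * v 4 - v 5) + 1 / 2 * (v 7 - I * v 6),
      -z * (I * v 4 - v 5) + 1 / 2 * (v 7 - I * v 6),
      -(v 4 + I * v 5) - z / 2 * (v 6 + I * v 7),
      (I * v 4 - v 5) + z / 2 * (v 7 - I * v 6),
      I * z * (v 0 + v 1) + (v 2 - I * v 3) - z ^ 2 / 2 * (v 6 + I * v 7),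
      -z * (v 0 + v 1) + (I * v 2 + v 3) + z ^ 2 / 2 * (v 7 - I * v 6),
      I / 2 * (v 1 - v 0) + z / 2 * (v 2 + I * v 3) + z ^ 2 / 2 * (v 4 + I * v 5),
      1 / 2 * (v 0 - v 1) + z / 2 * (I * v 2 - v 3) + z ^ 2 / 2 * (I * v 4 - v 5)] := by
  ext i
  fin_cases i <;>
    simp [initialSolutionDeriv, initialCoeff, initialDegree, Matrix.mulVec, dotProduct,
      Fin.sum_univ_eight] <;> ring

theorem offDiagonal_exampleB_mulVec (z : ℂ) (v : Fin 8 → ℂ) :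
    (offDiagonal (exampleB z)).mulVec v =
      ![z * (I * v 4 - v 5) + 1 / 2 * (v 7 - I * v 6),
        -z * (I * v 4 - v 5) + 1 / 2 * (v 7 - I * v 6),
        -(v 4 + I * v 5) - z / 2 * (v 6 + I * v 7),
        (I * v 4 - v 5) + z / 2 * (v 7 - I * v 6),
        I * z * (v 0 + v 1) + (v 2 - I * v 3),
        -z * (v 0 + v 1) + (I * v 2 + v 3),
        I / 2 * (v 1 - v 0) + z / 2 * (v 2 + I * v 3),
        1 / 2 * (v 0 - v 1) + z / 2 * (I * v 2 - v 3)] := by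
  ext i
  fin_cases i <;>
    simp [offDiagonal, finSumFinEquiv, Fin.addCases, I13, Fin.castLT, Fin.subNat, exampleB,
      Matrix.mulVec, dotProduct, Fin.sum_univ_eight] <;> ring

/-- The potential lowers weights, and there are only three of them, so the iterated-integral series
stops after the second order and the solution is polynomial. -/
theorem initialSolutionDeriv_eq (z : ℂ) :
    initialSolutionDeriv z = initialSolution z * offDiagonal (exampleB z) := by
  refine Matrix.mulVec_injective (funext fun v => ?_)
  rw [← Matrix.mulVec_mulVec, initialSolutionDeriv_mulVec, initialSolution_mulVec,
    offDiagonal_exampleB_mulVec]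
  ext i
  fin_cases i <;> simp <;> ring_nf <;> simp [I_sq] <;> ring

theorem initialSolution_zero : initialSolution 0 = 1 := by
  refine Matrix.mulVec_injective (funext fun v => ?_)
  rw [initialSolution_mulVec, Matrix.one_mulVec]
  ext i
  fin_cases i <;> simp

/-- The origin of the isotropic frame: it is the image under `H` of the weight-one space. -/
theorem initialSolution_mulVec_weightVector (z : ℂ) (k : Fin 2) :
    (initialSolution z).mulVec (weightVector k) = frameZero k z := by
  rw [initialSolution_mulVec]
  ext i
  fin_cases k <;> fin_cases i <;> simp [weightVector, frameZero] <;> ring_nf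

/-- The potential lowers the weights by one. -/
theorem rotMatrix_mul_offDiagonal {l : ℂ} (hl : l ≠ 0) (z : ℂ) :
    rotMatrix l * offDiagonal (exampleB z) * rotMatrix l⁻¹ =
      l⁻¹ • offDiagonal (exampleB z) := by
  have h : rotMatrix l * offDiagonal (exampleB z) =
      (l⁻¹ • offDiagonal (exampleB z)) * rotMatrix l := by
    have hl1 : l * l⁻¹ = 1 := mul_inv_cancel₀ hl
    have hI := I_sq
    refine Matrix.mulVec_injective (funext fun v => ?_)
    rw [← Matrix.mulVec_mulVec, ← Matrix.mulVec_mulVec, Matrix.smul_mulVec, rotMatrix_mulVec,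
      rotMatrix_mulVec, offDiagonal_exampleB_mulVec, offDiagonal_exampleB_mulVec]
    -- The inverse becomes a free variable subject only to `l * m = 1`, which leaves polynomial
    -- identities.
    generalize l⁻¹ = m at *
    ext i
    fin_cases i <;> simp
    all_goals grind
  rw [h, Matrix.mul_assoc, rotMatrix_mul_inv hl, Matrix.mul_one]

theorem lorentzAdjoint_initialSolution_mul (z : ℂ) :
    lorentzAdjoint (initialSolution z) * initialSolution z = 1 :=
  mul_eq_one_comm.1 (mul_lorentzAdjoint_eq_one_of_hasDerivAt
    (fun w => lorentzAdjoint_offDiagonal (exampleB w))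
    (fun w => by rw [← initialSolutionDeriv_eq]; exact hasDerivAt_initialSolution w)
    (fun w => by rw [← initialSolutionDeriv_eq]; exact hasDerivAt_initialSolution w)
    initialSolution_zero initialSolution_zero z)

theorem continuous_initialSolution : Continuous initialSolution :=
  continuous_matrix fun _ _ => continuous_const.mul (continuous_pow _)


/-! ### The adapted frame -/

/-- The columns of the frame given by `Y, Y_u, Y_v, N` and two isotropic normal vectors. -/
noncomputable def adaptedColumn (v : Fin 4 → Fin 8 → ℂ) (f : Fin 2 → Fin 8 → ℂ) :
    Fin 8 → Fin 8 → ℂ :=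
  ![v 0 + (1 / 2 : ℂ) • v 3, v 0 - (1 / 2 : ℂ) • v 3, v 2, v 1,
    (1 / 2 : ℂ) • (f 0 + star (f 0)), (I / 2) • (f 0 - star (f 0)),
    (1 / 2 : ℂ) • (f 1 + star (f 1)), (I / 2) • (f 1 - star (f 1))]

/-- The frame given by `Y, Y_u, Y_v, N` and two isotropic normal vectors. -/
noncomputable def adaptedFrame (v : Fin 4 → Fin 8 → ℂ) (f : Fin 2 → Fin 8 → ℂ) :
    Matrix (Fin 8) (Fin 8) ℂ :=
  Matrix.of fun i j => adaptedColumn v f j i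

theorem transpose_mul_I17_mul_apply (A : Matrix (Fin 8) (Fin 8) ℂ) (i j : Fin 8) :
    (A.transpose * I17 ℂ * A) i j = lorentz (fun k => A k i) (fun k => A k j) := by
  rw [Matrix.mul_apply]
  simp only [I17, Matrix.mul_diagonal, Matrix.transpose_apply, lorentz]
  rw [Fin.sum_univ_succ]
  simp

theorem star_adaptedColumn {v : Fin 4 → Fin 8 → ℂ} {f : Fin 2 → Fin 8 → ℂ}
    (hv : ∀ i, star (v i) = v i) (j : Fin 8) :
    star (adaptedColumn v f j) = adaptedColumn v f j := by
  have h1 : ∀ c : ℂ, star (2⁻¹ : ℂ) = 2⁻¹ := by simp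
  have h2 : star (I / 2) = -(I / 2) := by simp [neg_div]
  fin_cases j <;> simp [adaptedColumn, hv] <;> module

/-- As `⟨Y, N⟩ = -1`, the vectors `Y ± N/2` have squares `∓1`; as `⟨f, f̄⟩ = 2`, real and imaginary
parts of `f` are unit vectors. -/
theorem lorentz_adaptedColumn {v : Fin 4 → Fin 8 → ℂ} {f : Fin 2 → Fin 8 → ℂ}
    (hv : ∀ i j, lorentz (v i) (v j) =
      !![0, 0, 0, -1; 0, 1, 0, 0; 0, 0, 1, 0; -1, 0, 0, 0] i j)
    (hf : ∀ i j, lorentz (f i) (f j) = 0)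
    (hfs : ∀ i j, lorentz (f i) (star (f j)) = if i = j then 2 else 0)
    (hvf : ∀ i j, lorentz (v i) (f j) = 0) (hvfs : ∀ i j, lorentz (v i) (star (f j)) = 0)
    (i j : Fin 8) : lorentz (adaptedColumn v f i) (adaptedColumn v f j) = I17 ℂ i j := by
  have hsf : ∀ i j, lorentz (star (f i)) (f j) = if i = j then 2 else 0 := fun i j => by
    rw [lorentz_comm, hfs]
    simp only [eq_comm]
  have hss : ∀ i j, lorentz (star (f i)) (star (f j)) = 0 := fun i j =>
    lorentz_star_eq_zero (hf i j)
  have hfv : ∀ i j, lorentz (f i) (v j) = 0 := fun i j => by rw [lorentz_comm, hvf]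
  have hsv : ∀ i j, lorentz (star (f i)) (v j) = 0 := fun i j => by rw [lorentz_comm, hvfs]
  rw [I17_apply, signs_eq]
  fin_cases i <;> fin_cases j <;>
    simp [adaptedColumn, lorentz_add_left, lorentz_add_right, lorentz_sub_left, lorentz_sub_right,
      lorentz_smul_left, lorentz_smul_right, hv, hf, hfs, hvf, hvfs, hsf, hss, hfv, hsv] <;>
    ring_nf <;> simp [I_sq]

/-- The signs of the normal columns are chosen for this: the frame maps the weight-one space onto
the span of `f`. -/
theorem adaptedFrame_mulVec_weightVector (v : Fin 4 → Fin 8 → ℂ) (f : Fin 2 → Fin 8 → ℂ)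
    (k : Fin 2) : (adaptedFrame v f).mulVec (weightVector k) = f k := by
  ext i
  fin_cases k <;>
    simp [Matrix.mulVec, dotProduct, Fin.sum_univ_eight, adaptedFrame, adaptedColumn,
      weightVector] <;> ring_nf <;> simp [I_sq] <;> ring

theorem adaptedFrame_eq_one {v : Fin 4 → Fin 8 → ℂ}
    (h0 : v 0 = ![1 / 2, 1 / 2, 0, 0, 0, 0, 0, 0]) (h1 : v 1 = ![0, 0, 0, 1, 0, 0, 0, 0])
    (h2 : v 2 = ![0, 0, 1, 0, 0, 0, 0, 0]) (h3 : v 3 = ![1, -1, 0, 0, 0, 0, 0, 0]) :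
    adaptedFrame v weightVector = 1 := by
  refine Matrix.mulVec_injective (funext fun x => ?_)
  rw [Matrix.one_mulVec]
  ext i
  fin_cases i <;>
    simp [Matrix.mulVec, dotProduct, Fin.sum_univ_eight, adaptedFrame, adaptedColumn,
      h0, h1, h2, h3] <;> simp [weightVector] <;> ring_nf <;> simp [I_sq]

/-- The first four columns represent the same oriented 4-space as `Y, Y_u, Y_v, N`. -/
theorem ιMulti_adaptedColumn (v : Fin 4 → Fin 8 → ℂ) (f : Fin 2 → Fin 8 → ℂ) :
    ExteriorAlgebra.ιMulti ℂ 4 (fun k : Fin 4 => adaptedColumn v f (Fin.castAdd 4 k)) =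
      ExteriorAlgebra.ιMulti ℂ 4 v := by
  have h := alternatingMap_sum_smul (ExteriorAlgebra.ιMulti ℂ 4) v
    -- Passing to `Y ± N/2` contributes `-1` and the exchange of `Y_u` and `N` another `-1`; this is
    -- why `Y_v` precedes `Y_u`.
    !![1, 1, 0, 0; 0, 0, 0, 1; 0, 0, 1, 0; 1 / 2, -1 / 2, 0, 0]
  have hd : (!![1, 1, 0, 0; 0, 0, 0, 1; 0, 0, 1, 0; 1 / 2, -1 / 2, 0, 0] :
      Matrix (Fin 4) (Fin 4) ℂ).det = 1 := by
    simp [Matrix.det_succ_row_zero, Fin.sum_univ_succ, Fin.succAbove]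
    norm_num
  rw [hd, one_smul] at h
  rw [← h]
  congr 1
  ext k i
  fin_cases k <;> simp [adaptedColumn, Fin.sum_univ_four]; ring

/-! ### The adapted frame of the example -/

/-- `⟨h₀, h̄₀⟩` as a function of `|z|²`. -/
noncomputable def gramZero (n : ℝ) : ℝ := 2 + 8 * n + 2 / 9 * n ^ 3

/-- The Gram determinant of `h₀`, `h₁` as a function of `|z|²`. -/
noncomputable def gramDet (n : ℝ) : ℝ :=
  (2 + 8 * n + 2 / 9 * n ^ 3) * (2 + 1 / 2 * n ^ 2 + 2 / 9 * n ^ 3) - 4 * n ^ 3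

theorem gramZero_pos {n : ℝ} (hn : 0 ≤ n) : 0 < gramZero n := by
  rw [gramZero]
  positivity

theorem gramDet_pos {n : ℝ} (hn : 0 ≤ n) : 0 < gramDet n := by
  have h : gramDet n = 4 + 16 * n + n ^ 2 + 8 / 9 * n ^ 3 + 16 / 9 * n ^ 4 + 1 / 9 * n ^ 5
      + 4 / 81 * n ^ 6 := by
    rw [gramDet]
    ring
  rw [h]
  positivity

/-- The isotropic frame of the normal bundle made unitary. -/
noncomputable def unitaryFrame (z : ℂ) : Fin 2 → Fin 8 → ℂ :=
  ![((√(2 / gramZero (normSq z)) : ℝ) : ℂ) • frameZero 0 z,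
    ((√(2 * gramZero (normSq z) / gramDet (normSq z)) : ℝ) : ℂ) • (frameZero 1 z -
      (2 * z * starRingEnd ℂ z ^ 2 * ((gramZero (normSq z) : ℝ) : ℂ)⁻¹) • frameZero 0 z)]

theorem contDiff_unitaryFrame (k : Fin 2) : ContDiff ℝ ∞ fun z => unitaryFrame z k := by
  have hn : ContDiff ℝ ∞ fun z : ℂ => normSq z := by
    simp only [normSq_apply]
    exact (reCLM.contDiff.mul reCLM.contDiff).add (imCLM.contDiff.mul imCLM.contDiff)
  have ha : ContDiff ℝ ∞ fun z : ℂ => gramZero (normSq z) := by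
    simp only [gramZero]
    fun_prop
  have hg : ContDiff ℝ ∞ fun z : ℂ => gramDet (normSq z) := by
    simp only [gramDet]
    fun_prop
  have ha0 := fun z : ℂ => gramZero_pos (normSq_nonneg z)
  have hg0 := fun z : ℂ => gramDet_pos (normSq_nonneg z)
  have h0 := contDiff_frameZero 0
  have h1 := contDiff_frameZero 1
  have hc := contDiff_conj
  fin_cases k
  · refine ContDiff.smul (ofRealCLM.contDiff.comp (ContDiff.sqrt (contDiff_const.div ha
      fun z => (ha0 z).ne') fun z => (div_pos two_pos (ha0 z)).ne')) h0
  · refine ContDiff.smul (ofRealCLM.contDiff.comp (ContDiff.sqrt ((contDiff_const.mul ha).div hg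
      fun z => (hg0 z).ne') fun z => (div_pos (mul_pos two_pos (ha0 z)) (hg0 z)).ne')) ?_
    refine h1.sub (ContDiff.smul (f := fun z : ℂ => 2 * z * starRingEnd ℂ z ^ 2 *
      ((gramZero (normSq z) : ℝ) : ℂ)⁻¹) ?_ h0)
    exact ((contDiff_const.mul contDiff_id).mul (hc.pow 2)).mul
      ((ofRealCLM.contDiff.comp ha).inv fun z => ofReal_ne_zero.2 (ha0 z).ne')

theorem ofReal_sqrt_sq {x : ℝ} (hx : 0 ≤ x) : ((√x : ℝ) : ℂ) * ((√x : ℝ) : ℂ) = x := by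
  rw [← ofReal_mul, Real.mul_self_sqrt hx]

theorem unitaryFrame_zero_eq (z : ℂ) : unitaryFrame z 0 =
    ((√(2 / gramZero (normSq z)) : ℝ) : ℂ) • frameZero 0 z := rfl

theorem unitaryFrame_one_eq (z : ℂ) : unitaryFrame z 1 =
    ((√(2 * gramZero (normSq z) / gramDet (normSq z)) : ℝ) : ℂ) • (frameZero 1 z -
      (2 * z * starRingEnd ℂ z ^ 2 * ((gramZero (normSq z) : ℝ) : ℂ)⁻¹) • frameZero 0 z) := rfl

theorem lorentz_unitaryFrame (z : ℂ) (i j : Fin 2) :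
    lorentz (unitaryFrame z i) (unitaryFrame z j) = 0 := by
  revert i j
  simp only [Fin.forall_fin_two, unitaryFrame_zero_eq, unitaryFrame_one_eq, lorentz_smul_left,
    lorentz_smul_right, lorentz_sub_left, lorentz_sub_right, lorentz_frameZero]
  simp

/-- Gram–Schmidt for the Hermitian form: the second vector before scaling has square `gramDet /
gramZero`. The common value 2 is that of the weight vectors. -/
theorem lorentz_unitaryFrame_star (z : ℂ) (i j : Fin 2) :
    lorentz (unitaryFrame z i) (star (unitaryFrame z j)) = if i = j then 2 else 0 := by
  obtain ⟨h1, h2, h3, h4⟩ := lorentz_frameZero_star z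
  have ha := gramZero_pos (normSq_nonneg z)
  have hg := gramDet_pos (normSq_nonneg z)
  have s1 := ofReal_sqrt_sq (div_pos two_pos ha).le
  have s2 := ofReal_sqrt_sq (div_pos (mul_pos two_pos ha) hg).le
  have ha' : ((gramZero (normSq z) : ℝ) : ℂ) ≠ 0 := ofReal_ne_zero.2 ha.ne'
  have hg' : ((gramDet (normSq z) : ℝ) : ℂ) ≠ 0 := ofReal_ne_zero.2 hg.ne'
  have e1 : lorentz (frameZero 0 z) (star (frameZero 0 z)) = ((gramZero (normSq z) : ℝ) : ℂ) := by
    rw [h1, gramZero]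
    push_cast
    rw [normSq_eq]
  have e2 : lorentz (frameZero 1 z) (star (frameZero 1 z)) * ((gramZero (normSq z) : ℝ) : ℂ) =
      ((gramDet (normSq z) : ℝ) : ℂ) + 4 * (z * starRingEnd ℂ z) ^ 3 := by
    rw [h2, gramZero, gramDet]
    push_cast
    rw [normSq_eq]
    ring
  have hstar : ∀ x : ℝ, star (x : ℂ) = x := conj_ofReal
  revert i j
  simp only [Fin.forall_fin_two, unitaryFrame_zero_eq, unitaryFrame_one_eq, lorentz_smul_left,
    lorentz_smul_right, lorentz_sub_left, lorentz_sub_right, star_smul, star_sub, hstar, e1, h3, h4]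
  have hm : star (2 * z * starRingEnd ℂ z ^ 2 * ((gramZero (normSq z) : ℝ) : ℂ)⁻¹) =
      2 * starRingEnd ℂ z * z ^ 2 * ((gramZero (normSq z) : ℝ) : ℂ)⁻¹ := by
    simp
  rw [hm]
  generalize √(2 / gramZero (normSq z)) = c₀ at *
  generalize √(2 * gramZero (normSq z) / gramDet (normSq z)) = c₁ at *
  push_cast at s1 s2
  generalize ((gramZero (normSq z) : ℝ) : ℂ) = a at *
  generalize ((gramDet (normSq z) : ℝ) : ℂ) = g at *
  rw [eq_div_iff ha'] at s1
  rw [eq_div_iff hg'] at s2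
  have hi : a * a⁻¹ = 1 := mul_inv_cancel₀ ha'
  refine ⟨⟨?_, ?_⟩, ?_, ?_⟩
  · rw [if_pos trivial]
    linear_combination s1
  · rw [if_neg (by decide)]
    linear_combination -(c₁ * c₀ * 2 * z ^ 2 * starRingEnd ℂ z) * hi
  · rw [if_neg (by decide)]
    linear_combination -(c₁ * c₀ * 2 * z * starRingEnd ℂ z ^ 2) * hi
  · rw [if_pos trivial]
    generalize lorentz (frameZero 1 z) (star (frameZero 1 z)) = L at *
    linear_combination a⁻¹ * s2 + c₁ * c₁ * a⁻¹ * e2 + (2 - c₁ * c₁ * L +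
      c₁ * c₁ * 4 * (z * starRingEnd ℂ z) ^ 3 * a⁻¹) * hi

theorem unitaryFrame_zero : unitaryFrame 0 = weightVector := by
  ext k i
  fin_cases k <;> fin_cases i <;> simp [unitaryFrame, weightVector, frameZero, gramZero, gramDet]


/-- The frame `Y, Y_u, Y_v, N` of a surface. -/
noncomputable def gaussFrame (y : ℂ → EuclideanSpace ℝ (Fin 7)) (z : ℂ) : Fin 4 → Fin 8 → ℂ :=
  ![canonicalLift y z, fderiv ℝ (canonicalLift y) z 1, fderiv ℝ (canonicalLift y) z I,
    lightlikeN y z]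

theorem star_gaussFrame {y : ℂ → EuclideanSpace ℝ (Fin 7)} (hy : IsConformalImmersion y) (z : ℂ)
    (i : Fin 4) : star (gaussFrame y z i) = gaussFrame y z i := by
  revert i
  simp only [Fin.forall_fin_succ, gaussFrame]
  simp [IsConformalImmersion.star_canonicalLift, hy.star_lightlikeN,
    IsConformalImmersion.fderiv_one, IsConformalImmersion.fderiv_I, hy.star_dz_canonicalLift,
    hy.star_dzbar_canonicalLift]
  constructor
  · rw [add_comm]
  · module

theorem contDiff_gaussFrame {y : ℂ → EuclideanSpace ℝ (Fin 7)} (hy : IsConformalImmersion y)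
    (i : Fin 4) : ContDiff ℝ ∞ fun z => gaussFrame y z i := by
  have hY := hy.contDiff_canonicalLift
  have h1 := contDiff_dz hY
  have h2 := contDiff_dzbar hY
  revert i
  simp only [Fin.forall_fin_succ, gaussFrame]
  refine ⟨hY, ?_, ?_, hy.contDiff_lightlikeN, fun i => i.elim0⟩
  · exact (funext (IsConformalImmersion.fderiv_one y)).symm ▸ h1.add h2
  · exact (funext (IsConformalImmersion.fderiv_I y)).symm ▸ (h1.sub h2).const_smul I

theorem lorentz_gaussFrame_eq_zero {y : ℂ → EuclideanSpace ℝ (Fin 7)} {z : ℂ} {w : Fin 8 → ℂ}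
    (hw : IsNormal y z w) (i : Fin 4) : lorentz (gaussFrame y z i) w = 0 := by
  have c1 := lorentz_comm (canonicalLift y z) w
  have c2 := lorentz_comm (dz (canonicalLift y) z) w
  have c3 := lorentz_comm (dzbar (canonicalLift y) z) w
  have c4 := lorentz_comm (lightlikeN y z) w
  rw [hw.perp_Y] at c1
  rw [hw.perp_Yz] at c2
  rw [hw.perp_Yzbar] at c3
  rw [hw.perp_N] at c4
  revert i
  simp only [Fin.forall_fin_succ, gaussFrame, IsConformalImmersion.fderiv_one,
    IsConformalImmersion.fderiv_I]
  simp [lorentz_add_left, lorentz_smul_left, lorentz_sub_left, c1, c2, c3, c4]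

/-- The adapted frame of the surface for `λ = 1`. -/
noncomputable def exampleFrame (z : ℂ) : Matrix (Fin 8) (Fin 8) ℂ :=
  adaptedFrame (gaussFrame (inCoord chartZero baseSurface) z) (unitaryFrame z)

theorem lorentz_gaussFrame_unitaryFrame (z : ℂ) (i : Fin 4) (j : Fin 2) :
    lorentz (gaussFrame (inCoord chartZero baseSurface) z i) (unitaryFrame z j) = 0 := by
  have h := fun k => lorentz_gaussFrame_eq_zero
    (isIsotropicFrame_zero.isNormal isConformalImmersion_base k z) i
  revert j
  simp only [Fin.forall_fin_two, unitaryFrame_zero_eq, unitaryFrame_one_eq, lorentz_smul_right,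
    lorentz_sub_right, h]
  simp

theorem exampleFrame_orthogonal (z : ℂ) :
    (exampleFrame z).transpose * I17 ℂ * exampleFrame z = I17 ℂ := by
  ext i j
  rw [transpose_mul_I17_mul_apply]
  refine lorentz_adaptedColumn (isConformalImmersion_base.lorentz_gaussFrame z)
    (lorentz_unitaryFrame z) (lorentz_unitaryFrame_star z) (lorentz_gaussFrame_unitaryFrame z)
    (fun i j => ?_) i j
  have h := lorentz_star_eq_zero (lorentz_gaussFrame_unitaryFrame z i j)
  rwa [star_gaussFrame isConformalImmersion_base] at h

theorem star_exampleFrame (z : ℂ) (i j : Fin 8) :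
    starRingEnd ℂ (exampleFrame z i j) = exampleFrame z i j :=
  congrFun (star_adaptedColumn (star_gaussFrame isConformalImmersion_base z) j) i

theorem contDiff_exampleFrame (i j : Fin 8) : ContDiff ℝ ∞ fun z => exampleFrame z i j := by
  have hv := contDiff_gaussFrame isConformalImmersion_base
  have hf := contDiff_unitaryFrame
  have hs := fun k => contDiff_star (hf k)
  have h : ∀ j, ContDiff ℝ ∞ fun z =>
      adaptedColumn (gaussFrame (inCoord chartZero baseSurface) z) (unitaryFrame z) j := by
    intro j
    fin_cases j
    · exact (hv 0).add ((hv 3).const_smul _)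
    · exact (hv 0).sub ((hv 3).const_smul _)
    · exact hv 2
    · exact hv 1
    · exact ((hf 0).add (hs 0)).const_smul _
    · exact ((hf 0).sub (hs 0)).const_smul _
    · exact ((hf 1).add (hs 1)).const_smul _
    · exact ((hf 1).sub (hs 1)).const_smul _
  exact contDiff_pi.1 (h j) i

/-! ### The adapted frame at the origin -/

/-- Applied to the scale of the canonical lift, a function of `|z|²`, this avoids differentiating
the square root. -/
theorem fderiv_eq_zero_of_even {f : ℂ → ℂ} (hf : ∀ z, f (-z) = f z) : fderiv ℝ f 0 = 0 := by
  by_cases hd : DifferentiableAt ℝ f 0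
  · have h1 : HasFDerivAt f (fderiv ℝ f 0) (-0 : ℂ) := by
      rw [neg_zero]
      exact hd.hasFDerivAt
    have h2 := h1.comp 0 (hasFDerivAt_id (0 : ℂ)).neg
    have h3 : f ∘ Neg.neg = f := funext hf
    rw [h3] at h2
    have h4 := h2.fderiv
    ext v
    have h5 := congrArg (fun A => A v) h4
    simp only [ContinuousLinearMap.comp_apply, neg_apply,
      ContinuousLinearMap.id_apply, map_neg] at h5
    exact self_eq_neg.1 h5
  · exact fderiv_zero_of_not_differentiableAt hd

theorem dzbar_canonicalLift_zero :
    dzbar (canonicalLift (inCoord chartZero baseSurface)) 0 =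
      ![0, 0, I / 2, 1 / 2, 0, 0, 0, 0] := by
  set y := inCoord chartZero baseSurface with hyd
  have hy : IsConformalImmersion y := isConformalImmersion_base
  have hn := contDiff_normSq
  have hdn : ContDiff ℝ ∞ fun z : ℂ => denominator (1 : ℂ) (normSq z) := by
    simp only [denominator]
    fun_prop
  have h1 : canonicalLift y = fun z => ((((√(conformalFactor y z))⁻¹ : ℝ) : ℂ) *
      (denominator (1 : ℂ) (normSq z))⁻¹) • liftZero z := by
    ext1 z
    rw [canonicalLift, hyd, coneLift_baseSurface_zero, smul_smul]
  have h2 : ContDiff ℝ ∞ fun z => (((√(conformalFactor y z))⁻¹ : ℝ) : ℂ) *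
      (denominator (1 : ℂ) (normSq z))⁻¹ :=
    hy.contDiff_scale.mul (hdn.inv denominator_zero_ne_zero)
  have h3 : wirtinger I (fun z => (((√(conformalFactor y z))⁻¹ : ℝ) : ℂ) *
      (denominator (1 : ℂ) (normSq z))⁻¹) 0 = 0 := by
    rw [wirtinger, fderiv_eq_zero_of_even]
    · simp
    · intro z
      rw [hyd, conformalFactor_zero, conformalFactor_zero, normSq_neg]
  have h4 : conformalFactor y 0 = 4 := by
    rw [hyd, conformalFactor_zero]
    norm_num [denominator]
  have h5 : √(4 : ℝ) = 2 := by
    rw [show (4 : ℝ) = 2 ^ 2 by norm_num, Real.sqrt_sq two_pos.le]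
  rw [dzbar_eq_wirtinger, h1, wirtinger_smul (differentiableAt_of_contDiff h2 0)
    (differentiableAt_of_contDiff contDiff_liftZero 0), h3, ← dzbar_eq_wirtinger,
    dzbar_liftZero_at_zero, h4, h5]
  ext i
  fin_cases i <;> simp [denominator] <;> ring

theorem canonicalLift_zero :
    canonicalLift (inCoord chartZero baseSurface) 0 = ![1 / 2, 1 / 2, 0, 0, 0, 0, 0, 0] := by
  have h4 : conformalFactor (inCoord chartZero baseSurface) 0 = 4 := by
    rw [conformalFactor_zero]
    norm_num [denominator]
  have h5 : √(4 : ℝ) = 2 := by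
    rw [show (4 : ℝ) = 2 ^ 2 by norm_num, Real.sqrt_sq two_pos.le]
  rw [canonicalLift, coneLift_baseSurface_zero, h4, h5]
  ext i
  fin_cases i <;> simp [denominator, liftZero, lightVector]

theorem dz_canonicalLift_zero :
    dz (canonicalLift (inCoord chartZero baseSurface)) 0 =
      ![0, 0, -I / 2, 1 / 2, 0, 0, 0, 0] := by
  rw [← isConformalImmersion_base.star_dzbar_canonicalLift, dzbar_canonicalLift_zero]
  ext i
  fin_cases i <;> simp

/-- No second derivatives are needed: `N` is recovered from its products with `Y, Y_z, Y_z̄, h₀, h₁,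
h̄₀, h̄₁` and from being null. -/
theorem lightlikeN_zero :
    lightlikeN (inCoord chartZero baseSurface) 0 = ![1, -1, 0, 0, 0, 0, 0, 0] := by
  have hy := isConformalImmersion_base
  have h1 := hy.lorentz_N_Y 0
  have h2 := hy.lorentz_N_N 0
  have h3 := hy.lorentz_N_Yz 0
  have h4 := hy.lorentz_N_Yzbar 0
  have h5 := fun k => (isIsotropicFrame_zero.isNormal hy k 0).perp_N
  have h6 := fun k => (isIsotropicFrame_zero.isNormal_star hy k 0).perp_N
  have a5 := h5 0
  have b5 := h5 1
  have a6 := h6 0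
  have b6 := h6 1
  rw [canonicalLift_zero] at h1
  rw [dz_canonicalLift_zero] at h3
  rw [dzbar_canonicalLift_zero] at h4
  generalize lightlikeN (inCoord chartZero baseSurface) 0 = N at *
  simp [lorentz, Fin.sum_univ_seven, frameZero, Fin.succ] at h1 h2 h3 h4 a5 b5 a6 b6
  have e4 : N 4 = 0 := by linear_combination (a5 + a6) / 2
  have e5 : N 5 = 0 := by linear_combination I * (a5 - a6) / 2 + N 5 * I_sq
  have e6 : N 6 = 0 := by linear_combination (b5 + b6) / 2
  have e7 : N 7 = 0 := by linear_combination I * (b5 - b6) / 2 + N 7 * I_sq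
  have e2 : N 2 = 0 := by linear_combination I * (h3 - h4) + N 2 * I_sq
  have e3 : N 3 = 0 := by linear_combination h3 + h4
  rw [e2, e3, e4, e5, e6, e7] at h2
  have e0 : N 0 = 1 := by linear_combination ((N 0 + N 1) / 2 - 1) * h1 - h2 / 4
  have e1 : N 1 = -1 := by linear_combination e0 + 2 * h1
  ext i
  fin_cases i <;> simp [e0, e1, e2, e3, e4, e5, e6, e7]

theorem exampleFrame_zero : exampleFrame 0 = 1 := by
  rw [exampleFrame, unitaryFrame_zero]
  refine adaptedFrame_eq_one ?_ ?_ ?_ ?_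
  · exact canonicalLift_zero
  · simp only [gaussFrame, Matrix.cons_val]
    rw [IsConformalImmersion.fderiv_one, dz_canonicalLift_zero, dzbar_canonicalLift_zero]
    ext i
    fin_cases i <;> simp <;> ring
  · simp only [gaussFrame, Matrix.cons_val]
    rw [IsConformalImmersion.fderiv_I, dz_canonicalLift_zero, dzbar_canonicalLift_zero]
    ext i
    fin_cases i <;> simp <;> ring_nf <;> simp
  · exact lightlikeN_zero


/-! ### The extended frame of the example -/

theorem lorentzAdjoint_mul_mul {R : Type*} [CommRing R] {A C : Matrix (Fin 8) (Fin 8) R}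
    (hA : lorentzAdjoint A * A = 1) (hC : lorentzAdjoint C * C = 1) :
    lorentzAdjoint (A * C) * (A * C) = 1 := by
  rw [lorentzAdjoint_mul, Matrix.mul_assoc, ← Matrix.mul_assoc _ A, hA, Matrix.one_mul, hC]

theorem continuous_lorentzAdjoint {X : Type*} [TopologicalSpace X]
    {A : X → Matrix (Fin 8) (Fin 8) ℂ} (hA : Continuous A) :
    Continuous fun x => lorentzAdjoint (A x) :=
  (continuous_const.matrix_mul hA.matrix_transpose).matrix_mul continuous_const

/-- Orthogonality leaves determinants a sign; connectedness of the plane and the value at the origin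
fix it. -/
theorem eq_one_of_mul_self_eq_one {f : ℂ → ℂ} (hf : Continuous f) (h : ∀ z, f z * f z = 1)
    (h0 : f 0 = 1) (z : ℂ) : f z = 1 := by
  rcases isPreconnected_univ.eq_or_eq_neg_of_sq_eq (f := f) (g := fun _ => 1) hf.continuousOn
    continuousOn_const (fun w _ => by simp [pow_two, h]) (by simp) with h1 | h1
  · exact h1 (Set.mem_univ z)
  · have := h1 (Set.mem_univ 0)
    rw [h0] at this
    norm_num at this

theorem det_eq_one_of_lorentzAdjoint {A : ℂ → Matrix (Fin 8) (Fin 8) ℂ} (hA : Continuous A)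
    (h : ∀ z, lorentzAdjoint (A z) * A z = 1) (h0 : A 0 = 1) (z : ℂ) : (A z).det = 1 := by
  refine eq_one_of_mul_self_eq_one hA.matrix_det (fun z => ?_) (by rw [h0, Matrix.det_one]) z
  have h1 := congrArg Matrix.det (h z)
  have h2 := congrArg Matrix.det (I17_mul_self (R := ℂ))
  rw [Matrix.det_mul, lorentzAdjoint, Matrix.det_mul, Matrix.det_mul, Matrix.det_transpose,
    Matrix.det_one] at h1
  rw [Matrix.det_mul, Matrix.det_one] at h2
  linear_combination h1 - (A z).det * (A z).det * h2

theorem continuous_exampleFrame : Continuous exampleFrame :=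
  continuous_matrix fun i j => (contDiff_exampleFrame i j).continuous

theorem lorentzAdjoint_exampleFrame_mul (z : ℂ) :
    lorentzAdjoint (exampleFrame z) * exampleFrame z = 1 :=
  lorentzAdjoint_mul_eq_one (exampleFrame_orthogonal z)

/-- The quotient `F⁻¹ H` for `λ = 1`. -/
noncomputable def exampleQuotient (z : ℂ) : Matrix (Fin 8) (Fin 8) ℂ :=
  lorentzAdjoint (exampleFrame z) * initialSolution z

theorem continuous_exampleQuotient : Continuous exampleQuotient :=
  (continuous_lorentzAdjoint continuous_exampleFrame).matrix_mul continuous_initialSolution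

theorem exampleQuotient_zero : exampleQuotient 0 = 1 := by
  rw [exampleQuotient, exampleFrame_zero, initialSolution_zero]
  simp [lorentzAdjoint, I17_mul_self]

theorem lorentzAdjoint_exampleQuotient_mul (z : ℂ) :
    lorentzAdjoint (exampleQuotient z) * exampleQuotient z = 1 := by
  refine lorentzAdjoint_mul_mul ?_ (lorentzAdjoint_initialSolution_mul z)
  rw [lorentzAdjoint_lorentzAdjoint]
  exact mul_eq_one_comm.1 (lorentzAdjoint_exampleFrame_mul z)

theorem exampleFrame_mul_exampleQuotient (z : ℂ) :
    exampleFrame z * exampleQuotient z = initialSolution z := by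
  rw [exampleQuotient, ← Matrix.mul_assoc, mul_eq_one_comm.1 (lorentzAdjoint_exampleFrame_mul z),
    Matrix.one_mul]

/-- A linear map which annihilates the unitary frame annihilates the holomorphic frame. -/
theorem forall_unitaryFrame_iff {T : Matrix (Fin 8) (Fin 8) ℂ} {z : ℂ} :
    (∀ k, T.mulVec (unitaryFrame z k) = 0) ↔ ∀ k, T.mulVec (frameZero k z) = 0 := by
  have ha := gramZero_pos (normSq_nonneg z)
  have hg := gramDet_pos (normSq_nonneg z)
  have h0 : ((√(2 / gramZero (normSq z)) : ℝ) : ℂ) ≠ 0 :=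
    ofReal_ne_zero.2 (Real.sqrt_pos.2 (div_pos two_pos ha)).ne'
  have h1 : ((√(2 * gramZero (normSq z) / gramDet (normSq z)) : ℝ) : ℂ) ≠ 0 :=
    ofReal_ne_zero.2 (Real.sqrt_pos.2 (div_pos (mul_pos two_pos ha) hg)).ne'
  simp only [Fin.forall_fin_two, unitaryFrame_zero_eq, unitaryFrame_one_eq, Matrix.mulVec_smul,
    Matrix.mulVec_sub, smul_eq_zero, h0, h1, false_or]
  constructor
  · rintro ⟨e0, e1⟩
    rw [e0, smul_zero, sub_zero] at e1
    exact ⟨e0, e1⟩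
  · rintro ⟨e0, e1⟩
    rw [e0, e1]
    simp

/-- `H` and `F` map the weight-one space onto the same plane, spanned by `h₀` and `h₁`. So `F⁻¹H`
preserves that space, stated here through matrices `T` annihilating it. -/
theorem mulVec_exampleQuotient {T : Matrix (Fin 8) (Fin 8) ℂ}
    (hT : ∀ k, T.mulVec (weightVector k) = 0) (z : ℂ) (k : Fin 2) :
    T.mulVec ((exampleQuotient z).mulVec (weightVector k)) = 0 := by
  have h := forall_unitaryFrame_iff (T := T * lorentzAdjoint (exampleFrame z)) (z := z)
  rw [exampleQuotient, Matrix.mulVec_mulVec, ← Matrix.mul_assoc, ← Matrix.mulVec_mulVec,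
    initialSolution_mulVec_weightVector]
  refine h.1 (fun k => ?_) k
  rw [← adaptedFrame_mulVec_weightVector (gaussFrame (inCoord chartZero baseSurface) z)
    (unitaryFrame z), ← exampleFrame, Matrix.mulVec_mulVec, Matrix.mul_assoc,
    lorentzAdjoint_exampleFrame_mul, Matrix.mul_one, hT]

theorem mulVec_lorentzAdjoint_exampleQuotient {T : Matrix (Fin 8) (Fin 8) ℂ}
    (hT : ∀ k, T.mulVec (weightVector k) = 0) (z : ℂ) (k : Fin 2) :
    T.mulVec ((lorentzAdjoint (exampleQuotient z)).mulVec (weightVector k)) = 0 := by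
  have h := forall_unitaryFrame_iff (T := T * lorentzAdjoint (initialSolution z)) (z := z)
  rw [exampleQuotient, lorentzAdjoint_mul, lorentzAdjoint_lorentzAdjoint, Matrix.mulVec_mulVec,
    ← Matrix.mul_assoc, ← Matrix.mulVec_mulVec, exampleFrame, adaptedFrame_mulVec_weightVector]
  refine h.2 (fun k => ?_) k
  rw [← initialSolution_mulVec_weightVector, Matrix.mulVec_mulVec, Matrix.mul_assoc,
    lorentzAdjoint_initialSolution_mul, Matrix.mul_one, hT]

theorem conjLoop_exampleQuotient (z : ℂ) {l : ℂ} (hl : l ≠ 0) :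
    conjLoop (exampleQuotient z) l = rotMatrix l * exampleQuotient z * rotMatrix l⁻¹ :=
  conjLoop_eq (mulVec_exampleQuotient (fun k => (proj_mulVec_weightVector k).1) z)
    (mulVec_exampleQuotient (fun k => (proj_mulVec_weightVector k).2) z)
    (mulVec_lorentzAdjoint_exampleQuotient (fun k => (proj_mulVec_weightVector k).1) z) hl

theorem lorentzAdjoint_rotMatrix_mul {l : ℂ} (hl : l ≠ 0) :
    lorentzAdjoint (rotMatrix l) * rotMatrix l = 1 :=
  lorentzAdjoint_mul_eq_one (rotMatrix_orthogonal hl)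

theorem lorentzAdjoint_conjugate {l : ℂ} (hl : l ≠ 0) {A : Matrix (Fin 8) (Fin 8) ℂ}
    (hA : lorentzAdjoint A * A = 1) :
    lorentzAdjoint (rotMatrix l * A * rotMatrix l⁻¹) * (rotMatrix l * A * rotMatrix l⁻¹) = 1 :=
  lorentzAdjoint_mul_mul (lorentzAdjoint_mul_mul (lorentzAdjoint_rotMatrix_mul hl) hA)
    (lorentzAdjoint_rotMatrix_mul (inv_ne_zero hl))

theorem det_conjugate {l : ℂ} (hl : l ≠ 0) {A : Matrix (Fin 8) (Fin 8) ℂ} (hA : A.det = 1) :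
    (rotMatrix l * A * rotMatrix l⁻¹).det = 1 := by
  rw [Matrix.det_mul, Matrix.det_mul, hA, mul_one, ← Matrix.det_mul, rotMatrix_mul_inv hl,
    Matrix.det_one]

/-- For `l ≠ 0` the loop is a conjugate of an isometry; the value at `l = 0` follows by continuity.
-/
theorem lorentzAdjoint_conjLoop_mul (z l : ℂ) :
    lorentzAdjoint (conjLoop (exampleQuotient z) l) * conjLoop (exampleQuotient z) l = 1 := by
  have hc : Continuous fun l => conjLoop (exampleQuotient z) l :=
    continuous_conjLoop continuous_const continuous_id
  have h := Continuous.ext_on (dense_compl_singleton (0 : ℂ))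
    ((continuous_lorentzAdjoint hc).matrix_mul hc) (continuous_const (y := 1)) fun l hl => by
      rw [conjLoop_exampleQuotient z hl]
      exact lorentzAdjoint_conjugate hl (lorentzAdjoint_exampleQuotient_mul z)
  exact congrFun h l

theorem det_conjLoop (z l : ℂ) : (conjLoop (exampleQuotient z) l).det = 1 := by
  have hc : Continuous fun l => conjLoop (exampleQuotient z) l :=
    continuous_conjLoop continuous_const continuous_id
  have h := Continuous.ext_on (dense_compl_singleton (0 : ℂ)) hc.matrix_det
    (continuous_const (y := 1)) fun l hl => by
      rw [conjLoop_exampleQuotient z hl]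
      exact det_conjugate hl (det_eq_one_of_lorentzAdjoint continuous_exampleQuotient
        lorentzAdjoint_exampleQuotient_mul exampleQuotient_zero z)
  exact congrFun h l

/-- At `l = 0` the matrix is block diagonal, so its upper block is a complex Lorentz matrix of
determinant `±1`, depending continuously on `z` and equal to the identity at `z = 0`. -/
theorem det_submatrix_conjLoop (z : ℂ) :
    ((conjLoop (exampleQuotient z) 0).submatrix (Fin.castAdd 4 : Fin 4 → Fin 8)
      (Fin.castAdd 4 : Fin 4 → Fin 8)).det = 1 := by
  refine eq_one_of_mul_self_eq_one (f := fun z => ((conjLoop (exampleQuotient z) 0).submatrix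
    (Fin.castAdd 4 : Fin 4 → Fin 8) (Fin.castAdd 4 : Fin 4 → Fin 8)).det) ?_ (fun z => ?_) ?_ z
  · exact ((continuous_conjLoop continuous_exampleQuotient continuous_const).matrix_submatrix
      _ _).matrix_det
  · set P := conjLoop (exampleQuotient z) 0 with hP
    have ht : P = involD ℂ * P * involD ℂ := by
      rw [hP, ← conjLoop_neg, neg_zero]
    have h1 : (I13 * (P.submatrix (Fin.castAdd 4 : Fin 4 → Fin 8) (Fin.castAdd 4)).transpose *
        I13) * P.submatrix (Fin.castAdd 4 : Fin 4 → Fin 8) (Fin.castAdd 4) = 1 := by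
      ext i j
      have h2 := congrFun (congrFun (lorentzAdjoint_conjLoop_mul z 0) (Fin.castAdd 4 i))
        (Fin.castAdd 4 j)
      rw [← hP, Matrix.mul_apply, Fin.sum_univ_add (a := 4) (b := 4)] at h2
      have h3 : ∀ k : Fin 4, P (Fin.natAdd 4 k) (Fin.castAdd 4 j) = 0 :=
        fun k => apply_eq_zero_of_twisted ht k j
      have h4 : (1 : Matrix (Fin 8) (Fin 8) ℂ) (Fin.castAdd 4 i) (Fin.castAdd 4 j) =
          (1 : Matrix (Fin 4) (Fin 4) ℂ) i j := by
        simp only [Matrix.one_apply, Fin.ext_iff, Fin.val_castAdd]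
      simp only [h3, mul_zero, Finset.sum_const_zero, add_zero, h4] at h2
      rw [← h2, Matrix.mul_apply]
      refine Finset.sum_congr rfl fun k _ => ?_
      rw [Matrix.submatrix_apply, lorentzAdjoint_apply, I13, Matrix.mul_diagonal,
        Matrix.diagonal_mul, Matrix.transpose_apply, Matrix.submatrix_apply]
      have h5 : ∀ k : Fin 4, (Fin.cons (-1) fun _ => 1 : Fin 8 → ℂ) (Fin.castAdd 4 k) =
          (![-1, 1, 1, 1] : Fin 4 → ℂ) k := fun k => by fin_cases k <;> rfl
      rw [h5, h5]
    have h4 : I13.det * I13.det = 1 := by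
      simp [I13, Matrix.det_diagonal, Fin.prod_univ_four]
    have h6 := congrArg Matrix.det h1
    rw [Matrix.det_mul, Matrix.det_mul, Matrix.det_mul, Matrix.det_transpose, Matrix.det_one] at h6
    set d := (P.submatrix (Fin.castAdd 4 : Fin 4 → Fin 8) (Fin.castAdd 4)).det
    linear_combination h6 - d * d * h4
  · simp only [exampleQuotient_zero, conjLoop_one]
    rw [Matrix.submatrix_one _ (Fin.castAdd_injective 4 4), Matrix.det_one]


/-! ### Real form of the frame, and the associated family -/

/-- The real matrix underlying the rotated frame. -/
noncomputable def exampleExtendedFrame (z : ℂ) (l : Circle) : Matrix (Fin 8) (Fin 8) ℝ :=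
  (rotMatrix l * exampleFrame z * rotMatrix (l : ℂ)⁻¹).map re

theorem star_rotMatrix (l : Circle) (i j : Fin 8) :
    starRingEnd ℂ (rotMatrix l i j) = rotMatrix l i j := by
  have h := congrFun ((isRealIsometry_rotMap l).star_map (Pi.single j 1)) i
  have h1 : star (Pi.single j 1 : Fin 8 → ℂ) = Pi.single j 1 := by
    ext k
    rcases eq_or_ne k j with rfl | hk
    · simp
    · simp [hk]
  rw [h1, rotMap_apply, Matrix.mulVec_single_one] at h
  exact h

theorem map_exampleExtendedFrame (z : ℂ) (l : Circle) :
    (exampleExtendedFrame z l).map ofReal =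
      rotMatrix l * exampleFrame z * rotMatrix (l : ℂ)⁻¹ := by
  have h : ∀ {A C : Matrix (Fin 8) (Fin 8) ℂ}, (∀ i j, starRingEnd ℂ (A i j) = A i j) →
      (∀ i j, starRingEnd ℂ (C i j) = C i j) → ∀ i j, starRingEnd ℂ ((A * C) i j) = (A * C) i j :=
    fun hA hC i j => by simp [Matrix.mul_apply, hA, hC]
  ext i j
  refine conj_eq_iff_re.1 (h (h (star_rotMatrix l) (star_exampleFrame z)) (fun i j => ?_) i j)
  rw [← Circle.coe_inv]
  exact star_rotMatrix l⁻¹ i j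

theorem map_ofReal_injective :
    Function.Injective fun A : Matrix (Fin 8) (Fin 8) ℝ => A.map ofReal :=
  Matrix.map_injective ofReal_injective

theorem map_ofReal_mul (A C : Matrix (Fin 8) (Fin 8) ℝ) :
    (A * C).map ofReal = A.map ofReal * C.map ofReal :=
  Matrix.map_mul (f := ofRealHom)

theorem map_ofReal_one : (1 : Matrix (Fin 8) (Fin 8) ℝ).map ofReal = 1 :=
  Matrix.map_one _ ofReal_zero ofReal_one

theorem map_ofReal_involD : (involD ℝ).map ofReal = involD ℂ := by
  rw [involD, Matrix.diagonal_map ofReal_zero, involD]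
  congr 1
  ext i
  fin_cases i <;> simp

theorem lorentzAdjoint_exampleExtendedFrame_mul (z : ℂ) (l : Circle) :
    lorentzAdjoint (exampleExtendedFrame z l) * exampleExtendedFrame z l = 1 := by
  apply map_ofReal_injective
  simp only [map_ofReal_mul, map_ofReal_one, ← lorentzAdjoint_map, map_exampleExtendedFrame]
  exact lorentzAdjoint_conjugate l.coe_ne_zero (lorentzAdjoint_exampleFrame_mul z)

theorem exampleExtendedFrame_zero_zero (z : ℂ) (l : Circle) :
    exampleExtendedFrame z l 0 0 = (exampleFrame z 0 0).re := by
  rw [exampleExtendedFrame, Matrix.map_apply, Matrix.mul_apply, Fin.sum_univ_eight]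
  simp [Matrix.mul_apply, Fin.sum_univ_eight, rotMatrix]

/-- The first column is real with Lorentzian square `-1`, so its time component never vanishes; by
continuity it keeps the sign it has at the origin. -/
theorem exampleFrame_zero_zero_pos (z : ℂ) : 0 < (exampleFrame z 0 0).re := by
  have hc : Continuous fun z => (exampleFrame z 0 0).re :=
    continuous_re.comp (contDiff_exampleFrame 0 0).continuous
  have hne : ∀ z, (exampleFrame z 0 0).re ≠ 0 := by
    intro z h0
    have h := congrFun (congrFun (lorentzAdjoint_exampleExtendedFrame_mul z 1) 0) 0
    rw [Matrix.mul_apply, Fin.sum_univ_succ] at h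
    simp only [lorentzAdjoint_apply, exampleExtendedFrame_zero_zero, h0, Fin.cons_succ,
      Fin.cons_zero, Matrix.one_apply_eq] at h
    have h1 : ∑ i : Fin 7, -1 * exampleExtendedFrame z 1 i.succ 0 * 1 *
        exampleExtendedFrame z 1 i.succ 0 ≤ 0 := Finset.sum_nonpos fun i _ => by
        have := mul_self_nonneg (exampleExtendedFrame z 1 i.succ 0)
        linarith
    linarith
  by_contra hz
  have h0 : (exampleFrame 0 0 0).re = 1 := by
    rw [exampleFrame_zero]
    simp
  obtain ⟨w, hw⟩ := mem_range_of_exists_le_of_exists_ge hc ⟨z, not_lt.1 hz⟩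
    ⟨0, by rw [h0]; exact zero_le_one⟩
  exact hne w hw

theorem continuous_circle_coe : Continuous fun l : Circle => (l : ℂ) := continuous_subtype_val

theorem continuous_exampleExtendedFrame (z : ℂ) : Continuous (exampleExtendedFrame z) := by
  have h1 : Continuous fun l : Circle => rotMatrix l := by
    have h2 : (fun l : Circle => rotMatrix l) = fun l : Circle =>
        projZero + (l : ℂ) • projPos + ((l⁻¹ : Circle) : ℂ) • projNeg := by
      ext1 l
      rw [rotMatrix_eq, Circle.coe_inv]
    rw [h2]
    exact (continuous_const.add (continuous_circle_coe.smul continuous_const)).add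
      ((continuous_circle_coe.comp continuous_inv).smul continuous_const)
  have h3 : Continuous fun l : Circle => rotMatrix (l : ℂ)⁻¹ := by
    simp only [← Circle.coe_inv]
    exact h1.comp continuous_inv
  exact ((h1.matrix_mul continuous_const).matrix_mul h3).matrix_map continuous_re

theorem contDiff_exampleExtendedFrame (l : Circle) (i j : Fin 8) :
    ContDiff ℝ ∞ fun z => exampleExtendedFrame z l i j := by
  simp only [exampleExtendedFrame, Matrix.map_apply, Matrix.mul_apply]
  have h : ContDiff ℝ ∞ fun z => ∑ k, (∑ m, rotMatrix l i m * exampleFrame z m k) *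
      rotMatrix (l : ℂ)⁻¹ k j := ContDiff.sum fun k _ =>
    (ContDiff.sum fun m _ => contDiff_const.mul (contDiff_exampleFrame m k)).mul contDiff_const
  exact reCLM.contDiff.comp h

/-- Each factor is the conjugate by the rotation of its value at `λ = 1`, so the factorization
reduces to that case; the polynomial `conjLoop` supplies the extension to the disk. -/
theorem isExtendedFrame_example : IsExtendedFrame exampleB
    (fun z l => rotMatrix l * initialSolution z * rotMatrix (l : ℂ)⁻¹) exampleExtendedFrame
    (fun z l => conjLoop (exampleQuotient z) l) where
  hol_init l := by
    rw [initialSolution_zero, Matrix.mul_one, rotMatrix_mul_inv l.coe_ne_zero]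
  hol_deriv l z i j := by
    have h1 := rotMatrix_mul_offDiagonal l.coe_ne_zero z
    have h2 : rotMatrix l * initialSolution z * rotMatrix (l : ℂ)⁻¹ *
        ((l : ℂ)⁻¹ • offDiagonal (exampleB z)) =
        rotMatrix l * initialSolutionDeriv z * rotMatrix (l : ℂ)⁻¹ := by
      have h3 : rotMatrix l * initialSolution z * rotMatrix (l : ℂ)⁻¹ *
          (rotMatrix l * offDiagonal (exampleB z) * rotMatrix (l : ℂ)⁻¹) =
          rotMatrix l * initialSolution z * (rotMatrix (l : ℂ)⁻¹ * rotMatrix l) *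
            offDiagonal (exampleB z) * rotMatrix (l : ℂ)⁻¹ := by noncomm_ring
      rw [← h1, h3, mul_eq_one_comm.1 (rotMatrix_mul_inv l.coe_ne_zero), Matrix.mul_one,
        initialSolutionDeriv_eq]
      noncomm_ring
    rw [h2]
    simp only [Matrix.mul_apply]
    exact HasDerivAt.fun_sum fun k _ => (HasDerivAt.fun_sum fun m _ =>
      (hasDerivAt_initialSolution z m k).const_mul _).mul_const _
  iwasawa z l := by
    have h3 : rotMatrix l * exampleFrame z * rotMatrix (l : ℂ)⁻¹ *
        (rotMatrix l * exampleQuotient z * rotMatrix (l : ℂ)⁻¹) =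
        rotMatrix l * exampleFrame z * (rotMatrix (l : ℂ)⁻¹ * rotMatrix l) *
          exampleQuotient z * rotMatrix (l : ℂ)⁻¹ := by noncomm_ring
    rw [map_exampleExtendedFrame, conjLoop_exampleQuotient z l.coe_ne_zero, h3,
      mul_eq_one_comm.1 (rotMatrix_mul_inv l.coe_ne_zero), Matrix.mul_one,
      ← exampleFrame_mul_exampleQuotient]
    noncomm_ring
  frame_init l := by
    apply map_ofReal_injective
    simp only [map_exampleExtendedFrame, map_ofReal_one]
    rw [exampleFrame_zero, Matrix.mul_one, rotMatrix_mul_inv l.coe_ne_zero]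
  frame_smooth := contDiff_exampleExtendedFrame
  frame_continuous := continuous_exampleExtendedFrame
  frame_orthogonal z l :=
    transpose_mul_I17_mul_of_lorentzAdjoint (lorentzAdjoint_exampleExtendedFrame_mul z l)
  frame_det z l := by
    apply ofReal_injective
    rw [ofReal_one, ← det_conjugate l.coe_ne_zero (det_eq_one_of_lorentzAdjoint
      continuous_exampleFrame lorentzAdjoint_exampleFrame_mul exampleFrame_zero z),
      ← map_exampleExtendedFrame]
    exact RingHom.map_det ofRealHom _
  frame_orthochronous z l := by
    rw [exampleExtendedFrame_zero_zero]
    exact exampleFrame_zero_zero_pos z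
  frame_twisted z l := by
    apply map_ofReal_injective
    simp only [map_ofReal_mul, map_exampleExtendedFrame, map_ofReal_involD]
    rw [Circle.coe_neg, (rotMatrix_neg l).1, inv_neg, (rotMatrix_neg _).2]
    noncomm_ring
  plus_hol z i j := by
    refine Differentiable.diffContOnCl ?_
    simp only [conjLoop, Matrix.add_apply, Matrix.smul_apply, smul_eq_mul]
    fun_prop
  plus_orthogonal z l _ :=
    transpose_mul_I17_mul_of_lorentzAdjoint (lorentzAdjoint_conjLoop_mul z l)
  plus_det z l _ := det_conjLoop z l
  plus_twisted z l _ := conjLoop_neg _ l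
  plus_zero := det_submatrix_conjLoop

theorem conformalGaussMap_exampleSurface (l : Circle) (z : ℂ) :
    conformalGaussMap (inCoord chartZero (exampleSurface l)) z =
      ExteriorAlgebra.ιMulti ℂ 4 (fun k : Fin 4 => fun i : Fin 8 =>
        ((exampleExtendedFrame z l i (Fin.castAdd 4 k) : ℝ) : ℂ)) := by
  have hA := isRealIsometry_rotMap l
  have hy := isConformalImmersion_base
  have hyy := coneLift_exampleSurface l chartZero
  have h1 : (fun k : Fin 4 => fun i : Fin 8 =>
      ((exampleExtendedFrame z l i (Fin.castAdd 4 k) : ℝ) : ℂ)) = rotMap l ∘ fun k : Fin 4 =>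
        adaptedColumn (gaussFrame (inCoord chartZero baseSurface) z) (unitaryFrame z)
          (Fin.castAdd 4 k) := by
    ext k i
    have h2 := congrFun (congrFun (map_exampleExtendedFrame z l) i) (Fin.castAdd 4 k)
    rw [Matrix.map_apply] at h2
    -- The rotations fix the first four basis vectors, so the right factor of the conjugation does
    -- not affect the columns entering the Gauss map.
    have h3 : (rotMatrix (l : ℂ)⁻¹).mulVec (Pi.single (Fin.castAdd 4 k) 1) =
        Pi.single (Fin.castAdd 4 k) 1 := by
      rw [rotMatrix_mulVec]
      ext i
      fin_cases k <;> fin_cases i <;> simp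
    have h4 : (rotMatrix l * exampleFrame z * rotMatrix (l : ℂ)⁻¹) i (Fin.castAdd 4 k) =
        ((rotMatrix l * exampleFrame z * rotMatrix (l : ℂ)⁻¹).mulVec
          (Pi.single (Fin.castAdd 4 k) 1)) i := by
      rw [Matrix.mulVec_single_one]
      rfl
    rw [h2, h4, ← Matrix.mulVec_mulVec, h3, ← Matrix.mulVec_mulVec, Matrix.mulVec_single_one]
    rfl
  have h5 : (![canonicalLift (inCoord chartZero (exampleSurface l)) z,
      fderiv ℝ (canonicalLift (inCoord chartZero (exampleSurface l))) z 1,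
      fderiv ℝ (canonicalLift (inCoord chartZero (exampleSurface l))) z I,
      lightlikeN (inCoord chartZero (exampleSurface l)) z] : Fin 4 → Fin 8 → ℂ) =
      rotMap l ∘ gaussFrame (inCoord chartZero baseSurface) z := by
    rw [hA.canonicalLift_eq hy.smooth hyy, hA.fderiv_canonicalLift_eq hy hyy,
      hA.fderiv_canonicalLift_eq hy hyy, hA.lightlikeN_eq hy hyy]
    ext k
    fin_cases k <;> rfl
  have h6 := fun m : Fin 4 → Fin 8 → ℂ =>
    ExteriorAlgebra.map_apply_ιMulti (R := ℂ) (rotMap l).toLinearMap m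
  rw [conformalGaussMap, h5, h1]
  exact (h6 _).symm.trans ((congrArg _ (ιMulti_adaptedColumn _ _).symm).trans (h6 _))

theorem isAssociatedFamily_exampleSurface :
    IsAssociatedFamily exampleB fun l => inCoord chartZero (exampleSurface l) :=
  ⟨isConformalImmersion_example_zero, _, _, _, isExtendedFrame_example,
    conformalGaussMap_exampleSurface⟩

theorem eq_exampleSurface_of_isAssociatedFamily {y : Circle → ℂ → EuclideanSpace ℝ (Fin 7)}
    (hy : IsAssociatedFamily exampleB y) (l : Circle) (z : ℂ) :
    y l z = exampleSurface l (chartZero z) := by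
  obtain ⟨hy1, H, F, P, hF, hG⟩ := hy
  refine (isIsotropicFrame_example_zero l).eq_of_conformalGaussMap_eq
    (isConformalImmersion_example_zero l) (hy1 l) (fun w => ?_) z
  rw [hG, conformalGaussMap_exampleSurface]
  exact isExtendedFrame_example.ιMulti_eq hF w l

end WillmoreTwoSphere

theorem mainTheorem7 :
    ∃ x : Circle → WillmoreTwoSphere.S2 → WillmoreTwoSphere.S6,
      -- the explicit formula
      (∀ (l : Circle) (z : ℂ) (j : Fin 7),
        (((x l (WillmoreTwoSphere.chartZero z) : EuclideanSpace ℝ (Fin 7)) j : ℝ) : ℂ)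
          = WillmoreTwoSphere.exampleFormula (l : ℂ) z j) ∧
      -- it is the associated family of the potential
      WillmoreTwoSphere.IsAssociatedFamily WillmoreTwoSphere.exampleB
        (fun l => WillmoreTwoSphere.inCoord WillmoreTwoSphere.chartZero (x l)) ∧
      (∀ y : Circle → ℂ → EuclideanSpace ℝ (Fin 7),
        WillmoreTwoSphere.IsAssociatedFamily WillmoreTwoSphere.exampleB y →
          ∀ l z, y l z = x l (WillmoreTwoSphere.chartZero z)) ∧
      -- geometric properties of every member
      (∀ l : Circle,
        WillmoreTwoSphere.IsWillmoreImmersion (x l) ∧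
        WillmoreTwoSphere.IsFull (x l) ∧
        ¬ WillmoreTwoSphere.IsSWillmore (x l) ∧
        WillmoreTwoSphere.IsTotallyIsotropic (x l)) ∧
      -- any two members differ by an isometry of the six-sphere
      (∀ l m : Circle,
        ∃ A : EuclideanSpace ℝ (Fin 7) ≃ₗᵢ[ℝ] EuclideanSpace ℝ (Fin 7),
          ∀ p, (x m p : EuclideanSpace ℝ (Fin 7)) = A (x l p)) := by
  exact ⟨WillmoreTwoSphere.exampleSurface, WillmoreTwoSphere.exampleSurface_formula,
    WillmoreTwoSphere.isAssociatedFamily_exampleSurface,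
    fun _ hy => WillmoreTwoSphere.eq_exampleSurface_of_isAssociatedFamily hy,
    fun l => ⟨(WillmoreTwoSphere.exampleSurface_willmore l).1,
      WillmoreTwoSphere.isFull_exampleSurface l, WillmoreTwoSphere.not_isSWillmore_exampleSurface l,
      (WillmoreTwoSphere.exampleSurface_willmore l).2⟩,
    WillmoreTwoSphere.exampleSurface_isometry⟩
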